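/- A planar tree $T$ is a rooted, locally finite tree whose generations $D_0(T),D_1(T),D_2(T),\dots$ ($D_r(T)$ is the set of vertices at height $r$, i.e. at distance $r$ from the root) are finite ordered sets with order-preserving parent maps $D_{r+1}(T)\to D_r(T)$, and with $|D_0(T)|=|D_1(T)|=1$; isomorphic trees are identified. The size $|T|\in\mathbb N\cup\{\infty\}$ is the number of edges of $T$, $h(T)$ is the maximal height of a vertex of $T$ when $T$ is finite, and for $r\ge 1$, $B_r(T)$ is the subtree spanned by the vertices at distance at most $r$ from the root, so that $|B_r(T)|=\sum_{s=1}^r|D_s(T)|$. The set $\mathcal T$ of planar trees carries the metric $\mathrm{dist}(T,T')=\inf\{1/r : r\ge 1,\ B_r(T)=B_r(T')\}$ and its Borel $\sigma$-algebra. The spine $\chi(T)$ of an infinite tree $T$ is the subtree spanned by the vertices that have infinitely many descendants. Let $\mu>0$, and for $N\ge 1$ let $\nu_N^{(\mu)}$ be the probability measure on $\mathcal T$, supported on $\{T : |T|=N\}$, with $$\nu_N^{(\mu)}(\{T\})=\frac{e^{-\mu h(T)}}{Z_N^{(\mu)}}\quad (|T|=N),\qquad Z_N^{(\mu)}=\sum_{|T|=N}e^{-\mu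 h(T)} .$$ Then $\nu^{(\mu)}_N$ converges weakly as $N\to\infty$ to a (unique) Borel probability measure $\nu^{(\mu)}$ on $\mathcal T$, $\nu^{(\mu)}$-almost every tree is infinite, and $\chi$ is $\nu^{(\mu)}$-a.e. measurable. Let $\tilde\nu^{(\mu)}=\nu^{(\mu)}\circ\chi^{-1}$ be the spine measure, that is, the law of $\chi(T)$ when $T$ has law $\nu^{(\mu)}$, and let $\tilde{\mathbb E}_\mu$ be the expectation with respect to $\tilde\nu^{(\mu)}$. The following hold. 1. For every $r\ge 1$, $|D_r|$ is integrable and $\tilde{\mathbb E}_\mu(|D_r|)=\mu(r-1)+1$. 2. For every $r\ge 1$, $|B_r|$ is integrable and $\tilde{\mathbb E}_\mu(|B_r|)=\tfrac12\mu r(r-1)+r$. 3. $\lim_{r\to\infty}|D_r(T^s)|/r=\mu$ for $\tilde\nu^{(\mu)}$-almost every $T^s$. 4. $\lim_{r\to\infty}|B_r(T^s)|/r^2=\tfrac12\mu$ for $\tilde\nu^{(\mu)}$-almost every $T^s$. -/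

import Mathlib

open MeasureTheory Filter Topology

/-- A locally finite rooted planar tree, given by its generations `D₀, D₁, D₂, …` and its parent
maps. Up to the unique order isomorphism, the finite ordered set `D_r` is `{0, …, width r - 1}` with
its usual order, listed from left to right, and `parent r` is the order preserving parent map from
`D_{r+1}` to `D_r`. The values of `parent r` outside `D_{r+1}` carry no information and are
normalised to be `0`, so that two trees are equal as elements of this type if and only if they are
isomorphic as planar trees. The generations `D₀` (the root) and `D₁` have exactly one vertex. -/
@[ext]
structure PlanarTree where
  width : ℕ → ℕ
  parent : ℕ → ℕ → ℕ
  width_zero : width 0 = 1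
  width_one : width 1 = 1
  parent_lt : ∀ r j, j < width (r + 1) → parent r j < width r
  parent_mono : ∀ r i j, i ≤ j → j < width (r + 1) → parent r i ≤ parent r j
  parent_eq_zero : ∀ r j, width (r + 1) ≤ j → parent r j = 0

namespace PlanarTree

/-- The size `|T|`, the number of edges of `T`. Every vertex `j ∈ D_{r+1}` gives one edge, which
joins it to its parent; the edge is encoded as the pair `(r, j)`. -/
noncomputable def size (T : PlanarTree) : ℕ∞ :=
  {e : ℕ × ℕ | e.2 < T.width (e.1 + 1)}.encard

/-- The height `h(T)` of a finite tree: the largest `r` such that `D_r` is not empty. -/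
noncomputable def height (T : PlanarTree) : ℕ := sSup {r : ℕ | T.width r ≠ 0}

/-- The ball `B_r(T)` of radius `r ≥ 1` around the root, as a planar tree: the subtree of `T`
spanned by the vertices at distance at most `r` from the root. (For `r = 0` it is by convention
the ball of radius `1`, since a planar tree has a root edge.) -/
def ball (r : ℕ) (T : PlanarTree) : PlanarTree where
  width s := if s ≤ max r 1 then T.width s else 0
  parent s j := if s < max r 1 then T.parent s j else 0
  width_zero := by simp [T.width_zero]
  width_one := by simp [T.width_one]
  parent_lt s j h := by
    by_cases hs : s < max r 1
    · rw [if_pos (show s + 1 ≤ max r 1 by omega)] at h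
      rw [if_pos hs, if_pos hs.le]
      exact T.parent_lt s j h
    · rw [if_neg (by omega)] at h
      omega
  parent_mono s i j hij h := by
    by_cases hs : s < max r 1
    · rw [if_pos (show s + 1 ≤ max r 1 by omega)] at h
      rw [if_pos hs, if_pos hs]
      exact T.parent_mono s i j hij h
    · rw [if_neg hs, if_neg hs]
  parent_eq_zero s j h := by
    by_cases hs : s < max r 1
    · rw [if_pos (show s + 1 ≤ max r 1 by omega)] at h
      rw [if_pos hs]
      exact T.parent_eq_zero s j h
    · rw [if_neg hs]

theorem ball_eq_ball_iff (r : ℕ) (T T' : PlanarTree) :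
    ball r T = ball r T' ↔
      (∀ s ≤ max r 1, T.width s = T'.width s) ∧ ∀ s < max r 1, T.parent s = T'.parent s := by
  constructor
  · intro h
    have h1 := congrArg PlanarTree.width h
    have h2 := congrArg PlanarTree.parent h
    constructor
    · intro s hs
      have := congrFun h1 s
      simpa only [ball, if_pos hs] using this
    · intro s hs
      have := congrFun h2 s
      simpa only [ball, if_pos hs] using this
  · rintro ⟨h1, h2⟩
    ext s j
    · simp only [ball]
      split_ifs with hs
      · exact h1 s hs
      · rfl
    · simp only [ball]
      split_ifs with hs
      · exact congrFun (h2 s hs) j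
      · rfl

theorem ball_eq_ball_of_le {r s : ℕ} (hrs : r ≤ s) {T T' : PlanarTree}
    (h : ball s T = ball s T') : ball r T = ball r T' := by
  rw [ball_eq_ball_iff] at h ⊢
  exact ⟨fun q hq => h.1 q (by omega), fun q hq => h.2 q (by omega)⟩

theorem eq_of_forall_ball_eq {T T' : PlanarTree} (h : ∀ r : ℕ, ball r T = ball r T') :
    T = T' := by
  ext s j
  · exact ((ball_eq_ball_iff s T T').1 (h s)).1 s (by omega)
  · exact congrFun (((ball_eq_ball_iff (s + 1) T T').1 (h (s + 1))).2 s (by omega)) j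

/-- The numbers `1 / r`, `r ≥ 1`, such that `T` and `T'` share the ball of radius `r`. -/
def invRadii (T T' : PlanarTree) : Set ℝ :=
  {x : ℝ | ∃ r : ℕ, 1 ≤ r ∧ ball r T = ball r T' ∧ x = 1 / (r : ℝ)}

theorem invRadii_nonempty (T T' : PlanarTree) : (invRadii T T').Nonempty := by
  refine ⟨1 / ((1 : ℕ) : ℝ), 1, le_rfl, ?_, rfl⟩
  rw [ball_eq_ball_iff]
  have hw : ∀ s ≤ max 1 1, T.width s = T'.width s := by
    intro s hs
    have hs' : s = 0 ∨ s = 1 := by omega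
    rcases hs' with rfl | rfl
    · rw [T.width_zero, T'.width_zero]
    · rw [T.width_one, T'.width_one]
  refine ⟨hw, ?_⟩
  intro s hs
  obtain rfl : s = 0 := by omega
  have key : ∀ (S : PlanarTree) (j : ℕ), S.parent 0 j = 0 := by
    intro S j
    by_cases hj : j < S.width (0 + 1)
    · have := S.parent_lt 0 j hj
      rw [S.width_zero] at this
      omega
    · exact S.parent_eq_zero 0 j (by omega)
  funext j
  rw [key T, key T']

theorem invRadii_pos {T T' : PlanarTree} {x : ℝ} (hx : x ∈ invRadii T T') : 0 < x := by
  obtain ⟨r, hr, -, rfl⟩ := hx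
  have : (0 : ℝ) < r := by exact_mod_cast hr
  positivity

theorem invRadii_bddBelow (T T' : PlanarTree) : BddBelow (invRadii T T') :=
  ⟨0, fun _ hx => (invRadii_pos hx).le⟩

theorem invRadii_comm (T T' : PlanarTree) : invRadii T T' = invRadii T' T := by
  ext x
  exact ⟨fun ⟨r, h1, h2, h3⟩ => ⟨r, h1, h2.symm, h3⟩, fun ⟨r, h1, h2, h3⟩ => ⟨r, h1, h2.symm, h3⟩⟩

/-- The metric `dist(T, T') = inf {1 / r | r ≥ 1, B_r(T) = B_r(T')}` on planar trees. -/
noncomputable instance : MetricSpace PlanarTree where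
  dist T T' := sInf (invRadii T T')
  dist_self T := by
    refine le_antisymm (le_of_forall_pos_le_add fun ε hε => ?_)
      (le_csInf (invRadii_nonempty T T) fun _ hx => (invRadii_pos hx).le)
    obtain ⟨n, hn⟩ := exists_nat_one_div_lt hε
    refine (csInf_le (invRadii_bddBelow T T)
      (⟨n + 1, by omega, rfl, rfl⟩ : 1 / ((n + 1 : ℕ) : ℝ) ∈ invRadii T T)).trans ?_
    push_cast
    linarith
  dist_comm T T' := by
    show sInf (invRadii T T') = sInf (invRadii T' T)
    rw [invRadii_comm]
  dist_triangle T T' T'' := by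
    show sInf (invRadii T T'') ≤ sInf (invRadii T T') + sInf (invRadii T' T'')
    have key : ∀ a ∈ invRadii T T', ∀ b ∈ invRadii T' T'', sInf (invRadii T T'') ≤ a + b := by
      intro a ha b hb
      have ha0 := invRadii_pos ha
      have hb0 := invRadii_pos hb
      obtain ⟨r, hr, hab, rfl⟩ := ha
      obtain ⟨s, hs, hbc, rfl⟩ := hb
      rcases le_total r s with h | h
      · have := csInf_le (invRadii_bddBelow T T'')
          (⟨r, hr, hab.trans (ball_eq_ball_of_le h hbc), rfl⟩ : 1 / (r : ℝ) ∈ invRadii T T'')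
        linarith
      · have := csInf_le (invRadii_bddBelow T T'')
          (⟨s, hs, (ball_eq_ball_of_le h hab).trans hbc, rfl⟩ : 1 / (s : ℝ) ∈ invRadii T T'')
        linarith
    have h1 : ∀ a ∈ invRadii T T', sInf (invRadii T T'') - a ≤ sInf (invRadii T' T'') :=
      fun a ha => le_csInf (invRadii_nonempty T' T'') fun b hb => by
        have := key a ha b hb
        linarith
    have h2 : sInf (invRadii T T'') - sInf (invRadii T' T'') ≤ sInf (invRadii T T') :=
      le_csInf (invRadii_nonempty T T') fun a ha => by
        have := h1 a ha
        linarith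
    linarith
  eq_of_dist_eq_zero {T T'} h := by
    replace h : sInf (invRadii T T') = 0 := h
    refine eq_of_forall_ball_eq fun r => ?_
    have hpos : (0 : ℝ) < 1 / ((r : ℝ) + 1) := by positivity
    obtain ⟨x, ⟨s, hs, hb, rfl⟩, hx⟩ :=
      exists_lt_of_csInf_lt (invRadii_nonempty T T') (h.trans_lt hpos)
    have hs0 : (0 : ℝ) < s := by exact_mod_cast hs
    have hlt : (r : ℝ) + 1 < s := (one_div_lt_one_div hs0 (by positivity)).1 hx
    have hrs : r ≤ s := by
      have : r + 1 < s := by exact_mod_cast hlt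
      omega
    exact ball_eq_ball_of_le hrs hb

/-- Measures on the space of planar trees are Borel measures. -/
noncomputable instance : MeasurableSpace PlanarTree := borel PlanarTree

instance : BorelSpace PlanarTree := ⟨rfl⟩

theorem size_ball (r : ℕ) (hr : 1 ≤ r) (T : PlanarTree) :
    (ball r T).size = ((∑ s ∈ Finset.Icc 1 r, T.width s : ℕ) : ℕ∞) := by
  have hset : {e : ℕ × ℕ | e.2 < (ball r T).width (e.1 + 1)} =
      (((Finset.range r).sigma fun s => Finset.range (T.width (s + 1))).map
        (Equiv.sigmaEquivProd ℕ ℕ).toEmbedding : Finset (ℕ × ℕ)) := by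
    ext ⟨s, j⟩
    by_cases hs : s < r
    · have hm : s + 1 ≤ max r 1 := by omega
      simp only [ball, Set.mem_ofPred_eq, if_pos hm]
      simp [hs]
    · have hm : ¬ s + 1 ≤ max r 1 := by omega
      simp only [ball, Set.mem_ofPred_eq, if_neg hm]
      simp [hs]
  rw [size, hset, Set.encard_coe_eq_coe_finsetCard, Finset.card_map, Finset.card_sigma]
  simp only [Finset.card_range]
  congr 1
  rw [Finset.range_eq_Ico, Finset.sum_Ico_add' (fun s => T.width s) 0 r 1]
  rfl

/-- `T.ancestor r k j` is the ancestor in `D_r` of the vertex `j ∈ D_{r+k}`. -/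
def ancestor (T : PlanarTree) (r : ℕ) : ℕ → ℕ → ℕ
  | 0, j => j
  | k + 1, j => ancestor T r k (T.parent (r + k) j)

/-- The descendants of the vertex `i ∈ D_r`; the pair `(k, j)` stands for `j ∈ D_{r+k+1}`. -/
def descendants (T : PlanarTree) (r i : ℕ) : Set (ℕ × ℕ) :=
  {v : ℕ × ℕ | v.2 < T.width (r + (v.1 + 1)) ∧ T.ancestor r (v.1 + 1) v.2 = i}

/-- The vertex `i ∈ D_r` is of infinite type: it has infinitely many descendants. -/
def IsInfType (T : PlanarTree) (r i : ℕ) : Prop := (T.descendants r i).Infinite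

theorem ancestor_succ_left (T : PlanarTree) (r k j : ℕ) :
    T.ancestor r (k + 1) j = T.parent r (T.ancestor (r + 1) k j) := by
  induction k generalizing j with
  | zero => rfl
  | succ k ih =>
    show T.ancestor r (k + 1) (T.parent (r + (k + 1)) j) =
      T.parent r (T.ancestor (r + 1) k (T.parent (r + 1 + k) j))
    rw [ih, show r + 1 + k = r + (k + 1) by omega]

theorem ancestor_lt (T : PlanarTree) (r k j : ℕ) (hj : j < T.width (r + k)) :
    T.ancestor r k j < T.width r := by
  induction k generalizing j with
  | zero => exact hj
  | succ k ih => exact ih _ (T.parent_lt (r + k) j hj)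

theorem IsInfType.parent {T : PlanarTree} {r i : ℕ} (h : T.IsInfType (r + 1) i) :
    T.IsInfType r (T.parent r i) := by
  have hinj : Function.Injective (fun v : ℕ × ℕ => (v.1 + 1, v.2)) := by
    rintro ⟨a, b⟩ ⟨c, d⟩ h
    simp only [Prod.mk.injEq] at h ⊢
    omega
  refine (Set.Infinite.image hinj.injOn h).mono ?_
  rintro _ ⟨v, ⟨hv1, hv2⟩, rfl⟩
  refine ⟨?_, ?_⟩
  · show v.2 < T.width (r + (v.1 + 1 + 1))
    rw [show r + (v.1 + 1 + 1) = r + 1 + (v.1 + 1) by omega]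
    exact hv1
  · show T.ancestor r (v.1 + 1 + 1) v.2 = T.parent r i
    rw [ancestor_succ_left, hv2]

theorem isInfType_zero {T : PlanarTree} (hT : T.size = ⊤) : T.IsInfType 0 0 := by
  refine (Set.encard_eq_top_iff.1 hT).mono ?_
  rintro v (hv : v.2 < T.width (v.1 + 1))
  have hv' : v.2 < T.width (0 + (v.1 + 1)) := by rwa [Nat.zero_add]
  refine ⟨hv', ?_⟩
  have := T.ancestor_lt 0 _ _ hv'
  rw [T.width_zero] at this
  omega

theorem isInfType_one {T : PlanarTree} (hT : T.size = ⊤) : T.IsInfType 1 0 := by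
  have hfin : ((fun j : ℕ => ((0 : ℕ), j)) '' Set.Iio (T.width 1)).Finite :=
    (Set.finite_Iio _).image _
  have hinf := (Set.encard_eq_top_iff.1 hT).sdiff hfin
  refine Set.Infinite.of_image (fun v : ℕ × ℕ => (v.1 + 1, v.2)) (hinf.mono ?_)
  rintro ⟨a, b⟩ ⟨hv, hn⟩
  replace hv : b < T.width (a + 1) := hv
  cases a with
  | zero => exact absurd ⟨b, hv, rfl⟩ hn
  | succ a =>
    have hv' : b < T.width (1 + (a + 1)) := by rwa [Nat.add_comm 1 (a + 1)]
    refine ⟨(a, b), ⟨hv', ?_⟩, rfl⟩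
    have := T.ancestor_lt 1 _ _ hv'
    rw [T.width_one] at this
    show T.ancestor 1 (a + 1) b = 0
    omega

open Classical in
/-- The spine (backbone) of an infinite tree `T`: the subtree spanned by the vertices of infinite
type. Its generation `r` consists of the vertices of infinite type in `D_r`, which are renumbered
from left to right: `Nat.nth` gives the vertex of `T` with a given new number, and `Nat.count`
gives the new number of a vertex of `T`. -/
noncomputable def infiniteSpine (T : PlanarTree) (hT : T.size = ⊤) : PlanarTree where
  width r := Nat.count (T.IsInfType r) (T.width r)
  parent r j :=
    if j < Nat.count (T.IsInfType (r + 1)) (T.width (r + 1)) then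
      Nat.count (T.IsInfType r) (T.parent r (Nat.nth (T.IsInfType (r + 1)) j))
    else 0
  width_zero := by
    rw [T.width_zero, Nat.count_succ, Nat.count_zero, if_pos (isInfType_zero hT)]
  width_one := by
    rw [T.width_one, Nat.count_succ, Nat.count_zero, if_pos (isInfType_one hT)]
  parent_lt r j h := by
    rw [if_pos h]
    have h1 : Nat.nth (T.IsInfType (r + 1)) j < T.width (r + 1) := Nat.nth_lt_of_lt_count h
    have h2 : T.IsInfType (r + 1) (Nat.nth (T.IsInfType (r + 1)) j) :=
      Nat.nth_mem j fun hf => h.trans_le (Nat.count_le_card hf _)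
    exact Nat.count_strict_mono h2.parent (T.parent_lt r _ h1)
  parent_mono r i j hij h := by
    rw [if_pos h, if_pos (hij.trans_lt h)]
    refine Nat.count_monotone _ (T.parent_mono r _ _ ?_ (Nat.nth_lt_of_lt_count h))
    exact Nat.nth_le_nth' hij fun hf => h.trans_le (Nat.count_le_card hf _)
  parent_eq_zero r j h := if_neg (not_lt.2 h)

open Classical in
/-- The spine map `χ`. On finite trees, where the spine is not defined, it is extended by the
identity. -/
noncomputable def spine (T : PlanarTree) : PlanarTree :=
  if hT : T.size = ⊤ then T.infiniteSpine hT else T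

/-- The partition function `Z_N = ∑_{|T| = N} e^{-μ h(T)}`. -/
noncomputable def partitionFunction (μ : ℝ) (N : ℕ) : ENNReal :=
  ∑' T : {T : PlanarTree // T.size = N}, ENNReal.ofReal (Real.exp (-μ * T.1.height))

/-- The measure on planar trees supported on the trees of size `N ≥ 1`, with
`ν_N({T}) = e^{-μ h(T)} / Z_N` if `|T| = N`. -/
noncomputable def finiteSizeMeasure (μ : ℝ) (N : ℕ) : Measure PlanarTree :=
  Measure.sum fun T : {T : PlanarTree // T.size = N} =>
    (ENNReal.ofReal (Real.exp (-μ * T.1.height)) / partitionFunction μ N) • Measure.dirac T.1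

/-- `ν` is the local limit of the measures `ν_N`: a Borel probability measure to which they
converge weakly as `N → ∞`. -/
def IsLocalLimit (μ : ℝ) (ν : Measure PlanarTree) : Prop :=
  IsProbabilityMeasure ν ∧
    ∀ F : BoundedContinuousFunction PlanarTree ℝ,
      Tendsto (fun N : ℕ => ∫ T, F T ∂(finiteSizeMeasure μ N)) atTop (𝓝 (∫ T, F T ∂ν))

/-- The spine measure: the distribution of the spine `χ(T)`, where `T` has distribution `ν`. -/
noncomputable def spineMeasure (ν : Measure PlanarTree) : Measure PlanarTree :=
  ν.map spine

/-- The number `|D_r(T)|` of vertices at height `r`, as a real number. -/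
def generationSize (r : ℕ) (T : PlanarTree) : ℝ := T.width r

/-- The size `|B_r(T)|` (the number of edges) of the ball of radius `r ≥ 1`, as a real number. -/
noncomputable def ballSize (r : ℕ) (T : PlanarTree) : ℝ := ((ball r T).size.toNat : ℝ)

end PlanarTree

/-! The limit measure is identified with the law of an explicit random tree whose backbone is marked
while the tree is built. The identification rests on computing the same ball probabilities in two
ways.

Counting. Let `g_p` be the generating function of trees of height at most `p`; then `X * g_p` arises
by iterating the Möbius map `x ↦ X / (1 - x)`. Prescribing a ball with `b` edges and `K` vertices on
its top level leaves a forest, with generating function `X ^ b * g_p ^ K` (`treeCount_add`), and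
summation by parts turns `e^{-μh}` into a geometric sum over the height bound
(`cylinderWeight_eq_tsum_treeCount`). For `K = 1` the coefficients are a trigonometric sum
(`coeff_realTreeSeries`); a Riccati equation in `X` then yields a recursion in `K`
(`forestWeight_rec`). The sum over `p` is treated by Laplace's method: with `M = p + 2`, the
exponent `μ M + n π² / M²` is minimal at `M = x₀ n^{1/3}`, where `μ x₀³ = 2π²`. Hence only the
regime `n / M³ → μ / (2π²)` matters. There one trigonometric mode dominates, and the recursion in
`K` becomes a three-term recursion of Laguerre type. Dividing by `Z_N`, the limiting probability of
a ball of radius `n + 1` is `e^{-μn} 2^{K+1} 4^{-b} ∑ i, C(K, i+1) μ^i / i!`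
(`tendsto_finiteSizeMeasure_cylinder`).

Probability. The factor `C(K, i+1)` suggests marking `i + 1` of the `K` top vertices. In the random
tree every generation gains a Poisson(`μ`) number of marks, a vertex being marked exactly when one
of its children is, and the offspring has weight `2^{-1}` per vertex and per child, up to
normalisation. The probability of a ball together with marks on its top level depends on the marks
only through their number `i + 1`, with factor `μ^i / i!`; summing over the marks gives the same
formula (`markedTreeMeasure_cylinder`). Balls form a π-system and a basis of the topology, so weak
convergence follows (`isLocalLimit_map_markedTree`).

Spine. A marked vertex has a marked child, hence infinitely many descendants. Unmarked vertices
start critical geometric branching processes, which die out almost surely. So the spine consists of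
the marked vertices, and `|D_{n+1}|` is `1` plus a sum of `n` independent Poisson(`μ`) variables
(`ae_width_spine_markedTree`). The expectations, the strong law and its summed version follow. -/

/-! ### Generating functions of trees of bounded height and their Riccati equation. -/

section GeneratingFunction

open PowerSeries

/-- The generating function of the descendants (up to `p` generations below it) of one vertex:
`coeff n (treeSeries p)` is the number of planar forests with one root, `n` other vertices and
height at most `p`. -/
noncomputable def treeSeries : ℕ → PowerSeries ℕ
  | 0 => 1
  | p + 1 => PowerSeries.mk fun n => ∑ i ∈ Finset.range (n + 1), coeff n ((X * treeSeries p) ^ i)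

theorem coeff_X_mul_pow_of_lt {R : Type*} [CommSemiring R] (f : PowerSeries R) {n i : ℕ}
    (h : n < i) (g : PowerSeries R) : coeff n ((X * f) ^ i * g) = 0 := by
  rw [mul_pow, mul_assoc, coeff_X_pow_mul', if_neg (by omega)]

/-- The truncation in the definition is harmless because `(X * f) ^ i` has no coefficient below
degree `i`: the series is the full geometric series of `X * treeSeries p`. -/
theorem treeSeries_succ (p : ℕ) :
    treeSeries (p + 1) = 1 + X * treeSeries p * treeSeries (p + 1) := by
  have key : ∀ m n : ℕ, n ≤ m → coeff n (treeSeries (p + 1)) =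
      coeff n (∑ i ∈ Finset.range (m + 1), (X * treeSeries p) ^ i) := by
    intro m n hnm
    rw [map_sum]
    simp only [treeSeries, coeff_mk]
    refine Finset.sum_subset (by simpa using hnm) fun i _ hi => ?_
    simpa using coeff_X_mul_pow_of_lt (treeSeries p) (by simpa using hi) 1
  ext n
  rw [map_add, key (n + 1) n (by omega), coeff_mul]
  have : ∑ x ∈ Finset.HasAntidiagonal.antidiagonal n, coeff x.1 (X * treeSeries p) *
        coeff x.2 (treeSeries (p + 1)) =
      coeff n (X * treeSeries p * ∑ i ∈ Finset.range (n + 1), (X * treeSeries p) ^ i) := by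
    rw [coeff_mul]
    refine Finset.sum_congr rfl fun x hx => ?_
    have hx2 := Finset.HasAntidiagonal.mem_antidiagonal.1 hx
    rw [key n x.2 (by omega)]
  rw [this, ← map_add, Finset.mul_sum, Finset.sum_range_succ' _ (n + 1), add_comm]
  simp only [pow_succ', pow_zero]

/-- Expansion of `v ^ K` in powers of `u`, where `v = 1 / (1 - u)`. -/
theorem coeff_mul_eq_sum_of_eq_one_add {R : Type*} [CommSemiring R] {f v : PowerSeries R}
    (h : v = 1 + X * f * v) (n : ℕ) (w : PowerSeries R) :
    coeff n (v * w) = ∑ i ∈ Finset.range (n + 1), coeff n ((X * f) ^ i * w) := by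
  have key : ∀ m : ℕ, v * w = ∑ i ∈ Finset.range m, (X * f) ^ i * w + (X * f) ^ m * (v * w) := by
    intro m
    induction m with
    | zero => simp
    | succ m ih =>
      rw [Finset.sum_range_succ]
      conv_lhs => rw [ih]
      conv_lhs => rw [h]
      ring
  conv_lhs => rw [key (n + 1)]
  rw [map_add, map_sum, coeff_X_mul_pow_of_lt _ (by omega), add_zero]

/-- The generating function `treeSeries p` with real coefficients. -/
noncomputable def realTreeSeries (p : ℕ) : PowerSeries ℝ := (treeSeries p).map (Nat.castRingHom ℝ)

theorem coeff_realTreeSeries_pow (p K n : ℕ) :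
    coeff n (realTreeSeries p ^ K) = (coeff n (treeSeries p ^ K) : ℕ) := by
  rw [realTreeSeries, ← map_pow, coeff_map]
  simp

theorem realTreeSeries_zero : realTreeSeries 0 = 1 := by
  simp [realTreeSeries, treeSeries]

theorem realTreeSeries_succ (p : ℕ) :
    realTreeSeries (p + 1) = 1 + X * realTreeSeries p * realTreeSeries (p + 1) := by
  conv_lhs => rw [realTreeSeries, treeSeries_succ]
  simp [realTreeSeries]

/-- With `x = X * realTreeSeries p`, one step of the recursion is `x ↦ X / (1 - x)`. The polynomial
`x² - x + X`, which vanishes at the fixed points of this map, is multiplied by `X * v²` with `v = 1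
/ (1 - x)`; the derivative of `x` acquires the same factor, and the remaining terms raise the
coefficient `p + 2` by one. -/
theorem realTreeSeries_riccati (p : ℕ) :
    X * (4 * X - 1) * derivative ℝ (X * realTreeSeries p) =
      2 * X * (X * realTreeSeries p) - X + (p + 2 : PowerSeries ℝ) *
        ((X * realTreeSeries p) ^ 2 - X * realTreeSeries p + X) := by
  induction p with
  | zero =>
    rw [realTreeSeries_zero, mul_one, derivative_X]
    push_cast
    ring
  | succ p ih =>
    set x := X * realTreeSeries p with hx
    set v := realTreeSeries (p + 1) with hv
    have h : v * (1 - x) = 1 := by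
      have := realTreeSeries_succ p
      rw [← hx, ← hv] at this
      linear_combination this
    have hder : derivative ℝ v = v ^ 2 * derivative ℝ x := by
      have h1 : derivative ℝ (v * (1 - x)) = 0 := by rw [h, Derivation.map_one_eq_zero]
      rw [Derivation.leibniz, map_sub, Derivation.map_one_eq_zero] at h1
      simp only [smul_eq_mul] at h1
      linear_combination v * h1 - derivative ℝ v * h
    have hXv : derivative ℝ (X * v) = v + X * (v ^ 2 * derivative ℝ x) := by
      rw [Derivation.leibniz, derivative_X, hder]
      simp only [smul_eq_mul]
      ring
    rw [hXv]
    push_cast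
    have hv1 : v = v ^ 2 * (1 - x) := by linear_combination (-v) * h
    have h1 : (1 : PowerSeries ℝ) = v ^ 2 * (1 - x) ^ 2 := by
      linear_combination (-(v * (1 - x)) - 1) * h
    have e : X * (4 * X - 1) * (v + X * (v ^ 2 * derivative ℝ x)) -
        (2 * X * (X * v) - X + (p + 1 + 2 : PowerSeries ℝ) * ((X * v) ^ 2 - X * v + X)) = 0 := by
      have e1 : X * (4 * X - 1) * (v + X * (v ^ 2 * derivative ℝ x)) =
          X * (4 * X - 1) * (v ^ 2 * (1 - x)) + X * v ^ 2 * (X * (4 * X - 1) * derivative ℝ x) := by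
        linear_combination (X * (4 * X - 1)) * hv1
      have e2 : 2 * X * (X * v) - X + (p + 1 + 2 : PowerSeries ℝ) * ((X * v) ^ 2 - X * v + X) =
          2 * X * X * (v ^ 2 * (1 - x)) - X * (v ^ 2 * (1 - x) ^ 2) + (p + 1 + 2 : PowerSeries ℝ) *
          ((X * v) ^ 2 - X * (v ^ 2 * (1 - x)) + X * (v ^ 2 * (1 - x) ^ 2)) := by
        linear_combination (2 * X * X - (p + 1 + 2 : PowerSeries ℝ) * X) * hv1 +
          (-X + (p + 1 + 2 : PowerSeries ℝ) * X) * h1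
      rw [e1, e2, ih]
      ring
    linear_combination e

end GeneratingFunction

/-! ### Spectral formula for paths in a strip, and for trees of bounded height. -/

section PathCount

open PowerSeries Real

/-- Multiplication by `2 sin (a / 2)` makes the sum telescope, and `0 < a / 2 < π` allows division.
It yields the orthogonality of the eigenvectors needed at time `0`. -/
theorem sum_cos_nat_mul_pi_div {M j : ℕ} (hj : 0 < j) (hjM : j < 2 * M) :
    ∑ k ∈ Finset.range M, cos ((k + 1 : ℕ) * (j * π / M)) = ((-1) ^ j - 1) / 2 := by
  have hM : 0 < M := by omega
  set a : ℝ := j * π / M with ha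
  have hM' : (0 : ℝ) < M := by exact_mod_cast hM
  have hj' : (0 : ℝ) < j := by exact_mod_cast hj
  have hlt : (j : ℝ) < 2 * M := by exact_mod_cast hjM
  have hs : sin (a / 2) ≠ 0 := by
    refine (sin_pos_of_pos_of_lt_pi (by positivity) ?_).ne'
    rw [ha, div_div, div_lt_iff₀ (by positivity)]
    nlinarith [pi_pos]
  have tel : ∀ m : ℕ, 2 * sin (a / 2) * ∑ k ∈ Finset.range m, cos ((k + 1 : ℕ) * a) =
      sin ((m : ℝ) * a + a / 2) - sin (a / 2) := by
    intro m
    induction m with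
    | zero => simp
    | succ m ih =>
      rw [Finset.sum_range_succ, mul_add, ih]
      have h1 : ((m : ℝ) * a + a / 2) = (m + 1 : ℕ) * a - a / 2 := by push_cast; ring
      rw [h1, sin_sub, sin_add]
      ring
  have h2 : (M : ℝ) * a = j * π := by rw [ha]; field_simp
  have h3 := tel M
  rw [h2, sin_add, sin_nat_mul_pi, cos_nat_mul_pi] at h3
  have : 2 * sin (a / 2) * (∑ k ∈ Finset.range M, cos ((k + 1 : ℕ) * a) - ((-1) ^ j - 1) / 2) = 0 := by
    linear_combination h3
  rcases mul_eq_zero.1 this with h | h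
  · exact absurd h (by simpa using hs)
  · linarith

/-- The number of nearest neighbour paths of length `t` from `0` to `i` in `{0, …, M - 2}`, in its
spectral form. -/
noncomputable def pathCount (M i t : ℕ) : ℝ :=
  2 / M * ∑ k ∈ Finset.range M, sin ((k + 1 : ℕ) * (π / M)) * sin ((k + 1 : ℕ) * ((i + 1) * π / M)) *
    (2 * cos ((k + 1 : ℕ) * (π / M))) ^ t

theorem pathCount_zero {M i : ℕ} (hi : i + 2 ≤ M) :
    pathCount M i 0 = if i = 0 then 1 else 0 := by
  have hM : (0 : ℝ) < M := by
    have : 0 < M := by omega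
    exact_mod_cast this
  have h : ∀ k : ℕ, sin ((k + 1 : ℕ) * (π / M)) * sin ((k + 1 : ℕ) * ((i + 1) * π / M)) *
      (2 * cos ((k + 1 : ℕ) * (π / M))) ^ 0 =
      (cos ((k + 1 : ℕ) * (i * π / M)) - cos ((k + 1 : ℕ) * ((i + 2 : ℕ) * π / M))) / 2 := by
    intro k
    have e1 : ((k + 1 : ℕ) : ℝ) * (i * π / M) =
      (k + 1 : ℕ) * ((i + 1) * π / M) - (k + 1 : ℕ) * (π / M) := by ring
    have e2 : ((k + 1 : ℕ) : ℝ) * ((i + 2 : ℕ) * π / M) =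
      (k + 1 : ℕ) * ((i + 1) * π / M) + (k + 1 : ℕ) * (π / M) := by push_cast; ring
    rw [e1, e2, cos_sub, cos_add]
    ring
  rw [pathCount, Finset.sum_congr rfl fun k _ => h k, ← Finset.sum_div, Finset.sum_sub_distrib,
    sum_cos_nat_mul_pi_div (j := i + 2) (by omega) (by omega)]
  split_ifs with hi0
  · subst hi0
    simp
    omega
  · rw [sum_cos_nat_mul_pi_div (by omega) (by omega), pow_add]
    simp

/-- The absorbing boundary: the eigenvectors vanish at the site just beyond the strip. -/
theorem pathCount_eq_zero {M i : ℕ} (hi : i + 1 = M) (t : ℕ) : pathCount M i t = 0 := by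
  have hM : (M : ℝ) ≠ 0 := by
    have : M ≠ 0 := by omega
    exact_mod_cast this
  rw [pathCount, Finset.sum_eq_zero, mul_zero]
  intro k _
  have : ((i : ℝ) + 1) * π / M = π := by
    have : (i : ℝ) + 1 = M := by exact_mod_cast hi
    rw [this]; field_simp
  rw [this, sin_nat_mul_pi]
  simp

theorem pathCount_succ_succ (M i t : ℕ) :
    pathCount M (i + 1) (t + 1) = pathCount M i t + pathCount M (i + 2) t := by
  simp only [pathCount]
  rw [← mul_add, ← Finset.sum_add_distrib]
  congr 1
  refine Finset.sum_congr rfl fun k _ => ?_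
  have e1 : ((k + 1 : ℕ) : ℝ) * ((i + 1) * π / M) =
      (k + 1 : ℕ) * (((i + 1 : ℕ) + 1) * π / M) - (k + 1 : ℕ) * (π / M) := by push_cast; ring
  have e2 : ((k + 1 : ℕ) : ℝ) * (((i + 2 : ℕ) + 1) * π / M) =
      (k + 1 : ℕ) * (((i + 1 : ℕ) + 1) * π / M) + (k + 1 : ℕ) * (π / M) := by push_cast; ring
  rw [e1, e2, sin_sub, sin_add]
  ring

theorem pathCount_zero_succ (M t : ℕ) : pathCount M 0 (t + 1) = pathCount M 1 t := by
  simp only [pathCount]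
  congr 1
  refine Finset.sum_congr rfl fun k _ => ?_
  have e1 : ((k + 1 : ℕ) : ℝ) * (((0 : ℕ) + 1) * π / M) = (k + 1 : ℕ) * (π / M) := by
    push_cast; ring
  have e2 : ((k + 1 : ℕ) : ℝ) * (((1 : ℕ) + 1) * π / M) = 2 * ((k + 1 : ℕ) * (π / M)) := by
    push_cast; ring
  rw [e1, e2, sin_two_mul]
  ring

/-- The number of trees of bounded height, in its spectral form. -/
theorem coeff_realTreeSeries (p n : ℕ) :
    coeff n (realTreeSeries p) = pathCount (p + 2) 0 (2 * n) := by
  set M := p + 2 with hM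
  let G : ℕ → PowerSeries ℝ := fun i => PowerSeries.mk (pathCount M i)
  -- An edge of a tree corresponds to two steps of its contour path, hence the substitution of `X ^
  -- 2` for `X`.
  let y : ℕ → PowerSeries ℝ := fun i => expand 2 two_ne_zero (realTreeSeries i)
  have hy0 : y 0 = 1 := by simp [y, realTreeSeries_zero]
  have hy : ∀ i, y (i + 1) = 1 + X ^ 2 * y i * y (i + 1) := by
    intro i
    simp only [y]
    conv_lhs => rw [realTreeSeries_succ]
    simp
  have hG : ∀ i, i + 3 ≤ M → G (i + 1) = X * G i + X * G (i + 2) := by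
    intro i hi
    ext t
    cases t with
    | zero => simp [G, pathCount_zero (show i + 1 + 2 ≤ M by omega)]
    | succ t => simp [G, coeff_succ_X_mul, pathCount_succ_succ]
  have hG0 : G 0 = 1 + X * G 1 := by
    ext t
    cases t with
    | zero => simp [G, pathCount_zero (show 0 + 2 ≤ M by omega)]
    | succ t => simp [G, coeff_succ_X_mul, pathCount_zero_succ, coeff_one]
  have hGM : G (p + 1) = 0 := by
    ext t
    simp [G, pathCount_eq_zero (show p + 1 + 1 = M by omega)]
  -- Downward from the absorbing boundary: after the last step from `i - 1` to `i`, a path makes an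
  -- excursion above level `i`, with `a = p - i` levels available.
  have hrec : ∀ a i, a + i = p → 1 ≤ i → G i = X * y a * G (i - 1) := by
    intro a
    induction a with
    | zero =>
      intro i hi h1
      obtain ⟨i, rfl⟩ : ∃ i', i = i' + 1 := ⟨i - 1, by omega⟩
      have : i + 2 = p + 1 := by omega
      rw [hG i (by omega), this, hGM, hy0]
      simp
    | succ a ih =>
      intro i hi h1
      obtain ⟨i, rfl⟩ : ∃ i', i = i' + 1 := ⟨i - 1, by omega⟩
      have h2 := ih (i + 2) (by omega) (by omega)
      have h3 := hG i (by omega)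
      have h4 := hy a
      simp only [Nat.add_sub_cancel, show i + 2 - 1 = i + 1 by omega] at h2 ⊢
      rw [h2] at h3
      linear_combination (y (a + 1)) * h3 - G (i + 1) * h4
  have hG0' : G 0 = y p := by
    cases p with
    | zero =>
      rw [hG0, show (1 : ℕ) = 0 + 1 from rfl, hGM, hy0]
      simp
    | succ p =>
      have h2 := hrec p 1 (by omega) le_rfl
      have h3 := hy p
      rw [h2] at hG0
      simp only [Nat.sub_self] at hG0
      linear_combination (y (p + 1)) * hG0 - G 0 * h3
  have := congrArg (coeff (2 * n)) hG0'
  simp only [G, y, coeff_mk] at this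
  rw [this, coeff_expand_mul]

end PathCount

/-! ### Normalised coefficients and their recursion in the number of roots. -/

section NormalizedCoefficients

open PowerSeries

/-- The coefficients of `treeSeries p ^ K`, normalised by their exponential growth rate. -/
noncomputable def forestWeight (K n p : ℕ) : ℝ :=
  (1 / 4) ^ (n + K) * coeff n (realTreeSeries p ^ K)

theorem forestWeight_nonneg (K n p : ℕ) : 0 ≤ forestWeight K n p := by
  rw [forestWeight, coeff_realTreeSeries_pow]
  positivity

theorem forestWeight_zero (n p : ℕ) : forestWeight 0 n p = if n = 0 then 1 else 0 := by
  rw [forestWeight, pow_zero, coeff_one]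
  split_ifs with h <;> simp [h]

theorem coeff_X_mul_realTreeSeries_pow (K m p : ℕ) :
    coeff (m + K) ((X * realTreeSeries p) ^ K) = 4 ^ (m + K) * forestWeight K m p := by
  rw [mul_pow, coeff_X_pow_mul, forestWeight, ← mul_assoc, ← mul_pow]
  norm_num

/-- This is the coefficient of degree `n + K + 2` in the Riccati equation multiplied by `(K + 1) * x
^ K`, because `(K + 1) * x ^ K * x'` is the derivative of `x ^ (K + 1)`. It reduces all `K` to `K =
0` and `K = 1`. -/
theorem forestWeight_rec (K n p : ℕ) :
    forestWeight (K + 2) n p = forestWeight (K + 1) (n + 1) p - forestWeight K (n + 1) p / 4 +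
      1 / (p + 2) * (-((n + K + 2) * (forestWeight (K + 1) (n + 1) p - forestWeight (K + 1) n p) +
        forestWeight (K + 1) n p) / (K + 1) - forestWeight (K + 1) n p / 2 +
        forestWeight K (n + 1) p / 4) := by
  set x := X * realTreeSeries p with hx
  have hr := realTreeSeries_riccati p
  rw [← hx] at hr
  have h1 : X * (4 * X - 1) * derivative ℝ (x ^ (K + 1)) = (K + 1 : PowerSeries ℝ) *
      (2 * (X * x ^ (K + 1)) - X * x ^ K + (p + 2 : PowerSeries ℝ) *
        (x ^ (K + 2) - x ^ (K + 1) + X * x ^ K)) := by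
    rw [Derivation.leibniz_pow]
    simp only [smul_eq_mul, nsmul_eq_mul, Nat.add_sub_cancel]
    push_cast
    linear_combination ((K + 1 : PowerSeries ℝ) * x ^ K) * hr
  have h2 := congrArg (coeff (n + K + 1 + 1)) h1
  have hD : coeff (n + K + 1 + 1) (X * (4 * X - 1) * derivative ℝ (x ^ (K + 1))) =
      4 * ((n + K + 1) * coeff (n + K + 1) (x ^ (K + 1))) -
      (n + K + 2) * coeff (n + K + 2) (x ^ (K + 1)) := by
    have : X * (4 * X - 1) * derivative ℝ (x ^ (K + 1)) =
      X * (C (4 : ℝ) * (X * derivative ℝ (x ^ (K + 1))) - derivative ℝ (x ^ (K + 1))) := by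
      have : C (4 : ℝ) = (4 : PowerSeries ℝ) := map_ofNat _ 4
      rw [this]
      ring
    rw [this, coeff_succ_X_mul, map_sub, coeff_C_mul, coeff_succ_X_mul, coeff_derivative,
      coeff_derivative]
    push_cast
    ring
  have hR : coeff (n + K + 1 + 1) ((K + 1 : PowerSeries ℝ) *
      (2 * (X * x ^ (K + 1)) - X * x ^ K + (p + 2 : PowerSeries ℝ) *
        (x ^ (K + 2) - x ^ (K + 1) + X * x ^ K))) = (K + 1) *
        (2 * coeff (n + K + 1) (x ^ (K + 1)) - coeff (n + K + 1) (x ^ K) + (p + 2) *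
        (coeff (n + K + 2) (x ^ (K + 2)) - coeff (n + K + 2) (x ^ (K + 1)) +
          coeff (n + K + 1) (x ^ K))) := by
    have e1 : (K + 1 : PowerSeries ℝ) = C ((K : ℝ) + 1) := by simp
    have e2 : (p + 2 : PowerSeries ℝ) = C ((p : ℝ) + 2) := by simp [map_ofNat]
    have e3 : (2 : PowerSeries ℝ) = C (2 : ℝ) := (map_ofNat _ 2).symm
    rw [e1, e2, coeff_C_mul, map_add, map_sub, coeff_C_mul, map_add, map_sub, coeff_succ_X_mul,
      e3, coeff_C_mul, coeff_succ_X_mul]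
  rw [hD, hR] at h2
  have c1 := coeff_X_mul_realTreeSeries_pow (K + 1) n p
  have c2 := coeff_X_mul_realTreeSeries_pow (K + 1) (n + 1) p
  have c3 := coeff_X_mul_realTreeSeries_pow K (n + 1) p
  have c4 := coeff_X_mul_realTreeSeries_pow (K + 2) n p
  rw [← hx] at c1 c2 c3 c4
  rw [show n + 1 + (K + 1) = n + K + 2 by ring] at c2
  rw [show n + (K + 1) = n + K + 1 by ring] at c1
  rw [show n + 1 + K = n + K + 1 by ring] at c3
  rw [show n + (K + 2) = n + K + 2 by ring] at c4
  rw [c1, c2, c3, c4, pow_succ (4 : ℝ) (n + K + 1)] at h2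
  have h4 : (4 : ℝ) ^ (n + K + 1) ≠ 0 := by positivity
  have h5 : (n + K + 1) * forestWeight (K + 1) n p - (n + K + 2) * forestWeight (K + 1) (n + 1) p =
    (K + 1) * (forestWeight (K + 1) n p / 2 - forestWeight K (n + 1) p / 4 + (p + 2) *
      (forestWeight (K + 2) n p - forestWeight (K + 1) (n + 1) p + forestWeight K (n + 1) p / 4)) := by
    refine mul_left_cancel₀ h4 ?_
    linear_combination h2 / 4
  have hp : (p : ℝ) + 2 ≠ 0 := by positivity
  have hK : (K : ℝ) + 1 ≠ 0 := by positivity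
  field_simp
  linear_combination (-8) * h5

theorem forestWeight_add (K L n p : ℕ) :
    forestWeight (K + L) n p = ∑ x ∈ Finset.HasAntidiagonal.antidiagonal n,
      forestWeight K x.1 p * forestWeight L x.2 p := by
  simp only [forestWeight]
  rw [pow_add (realTreeSeries p), coeff_mul, Finset.mul_sum]
  refine Finset.sum_congr rfl fun x hx => ?_
  rw [← Finset.HasAntidiagonal.mem_antidiagonal.1 hx]
  ring

end NormalizedCoefficients

/-! ### Trigonometric estimates and uniform upper bounds. -/

section Trigonometric

open Real

/-- The function `exp (x ^ 2 / 2) * cos x` decreases because `x ≤ tan x`. -/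
theorem cos_le_exp_neg_sq_div_two {x : ℝ} (h0 : 0 ≤ x) (h1 : x ≤ π / 2) :
    cos x ≤ exp (-x ^ 2 / 2) := by
  have hanti : AntitoneOn (fun x : ℝ => exp (x ^ 2 / 2) * cos x) (Set.Icc 0 (π / 2)) := by
    refine antitoneOn_of_deriv_nonpos (convex_Icc _ _) (by fun_prop) (by fun_prop) ?_
    intro y hy
    rw [interior_Icc] at hy
    have hd : HasDerivAt (fun x : ℝ => exp (x ^ 2 / 2) * cos x)
        (exp (y ^ 2 / 2) * (2 * y / 2) * cos y + exp (y ^ 2 / 2) * (-sin y)) y := by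
      refine HasDerivAt.mul (HasDerivAt.exp ?_) (hasDerivAt_cos y)
      simpa using (hasDerivAt_pow 2 y).div_const 2
    rw [hd.deriv]
    have hc : 0 < cos y := cos_pos_of_mem_Ioo ⟨by linarith [hy.1, pi_pos], hy.2⟩
    have ht := lt_tan hy.1 hy.2
    rw [tan_eq_sin_div_cos, lt_div_iff₀ hc] at ht
    have he := exp_pos (y ^ 2 / 2)
    nlinarith
  have h := hanti ⟨le_rfl, by positivity⟩ ⟨h0, h1⟩ h0
  simp only [cos_zero] at h
  have h2 : exp (x ^ 2 / 2) * cos x ≤ 1 := by simpa using h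
  rw [neg_div, exp_neg, ← one_div, le_div_iff₀ (exp_pos _)]
  linarith

theorem abs_cos_le_of_mem_Icc {x a : ℝ} (ha : 0 ≤ a) (h1 : a ≤ x) (h2 : x ≤ π - a) :
    |cos x| ≤ cos a := by
  rw [abs_le]
  constructor
  · rw [← cos_pi_sub]
    exact cos_le_cos_of_nonneg_of_le_pi (by linarith) (by linarith) h2
  · exact cos_le_cos_of_nonneg_of_le_pi ha (by linarith) h1

theorem forestWeight_one (n p : ℕ) :
    forestWeight 1 n p = 1 / (2 * (p + 2)) * ∑ k ∈ Finset.range (p + 1),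
      sin ((k + 1) * (π / (p + 2))) ^ 2 * (cos ((k + 1) * (π / (p + 2))) ^ 2) ^ n := by
  have hp : (p : ℝ) + 2 ≠ 0 := by positivity
  rw [forestWeight, pow_one, coeff_realTreeSeries, pathCount, Finset.sum_range_succ]
  have hlast : sin ((p + 1 + 1 : ℕ) * (π / (p + 2 : ℕ))) = 0 := by
    have : ((p + 1 + 1 : ℕ) : ℝ) * (π / (p + 2 : ℕ)) = π := by
      push_cast
      field_simp
      ring
    rw [this, sin_pi]
  rw [hlast, zero_mul, zero_mul, add_zero, ← mul_assoc, Finset.mul_sum, Finset.mul_sum]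
  refine Finset.sum_congr rfl fun k _ => ?_
  have e : ((k + 1 : ℕ) : ℝ) * (((0 : ℕ) + 1) * π / (p + 2 : ℕ)) = (k + 1) * (π / (p + 2)) := by
    push_cast; ring
  rw [e]
  push_cast
  rw [mul_pow, pow_mul, pow_mul, pow_succ, one_div, inv_pow]
  have h4 : (4 : ℝ) ^ n ≠ 0 := by positivity
  norm_num
  field_simp
  norm_num

/-- All modes satisfy `|cos| ≤ cos (π / (p + 2))`, and the number of modes is absorbed by the
prefactor. -/
theorem forestWeight_one_le (n p : ℕ) :
    forestWeight 1 n p ≤ exp (-(n * (π / (p + 2)) ^ 2)) := by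
  have hp : (0 : ℝ) < p + 2 := by positivity
  set a : ℝ := π / (p + 2) with ha
  have ha0 : 0 < a := by positivity
  have hpa : (p + 2) * a = π := by rw [ha]; field_simp
  have ha1 : a ≤ π / 2 := by
    rw [ha]
    gcongr
    linarith [p.cast_nonneg (α := ℝ)]
  have hc : (cos a ^ 2) ^ n ≤ exp (-(n * a ^ 2)) := by
    have h := cos_le_exp_neg_sq_div_two ha0.le ha1
    have h0 : 0 ≤ cos a := cos_nonneg_of_mem_Icc ⟨by linarith [pi_pos], ha1⟩
    calc (cos a ^ 2) ^ n ≤ (exp (-a ^ 2 / 2) ^ 2) ^ n := by gcongr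
      _ = exp (-(n * a ^ 2)) := by
        rw [← exp_nat_mul, ← exp_nat_mul]
        congr 1
        push_cast
        ring
  rw [forestWeight_one, ← ha]
  have hsum : ∑ k ∈ Finset.range (p + 1), sin ((k + 1) * a) ^ 2 * (cos ((k + 1) * a) ^ 2) ^ n ≤
      ∑ k ∈ Finset.range (p + 1), (cos a ^ 2) ^ n := by
    refine Finset.sum_le_sum fun k hk => ?_
    have hk' : (k : ℝ) + 1 ≤ p + 1 := by
      have := Finset.mem_range.1 hk
      exact_mod_cast this
    have h1 : |cos ((k + 1) * a)| ≤ cos a := by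
      refine abs_cos_le_of_mem_Icc ha0.le ?_ ?_
      · nlinarith [k.cast_nonneg (α := ℝ)]
      · nlinarith
    have h2 : cos ((k + 1) * a) ^ 2 ≤ cos a ^ 2 := sq_le_sq' (by linarith [(abs_le.1 h1).1])
      (abs_le.1 h1).2
    have h3 := sin_sq_le_one ((k + 1) * a)
    calc _ ≤ 1 * (cos a ^ 2) ^ n := by gcongr
      _ = _ := one_mul _
  rw [Finset.sum_const, Finset.card_range, nsmul_eq_mul] at hsum
  calc _ ≤ 1 / (2 * ((p : ℝ) + 2)) * (((p + 1 : ℕ) : ℝ) * (cos a ^ 2) ^ n) := by gcongr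
    _ = ((p + 1) / (2 * ((p : ℝ) + 2))) * (cos a ^ 2) ^ n := by push_cast; ring
    _ ≤ 1 * (cos a ^ 2) ^ n := by
      gcongr
      rw [div_le_one (by positivity)]
      linarith
    _ ≤ _ := by rwa [one_mul]

/-- The exponential bound is multiplicative along `x.1 + x.2 = n`, so every convolution costs only
the number `n + 1` of its terms. -/
theorem forestWeight_le (K n p : ℕ) :
    forestWeight K n p ≤ (n + 1) ^ K * exp (-(n * (π / (p + 2)) ^ 2)) := by
  induction K generalizing n with
  | zero =>
    rw [forestWeight_zero]
    split_ifs with h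
    · simp [h]
    · positivity
  | succ K ih =>
    rw [forestWeight_add]
    calc _ ≤ ∑ x ∈ Finset.HasAntidiagonal.antidiagonal n,
        ((n : ℝ) + 1) ^ K * exp (-(n * (π / (p + 2)) ^ 2)) := by
          refine Finset.sum_le_sum fun x hx => ?_
          have hx' := Finset.HasAntidiagonal.mem_antidiagonal.1 hx
          have hx1 : (x.1 : ℝ) ≤ n := by
            have : x.1 ≤ n := by omega
            exact_mod_cast this
          have e : exp (-(n * (π / ((p : ℝ) + 2)) ^ 2)) = exp (-(x.1 * (π / (p + 2)) ^ 2)) *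
              exp (-(x.2 * (π / (p + 2)) ^ 2)) := by
            rw [← exp_add, ← hx']
            congr 1
            push_cast
            ring
          rw [e, ← mul_assoc]
          refine mul_le_mul ((ih x.1).trans ?_) (forestWeight_one_le x.2 p)
            (forestWeight_nonneg _ _ _) (by positivity)
          gcongr
      _ = _ := by
        rw [Finset.sum_const, Finset.Nat.card_antidiagonal, nsmul_eq_mul, pow_succ]
        push_cast
        ring

end Trigonometric

/-! ### Calculus of iterated differences. -/

section IteratedDifference

/-- The iterated forward difference of a sequence. -/
def iterDiff : ℕ → (ℕ → ℝ) → ℕ → ℝ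
  | 0, f, n => f n
  | j + 1, f, n => iterDiff j f (n + 1) - iterDiff j f n

theorem iterDiff_add (j : ℕ) (f g : ℕ → ℝ) (n : ℕ) :
    iterDiff j (fun n => f n + g n) n = iterDiff j f n + iterDiff j g n := by
  induction j generalizing n with
  | zero => rfl
  | succ j ih => simp only [iterDiff, ih]; ring

theorem iterDiff_const_mul (j : ℕ) (c : ℝ) (f : ℕ → ℝ) (n : ℕ) :
    iterDiff j (fun n => c * f n) n = c * iterDiff j f n := by
  induction j generalizing n with
  | zero => rfl
  | succ j ih => simp only [iterDiff, ih]; ring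

theorem iterDiff_comp_succ (j : ℕ) (f : ℕ → ℝ) (n : ℕ) :
    iterDiff j (fun n => f (n + 1)) n = iterDiff j f (n + 1) := by
  induction j generalizing n with
  | zero => rfl
  | succ j ih => simp only [iterDiff, ih]

theorem iterDiff_sum {ι : Type*} (s : Finset ι) (j : ℕ) (f : ι → ℕ → ℝ) (n : ℕ) :
    iterDiff j (fun n => ∑ i ∈ s, f i n) n = ∑ i ∈ s, iterDiff j (f i) n := by
  induction j generalizing n with
  | zero => rfl
  | succ j ih => simp only [iterDiff, ih, Finset.sum_sub_distrib]

theorem iterDiff_pow (j : ℕ) (a : ℝ) (n : ℕ) :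
    iterDiff j (fun n => a ^ n) n = (a - 1) ^ j * a ^ n := by
  induction j generalizing n with
  | zero => simp [iterDiff]
  | succ j ih => simp only [iterDiff, ih]; ring

theorem iterDiff_diff (j : ℕ) (f : ℕ → ℝ) (n : ℕ) :
    iterDiff j (fun n => f (n + 1) - f n) n = iterDiff (j + 1) f n := by
  induction j generalizing n with
  | zero => rfl
  | succ j ih => rw [iterDiff, ih, ih]; rfl

/-- The discrete Leibniz rule. For `j = 0` the truncated index `j - 1` is harmless because of the
factor `j`. -/
theorem iterDiff_id_mul (j : ℕ) (f : ℕ → ℝ) (n : ℕ) :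
    iterDiff j (fun n => n * f n) n = n * iterDiff j f n + j * iterDiff (j - 1) f (n + 1) := by
  induction j generalizing n with
  | zero => simp [iterDiff]
  | succ j ih =>
    rw [iterDiff, ih, ih]
    cases j with
    | zero => simp [iterDiff]; ring
    | succ j => simp only [iterDiff, Nat.add_sub_cancel]; push_cast; ring

end IteratedDifference

/-! ### Asymptotics in the cubic regime: one mode dominates, and Laguerre weights appear. -/

section ScalingLimit

open Real

/-- The dominant contribution to `forestWeight 1`. -/
noncomputable def leadingMode (n p : ℕ) : ℝ :=
  1 / (p + 2) * sin (π / (p + 2)) ^ 2 * (cos (π / (p + 2)) ^ 2) ^ n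

/-- The regime `n → ∞`, `n / (p + 2) ^ 3 → ρ`. -/
noncomputable def cubicRegime (ρ : ℝ) : Filter (ℕ × ℕ) :=
  comap (fun x : ℕ × ℕ => x.1) atTop ⊓ comap (fun x : ℕ × ℕ => (x.1 : ℝ) / (x.2 + 2) ^ 3) (𝓝 ρ)

theorem tendsto_fst_cubicRegime (ρ : ℝ) :
    Tendsto (fun x : ℕ × ℕ => x.1) (cubicRegime ρ) atTop :=
  tendsto_comap.mono_left inf_le_left

theorem tendsto_ratio_cubicRegime (ρ : ℝ) :
    Tendsto (fun x : ℕ × ℕ => (x.1 : ℝ) / (x.2 + 2) ^ 3) (cubicRegime ρ) (𝓝 ρ) :=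
  tendsto_comap.mono_left inf_le_right

theorem tendsto_snd_cubicRegime {ρ : ℝ} (hρ : 0 < ρ) :
    Tendsto (fun x : ℕ × ℕ => (x.2 : ℝ) + 2) (cubicRegime ρ) atTop := by
  rw [tendsto_atTop]
  intro b
  have h1 := (tendsto_ratio_cubicRegime ρ).eventually (gt_mem_nhds (show ρ < 2 * ρ by linarith))
  have h2 := (tendsto_natCast_atTop_atTop (R := ℝ)).comp (tendsto_fst_cubicRegime ρ)
  filter_upwards [h1, h2.eventually_ge_atTop (2 * ρ * |b| ^ 3)] with x hx1 hx2
  have hM : (0 : ℝ) < (x.2 : ℝ) + 2 := by positivity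
  rw [div_lt_iff₀ (by positivity)] at hx1
  simp only [Function.comp] at hx2
  have h3 : |b| ^ 3 < ((x.2 : ℝ) + 2) ^ 3 := by
    have := hx2.trans_lt hx1
    exact lt_of_mul_lt_mul_left this (by positivity)
  exact (le_abs_self b).trans (lt_of_pow_lt_pow_left₀ 3 hM.le h3).le

theorem tendsto_inv_snd_cubicRegime {ρ : ℝ} (hρ : 0 < ρ) :
    Tendsto (fun x : ℕ × ℕ => 1 / ((x.2 : ℝ) + 2)) (cubicRegime ρ) (𝓝 0) := by
  simp only [one_div]
  exact (tendsto_snd_cubicRegime hρ).inv_tendsto_atTop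

/-- `f` is asymptotic to `ℓ` times the leading mode in the cubic regime, together with its iterated
differences. -/
def IsModeLike (ρ ℓ : ℝ) (f : ℕ → ℕ → ℝ) : Prop :=
  ∀ j : ℕ, Tendsto (fun x : ℕ × ℕ => ((x.2 : ℝ) + 2) ^ (2 * j) *
    iterDiff j (fun n => f n x.2) x.1 / leadingMode x.1 x.2) (cubicRegime ρ) (𝓝 ((-π ^ 2) ^ j * ℓ))

variable {ρ ℓ ℓ' : ℝ} {f g : ℕ → ℕ → ℝ}

theorem IsModeLike.add (hf : IsModeLike ρ ℓ f) (hg : IsModeLike ρ ℓ' g) :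
    IsModeLike ρ (ℓ + ℓ') fun n p => f n p + g n p := by
  intro j
  convert (hf j).add (hg j) using 1
  · ext x
    rw [iterDiff_add]
    ring
  · ring_nf

theorem IsModeLike.mul_left (hf : IsModeLike ρ ℓ f) {c : ℕ → ℝ} {a : ℝ}
    (hc : Tendsto (fun x : ℕ × ℕ => c x.2) (cubicRegime ρ) (𝓝 a)) :
    IsModeLike ρ (a * ℓ) fun n p => c p * f n p := by
  intro j
  convert hc.mul (hf j) using 1
  · ext x
    rw [iterDiff_const_mul]
    ring
  · ring_nf

theorem IsModeLike.const_mul (hf : IsModeLike ρ ℓ f) (a : ℝ) :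
    IsModeLike ρ (a * ℓ) fun n p => a * f n p :=
  hf.mul_left tendsto_const_nhds

theorem tendsto_pow_mul_iterDiff (hρ : 0 < ρ) (hf : IsModeLike ρ ℓ f) {i j : ℕ} (hij : i < 2 * j) :
    Tendsto (fun x : ℕ × ℕ => ((x.2 : ℝ) + 2) ^ i * iterDiff j (fun n => f n x.2) x.1 /
      leadingMode x.1 x.2) (cubicRegime ρ) (𝓝 0) := by
  have h := ((tendsto_inv_snd_cubicRegime hρ).pow (2 * j - i)).mul (hf j)
  rw [zero_pow (by omega), zero_mul] at h
  refine h.congr fun x => ?_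
  have hM : (x.2 : ℝ) + 2 ≠ 0 := by positivity
  have : ((x.2 : ℝ) + 2) ^ (2 * j) = (x.2 + 2) ^ i * (x.2 + 2) ^ (2 * j - i) := by
    rw [← pow_add]
    congr 1
    omega
  rw [this, one_div, inv_pow]
  field_simp

theorem IsModeLike.comp_succ (hρ : 0 < ρ) (hf : IsModeLike ρ ℓ f) :
    IsModeLike ρ ℓ fun n p => f (n + 1) p := by
  intro j
  have h := (hf j).add (tendsto_pow_mul_iterDiff hρ hf (show 2 * j < 2 * (j + 1) by omega))
  rw [add_zero] at h
  refine h.congr fun x => ?_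
  rw [iterDiff_comp_succ j fun n => f n x.2, iterDiff]
  ring

theorem IsModeLike.comp_add (hρ : 0 < ρ) (hf : IsModeLike ρ ℓ f) (s : ℕ) :
    IsModeLike ρ ℓ fun n p => f (n + s) p := by
  induction s with
  | zero => exact hf
  | succ s ih =>
    have := ih.comp_succ hρ
    simpa only [Nat.add_right_comm _ 1 s, ← Nat.add_assoc] using this

theorem IsModeLike.diff_div (hρ : 0 < ρ) (hf : IsModeLike ρ ℓ f) :
    IsModeLike ρ 0 fun n p => 1 / ((p : ℝ) + 2) * (f (n + 1) p - f n p) := by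
  intro j
  rw [mul_zero]
  have h := tendsto_pow_mul_iterDiff hρ hf (show 2 * j < 2 * (j + 1) by omega)
  have h2 := (tendsto_inv_snd_cubicRegime hρ).mul h
  rw [mul_zero] at h2
  refine h2.congr fun x => ?_
  rw [iterDiff_const_mul, iterDiff_diff j fun n => f n x.2]
  ring

/-- A difference gains `-π² / (p + 2)²`, and `n / (p + 2)³ → ρ` compensates for it exactly. This is
the only term of `forestWeight_rec` with the factor `1 / (p + 2)` that survives in the limit. Since
it contains a difference of `f`, the induction on `K` needs control of the differences of all
orders. -/
theorem IsModeLike.id_mul_diff (hρ : 0 < ρ) (hf : IsModeLike ρ ℓ f) :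
    IsModeLike ρ (-π ^ 2 * ρ * ℓ)
      fun n p => 1 / ((p : ℝ) + 2) * (n * (f (n + 1) p - f n p)) := by
  intro j
  have h1 := (tendsto_ratio_cubicRegime ρ).mul (hf (j + 1))
  have h2 := ((tendsto_inv_snd_cubicRegime hρ).mul ((hf.comp_succ hρ) j)).const_mul (j : ℝ)
  have h := h1.add h2
  convert h using 1
  · ext x
    have hM : (x.2 : ℝ) + 2 ≠ 0 := by positivity
    rw [iterDiff_const_mul, iterDiff_id_mul j fun n => f (n + 1) x.2 - f n x.2,
      iterDiff_diff j fun n => f n x.2, iterDiff_diff (j - 1) fun n => f n x.2,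
      iterDiff_comp_succ j fun n => f n x.2]
    cases j with
    | zero =>
      simp
      field_simp
    | succ j =>
      simp only [Nat.add_sub_cancel]
      field_simp
      ring
  · rw [zero_mul, mul_zero, add_zero, pow_succ]
    ring_nf

theorem tendsto_mul_sin_cubicRegime (hρ : 0 < ρ) :
    Tendsto (fun x : ℕ × ℕ => ((x.2 : ℝ) + 2) * sin (π / (x.2 + 2))) (cubicRegime ρ) (𝓝 π) := by
  have h0 : Tendsto (fun x : ℕ × ℕ => π / ((x.2 : ℝ) + 2)) (cubicRegime ρ) (𝓝 0) := by
    simpa [div_eq_mul_inv] using (tendsto_inv_snd_cubicRegime hρ).const_mul π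
  have h1 : Tendsto (fun x : ℕ × ℕ => π * sinc (π / ((x.2 : ℝ) + 2))) (cubicRegime ρ)
      (𝓝 (π * sinc 0)) := ((continuous_sinc.tendsto 0).comp h0).const_mul π
  rw [sinc_zero, mul_one] at h1
  refine h1.congr fun x => ?_
  rw [sinc_of_ne_zero (by positivity)]
  field_simp

theorem leadingMode_pos {p : ℕ} (hp : 1 ≤ p) (n : ℕ) : 0 < leadingMode n p := by
  have hp' : (1 : ℝ) ≤ p := by exact_mod_cast hp
  have h1 : 0 < π / ((p : ℝ) + 2) := by positivity
  have h2 : π / ((p : ℝ) + 2) < π / 2 := by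
    gcongr
    linarith
  have := sin_pos_of_pos_of_lt_pi h1 (by linarith [pi_pos])
  have := cos_pos_of_mem_Ioo ⟨by linarith [pi_pos], h2⟩
  rw [leadingMode]
  positivity

theorem iterDiff_forestWeight_one (j n p : ℕ) :
    iterDiff j (fun n => forestWeight 1 n p) n = 1 / (2 * (p + 2)) * ∑ k ∈ Finset.range (p + 1),
      sin ((k + 1) * (π / (p + 2))) ^ 2 * (-sin ((k + 1) * (π / (p + 2))) ^ 2) ^ j *
        (cos ((k + 1) * (π / (p + 2))) ^ 2) ^ n := by
  simp only [forestWeight_one]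
  rw [iterDiff_const_mul, iterDiff_sum]
  congr 1
  refine Finset.sum_congr rfl fun k _ => ?_
  rw [iterDiff_const_mul, iterDiff_pow, cos_sq']
  ring

/-- The modes other than the leading one are exponentially smaller. -/
theorem abs_iterDiff_forestWeight_one_sub_le {p : ℕ} (hp : 2 ≤ p) (j n : ℕ) :
    |iterDiff j (fun n => forestWeight 1 n p) n -
      (-sin (π / (p + 2)) ^ 2) ^ j * leadingMode n p| ≤
      ((p + 2) ^ 3 * exp (-(2 * n * (π / (p + 2)) ^ 2))) * leadingMode n p := by
  have hp' : (2 : ℝ) ≤ p := by exact_mod_cast hp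
  have hM : (0 : ℝ) < p + 2 := by positivity
  set a : ℝ := π / (p + 2) with ha
  have ha0 : 0 < a := by positivity
  have hpa : (p + 2) * a = π := by rw [ha]; field_simp
  have ha1 : 2 * a ≤ π / 2 := by nlinarith
  have hc : 0 < cos a := cos_pos_of_mem_Ioo ⟨by linarith [pi_pos], by linarith⟩
  have hc1 := cos_le_one a
  have hsin : 2 / (p + 2) ≤ sin a := by
    have := mul_le_sin ha0.le (by linarith)
    convert this using 1
    rw [ha]
    field_simp
  set F : ℕ → ℝ := fun k => sin ((k + 1) * a) ^ 2 * (-sin ((k + 1) * a) ^ 2) ^ j *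
    (cos ((k + 1) * a) ^ 2) ^ n with hF
  obtain ⟨q, rfl⟩ : ∃ q, p = q + 1 := ⟨p - 1, by omega⟩
  -- The first and the last mode coincide under `x ↦ π - x`; together they cancel the `1 / 2` of the
  -- prefactor and form the leading mode.
  have hsplit : ∑ k ∈ Finset.range (q + 1 + 1), F k =
      2 * F 0 + ∑ k ∈ Finset.range q, F (k + 1) := by
    rw [Finset.sum_range_succ, Finset.sum_range_succ']
    have : F (q + 1) = F 0 := by
      have e : ((q + 1 : ℕ) + 1 : ℝ) * a = π - ((0 : ℕ) + 1) * a := by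
        push_cast at hpa ⊢
        linarith
      simp only [hF]
      rw [e, sin_pi_sub, cos_pi_sub, neg_sq]
    rw [this]
    ring
  have hF0 : 1 / (2 * ((q + 1 : ℕ) + 2)) * (2 * F 0) =
      (-sin a ^ 2) ^ j * leadingMode n (q + 1) := by
    simp only [hF, leadingMode, ← ha]
    push_cast
    rw [zero_add, one_mul]
    field_simp
  have hbound : ∀ k ∈ Finset.range q, |F (k + 1)| ≤ (cos (2 * a) ^ 2) ^ n := by
    intro k hk
    have hk' : (k : ℝ) + 1 ≤ q := by exact_mod_cast Finset.mem_range.1 hk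
    have h1 : |cos (((k + 1 : ℕ) + 1) * a)| ≤ cos (2 * a) := by
      push_cast at hpa ⊢
      refine abs_cos_le_of_mem_Icc (by linarith) ?_ ?_
      · nlinarith [k.cast_nonneg (α := ℝ)]
      · nlinarith
    have h2 : cos (((k + 1 : ℕ) + 1) * a) ^ 2 ≤ cos (2 * a) ^ 2 :=
      sq_le_sq' (by linarith [(abs_le.1 h1).1]) (abs_le.1 h1).2
    have h3 := sin_sq_le_one (((k + 1 : ℕ) + 1) * a)
    have h4 : |(-sin (((k + 1 : ℕ) + 1) * a) ^ 2)| ≤ 1 := by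
      rw [abs_neg, abs_of_nonneg (sq_nonneg _)]
      exact h3
    simp only [hF]
    rw [abs_mul, abs_mul, abs_pow (-_), abs_of_nonneg (sq_nonneg (sin _)),
      abs_of_nonneg (pow_nonneg (sq_nonneg (cos _)) n)]
    calc _ ≤ 1 * 1 ^ j * (cos (2 * a) ^ 2) ^ n := by gcongr
      _ = _ := by simp
  -- With `c = cos a` this is `(1 - c) * (1 + c - c²) ≥ 0`. It provides the spectral gap: the second
  -- mode is smaller than the first by at least `cos a ^ 4` per unit of `n`.
  have hcos2 : cos (2 * a) ≤ cos a ^ 3 := by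
    rw [cos_two_mul]
    nlinarith [mul_nonneg (sub_nonneg.2 hc1) (show 0 ≤ 1 + cos a - cos a ^ 2 by nlinarith)]
  have hcos0 : 0 ≤ cos (2 * a) := cos_nonneg_of_mem_Icc ⟨by linarith [pi_pos], ha1⟩
  have hexp : (cos (2 * a) ^ 2) ^ n ≤ exp (-(2 * n * a ^ 2)) * (cos a ^ 2) ^ n := by
    have h := cos_le_exp_neg_sq_div_two ha0.le (by linarith)
    calc (cos (2 * a) ^ 2) ^ n ≤ ((cos a ^ 3) ^ 2) ^ n := by gcongr
      _ = (cos a ^ 4) ^ n * (cos a ^ 2) ^ n := by rw [← mul_pow]; ring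
      _ ≤ (exp (-a ^ 2 / 2) ^ 4) ^ n * (cos a ^ 2) ^ n := by gcongr
      _ = _ := by
        rw [← exp_nat_mul, ← exp_nat_mul]
        congr 2
        push_cast
        ring
  rw [iterDiff_forestWeight_one, ← ha, hsplit, mul_add, hF0, add_sub_cancel_left, abs_mul,
    abs_of_nonneg (by positivity)]
  have hsum : |∑ k ∈ Finset.range q, F (k + 1)| ≤ q * (exp (-(2 * n * a ^ 2)) * (cos a ^ 2) ^ n) := by
    calc _ ≤ ∑ k ∈ Finset.range q, |F (k + 1)| := Finset.abs_sum_le_sum_abs _ _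
      _ ≤ ∑ k ∈ Finset.range q, (cos (2 * a) ^ 2) ^ n := Finset.sum_le_sum hbound
      _ = q * (cos (2 * a) ^ 2) ^ n := by simp
      _ ≤ _ := by gcongr
  set E := exp (-(2 * n * a ^ 2)) * (cos a ^ 2) ^ n with hE
  have hE0 : 0 ≤ E := by positivity
  have hmode : (((q + 1 : ℕ) : ℝ) + 2) ^ 3 * exp (-(2 * n * a ^ 2)) * leadingMode n (q + 1) =
      ((q + 1 : ℕ) + 2) ^ 2 * sin a ^ 2 * E := by
    simp only [leadingMode, ← ha, hE]
    field_simp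
  rw [hmode]
  have hsin2 : 4 ≤ (((q + 1 : ℕ) : ℝ) + 2) ^ 2 * sin a ^ 2 := by
    rw [div_le_iff₀ hM] at hsin
    nlinarith
  calc _ ≤ 1 / (2 * (((q + 1 : ℕ) : ℝ) + 2)) * (q * E) := by gcongr
    _ = (q / (2 * (((q + 1 : ℕ) : ℝ) + 2))) * E := by ring
    _ ≤ 1 * E := by
      gcongr
      rw [div_le_one (by positivity)]
      push_cast
      linarith [q.cast_nonneg (α := ℝ)]
    _ ≤ _ := by
      gcongr
      linarith

/-- On the leading mode a difference is multiplication by `-sin² (π / (p + 2))`. The other modes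
have relative size at most `(p + 2)³ exp (-2nπ² / (p + 2)²)`, which is exponentially small in `p` as
soon as `n ≥ (ρ / 2) (p + 2)³`. -/
theorem isModeLike_forestWeight_one (hρ : 0 < ρ) :
    IsModeLike ρ 1 fun n p => forestWeight 1 n p := by
  intro j
  have hM := tendsto_snd_cubicRegime hρ
  have hmain : Tendsto (fun x : ℕ × ℕ => ((x.2 : ℝ) + 2) ^ (2 * j) * (-sin (π / (x.2 + 2)) ^ 2) ^ j)
      (cubicRegime ρ) (𝓝 ((-π ^ 2) ^ j * 1)) := by
    have h := ((tendsto_mul_sin_cubicRegime hρ).pow 2).neg.pow j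
    rw [mul_one]
    refine h.congr fun x => ?_
    rw [pow_mul, ← mul_pow]
    ring
  have herr : Tendsto (fun x : ℕ × ℕ => ((x.2 : ℝ) + 2) ^ (2 * j) *
      ((x.2 + 2) ^ 3 * exp (-(2 * x.1 * (π / (x.2 + 2)) ^ 2)))) (cubicRegime ρ) (𝓝 0) := by
    have h0 : Tendsto (fun t : ℝ => t ^ ((2 * j + 3 : ℕ) : ℝ) * exp (-(π ^ 2 * ρ) * t)) atTop (𝓝 0) :=
      tendsto_rpow_mul_exp_neg_mul_atTop_nhds_zero _ _ (by positivity)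
    refine squeeze_zero' (Eventually.of_forall fun x => by positivity) ?_ (h0.comp hM)
    filter_upwards [(tendsto_ratio_cubicRegime ρ).eventually
      (lt_mem_nhds (show ρ / 2 < ρ by linarith))] with x hx
    have hM0 : (0 : ℝ) < (x.2 : ℝ) + 2 := by positivity
    rw [lt_div_iff₀ (by positivity)] at hx
    simp only [Function.comp, rpow_natCast]
    rw [← mul_assoc, ← pow_add]
    gcongr
    rw [neg_mul, neg_le_neg_iff, div_pow, ← mul_div_assoc, le_div_iff₀ (by positivity)]
    nlinarith [pi_pos, mul_pos pi_pos pi_pos]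
  refine tendsto_of_tendsto_of_dist hmain (squeeze_zero' (Eventually.of_forall fun x => dist_nonneg)
    ?_ herr)
  filter_upwards [hM.eventually_ge_atTop 4] with x hx
  have hx2 : 2 ≤ x.2 := by
    have : (2 : ℝ) ≤ x.2 := by linarith
    exact_mod_cast this
  have hpos := leadingMode_pos (show 1 ≤ x.2 by omega) x.1
  have h := abs_iterDiff_forestWeight_one_sub_le hx2 j x.1
  have hM0 : (0 : ℝ) < (x.2 : ℝ) + 2 := by positivity
  rw [dist_comm, dist_eq]
  have e : ((x.2 : ℝ) + 2) ^ (2 * j) * iterDiff j (fun n => forestWeight 1 n x.2) x.1 /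
      leadingMode x.1 x.2 - ((x.2 : ℝ) + 2) ^ (2 * j) * (-sin (π / (x.2 + 2)) ^ 2) ^ j =
      (x.2 + 2) ^ (2 * j) * ((iterDiff j (fun n => forestWeight 1 n x.2) x.1 -
        (-sin (π / (x.2 + 2)) ^ 2) ^ j * leadingMode x.1 x.2) / leadingMode x.1 x.2) := by
    field_simp
  rw [e, abs_mul, abs_of_pos (by positivity), abs_div, abs_of_pos hpos]
  gcongr
  rw [div_le_iff₀ hpos]
  exact h

theorem isModeLike_forestWeight_zero : IsModeLike ρ 0 fun n p => forestWeight 0 n p := by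
  intro j
  rw [mul_zero]
  refine tendsto_const_nhds.congr' ?_
  filter_upwards [(tendsto_fst_cubicRegime ρ).eventually_ge_atTop 1] with x hx
  have : ∀ j n, 1 ≤ n → iterDiff j (fun n => forestWeight 0 n x.2) n = 0 := by
    intro j
    induction j with
    | zero => exact fun n hn => by rw [iterDiff, forestWeight_zero, if_neg (by omega)]
    | succ j ih => exact fun n hn => by rw [iterDiff, ih _ (by omega), ih _ hn, sub_zero]
  rw [this j x.1 hx]
  simp

/-- The weights `∑_{j ≥ 1} C(K, j) a ^ (j - 1) / (j - 1)!`. -/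
noncomputable def laguerreSum (a : ℝ) (K : ℕ) : ℝ :=
  ∑ i ∈ Finset.range K, (K.choose (i + 1) : ℝ) * (a ^ i / (i.factorial : ℝ))

theorem laguerreSum_eq {a : ℝ} {K m : ℕ} (h : K ≤ m) : laguerreSum a K =
    ∑ i ∈ Finset.range m, (K.choose (i + 1) : ℝ) * (a ^ i / (i.factorial : ℝ)) := by
  refine Finset.sum_subset (by simpa using h) fun i _ hi => ?_
  rw [Nat.choose_eq_zero_of_lt (by simpa [Nat.lt_succ_iff] using hi)]
  simp

/-- The three-term recursion of the Laguerre polynomials with parameter `1`, evaluated at `-a`; it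
is checked coefficient by coefficient with Pascal's rule. -/
theorem laguerreSum_add_two (a : ℝ) (K : ℕ) :
    laguerreSum a (K + 2) = (2 + a / (K + 1)) * laguerreSum a (K + 1) - laguerreSum a K := by
  have hK : (K : ℝ) + 1 ≠ 0 := by positivity
  have h1 : a / (K + 1) * laguerreSum a (K + 1) =
      ∑ i ∈ Finset.range (K + 2), ((i : ℝ) * ((K + 1).choose i : ℝ) / (K + 1)) *
        (a ^ i / (i.factorial : ℝ)) := by
    rw [Finset.sum_range_succ', laguerreSum, Finset.mul_sum]
    simp only [Nat.cast_zero, zero_mul, zero_div, add_zero]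
    refine Finset.sum_congr rfl fun i _ => ?_
    rw [Nat.factorial_succ]
    push_cast
    field_simp
    ring
  rw [add_mul, h1, laguerreSum, laguerreSum_eq (show K + 1 ≤ K + 2 by omega),
    laguerreSum_eq (show K ≤ K + 2 by omega), Finset.mul_sum, ← Finset.sum_add_distrib,
    ← Finset.sum_sub_distrib]
  refine Finset.sum_congr rfl fun i _ => ?_
  have h2 : (i : ℝ) * ((K + 1).choose i : ℝ) / (K + 1) = (K + 2).choose (i + 1) -
      2 * (K + 1).choose (i + 1) + K.choose (i + 1) := by
    have e1 : ((K + 2).choose (i + 1) : ℝ) = (K + 1).choose i + (K + 1).choose (i + 1) := by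
      exact_mod_cast Nat.choose_succ_succ (K + 1) i
    have e2 : ((K + 1).choose (i + 1) : ℝ) = K.choose i + K.choose (i + 1) := by
      exact_mod_cast Nat.choose_succ_succ K i
    rw [e1, e2]
    cases i with
    | zero => simp; ring
    | succ i =>
      have e3 : ((K + 1).choose (i + 1) : ℝ) = K.choose i + K.choose (i + 1) := by
        exact_mod_cast Nat.choose_succ_succ K i
      have e4 : ((K : ℝ) + 1) * K.choose i = (K + 1).choose (i + 1) * (i + 1) := by
        exact_mod_cast Nat.add_one_mul_choose_eq K i
      rw [div_eq_iff hK]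
      push_cast
      linear_combination (-1) * e4 - (K + 1) * e3
  rw [h2]
  ring

/-- In the limit `forestWeight_rec` reads `ℓ_{K+2} = (1 + π²ρ / (K + 1)) ℓ_{K+1} - ℓ_K / 4`;
rescaling by `2 ^ K / 2` turns this into `laguerreSum_add_two` with `a = 2π²ρ`. -/
theorem isModeLike_forestWeight (hρ : 0 < ρ) (K : ℕ) :
    IsModeLike ρ (2 / 2 ^ K * laguerreSum (2 * π ^ 2 * ρ) K) fun n p => forestWeight K n p := by
  induction K using Nat.twoStepInduction with
  | zero => simpa [laguerreSum] using isModeLike_forestWeight_zero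
  | one => simpa [laguerreSum] using isModeLike_forestWeight_one hρ
  | more K ih0 ih1 =>
    have hK : (K : ℝ) + 1 ≠ 0 := by positivity
    set f := fun n p => forestWeight (K + 1) n p
    set g := fun n p => forestWeight K n p
    have hinv := tendsto_inv_snd_cubicRegime hρ
    have key := (((((ih1.comp_succ hρ).add ((ih0.comp_succ hρ).const_mul (-1 / 4))).add
      ((ih1.id_mul_diff hρ).const_mul (-1 / (K + 1)))).add
      ((ih1.diff_div hρ).const_mul (-(K + 2) / (K + 1)))).add
      ((ih1.mul_left (c := fun p => 1 / ((p : ℝ) + 2)) hinv).const_mul (-1 / (K + 1) - 1 / 2))).add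
      (((ih0.comp_succ hρ).mul_left (c := fun p => 1 / ((p : ℝ) + 2)) hinv).const_mul (1 / 4))
    convert key using 1
    · rw [laguerreSum_add_two]
      field_simp
      ring
    · ext n p
      rw [forestWeight_rec]
      have hp : (p : ℝ) + 2 ≠ 0 := by positivity
      field_simp
      ring

end ScalingLimit

/-! ### Laplace's method for the sum over heights. -/

section Laplace

open Real

/-- As a function of `M` the exponent has its minimum `3 / 2 * μ * x₀ * t` at `M = x₀ * t`, and the
excess is exactly `μ d² / M + μ d² x₀ t / (2 M²)` with `d = |M - x₀ * t|`. Away from the minimiser,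
`d` dominates both `t` and `M`, so the excess is linear in `t + M`; this makes the tail summable and
negligible. -/
theorem exists_exponent_gap {μ x₀ ε : ℝ} (hμ : 0 < μ) (hx₀ : 0 < x₀) (hx : μ * x₀ ^ 3 = 2 * π ^ 2)
    (hε : 0 < ε) : ∃ κ > 0, ∀ t M : ℝ, 0 < t → 0 < M → ε * t ≤ |M - x₀ * t| →
      3 / 2 * μ * x₀ * t + κ * (t + M) ≤ μ * M + t ^ 3 * (π / M) ^ 2 := by
  set A := x₀ / ε + 1 with hA
  set B := (x₀ + 1) / ε + 1 with hB
  have hA0 : 0 < A := by positivity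
  have hB0 : 0 < B := by positivity
  refine ⟨μ / (A * B), by positivity, fun t M ht hM h => ?_⟩
  set d := |M - x₀ * t| with hd
  have hd0 : 0 < d := lt_of_lt_of_le (by positivity) h
  have htd : t ≤ d / ε := by rwa [le_div_iff₀ hε, mul_comm]
  have hMd : M ≤ A * d := by
    have h1 : M - x₀ * t ≤ d := le_abs_self _
    have h2 : x₀ * t ≤ x₀ * (d / ε) := by gcongr
    have h3 : A * d = x₀ * (d / ε) + d := by rw [hA]; ring
    linarith
  have htM : t + M ≤ B * d := by
    have h3 : B * d = d / ε + x₀ * (d / ε) + d := by rw [hB]; ring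
    have h1 : M - x₀ * t ≤ d := le_abs_self _
    have h2 : x₀ * t ≤ x₀ * (d / ε) := by gcongr
    linarith
  have hsq : M * (t + M) ≤ A * B * d ^ 2 := by
    calc M * (t + M) ≤ (A * d) * (B * d) := by gcongr
      _ = _ := by ring
  have hd2 : d ^ 2 = (M - x₀ * t) ^ 2 := sq_abs _
  have e : μ * M + t ^ 3 * (π / M) ^ 2 - 3 / 2 * μ * x₀ * t =
      μ * (d ^ 2 / M) + μ * d ^ 2 * (x₀ * t) / (2 * M ^ 2) := by
    rw [hd2, div_pow]
    field_simp
    linear_combination (-t ^ 3) * hx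
  have h1 : μ / (A * B) * (t + M) ≤ μ * (d ^ 2 / M) := by
    rw [div_mul_eq_mul_div, div_le_iff₀ (by positivity)]
    have : t + M ≤ A * B * d ^ 2 / M := by rwa [le_div_iff₀ hM, mul_comm]
    calc μ * (t + M) ≤ μ * (A * B * d ^ 2 / M) := by gcongr
      _ = _ := by ring
  have h2 : 0 ≤ μ * d ^ 2 * (x₀ * t) / (2 * M ^ 2) := by positivity
  linarith

theorem exp_neg_le_one_sub {u : ℝ} (h1 : u ≤ 1 / 2) :
    exp (-(u + 2 * u ^ 2)) ≤ 1 - u := by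
  have hpos : 0 < 1 - u := by linarith
  rw [← le_log_iff_exp_le hpos]
  refine le_trans ?_ (one_sub_inv_le_log_of_pos hpos)
  rw [← one_div, le_sub_iff_add_le, ← le_sub_iff_add_le', div_le_iff₀ hpos]
  nlinarith [mul_nonneg (sq_nonneg u) (show 0 ≤ 1 - 2 * u by linarith)]

theorem leadingMode_nonneg (n p : ℕ) : 0 ≤ leadingMode n p := by
  rw [leadingMode]
  positivity

theorem leadingMode_le (n p : ℕ) : leadingMode n p ≤ exp (-(n * (π / (p + 2)) ^ 2)) := by
  have hp : (0 : ℝ) < p + 2 := by positivity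
  set a : ℝ := π / (p + 2) with ha
  have ha0 : 0 < a := by positivity
  have ha1 : a ≤ π / 2 := by
    rw [ha]
    gcongr
    linarith [p.cast_nonneg (α := ℝ)]
  have hc : 0 ≤ cos a := cos_nonneg_of_mem_Icc ⟨by linarith [pi_pos], ha1⟩
  have h1 : 1 / ((p : ℝ) + 2) ≤ 1 := by
    rw [div_le_one hp]
    linarith [p.cast_nonneg (α := ℝ)]
  have h2 := cos_le_exp_neg_sq_div_two ha0.le ha1
  have h3 := sin_sq_le_one a
  rw [leadingMode, ← ha]
  calc _ ≤ 1 * 1 * (exp (-a ^ 2 / 2) ^ 2) ^ n := by gcongr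
    _ = _ := by
      rw [← exp_nat_mul, ← exp_nat_mul, one_mul, one_mul]
      congr 1
      push_cast
      ring

theorem leadingMode_ge {n p : ℕ} (hp : 4 ≤ p) :
    4 / ((p : ℝ) + 2) ^ 3 * exp (-(n * (π / (p + 2)) ^ 2 + 2 * (n * (π / (p + 2)) ^ 4))) ≤
      leadingMode n p := by
  have hp' : (4 : ℝ) ≤ p := by exact_mod_cast hp
  have hM : (0 : ℝ) < p + 2 := by positivity
  set a : ℝ := π / (p + 2) with ha
  have ha0 : 0 < a := by positivity
  have ha1 : a ^ 2 ≤ 1 / 2 := by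
    have : a ≤ 0.7 := by
      rw [ha, div_le_iff₀ hM]
      linarith [pi_lt_d2]
    nlinarith
  have ha2 : a ≤ π / 2 := by
    rw [ha]
    gcongr
    linarith
  have hsin : 2 / (p + 2) ≤ sin a := by
    have := mul_le_sin ha0.le ha2
    convert this using 1
    rw [ha]
    field_simp
  have hcos : exp (-(a ^ 2 + 2 * (a ^ 2) ^ 2)) ≤ cos a ^ 2 := by
    refine (exp_neg_le_one_sub ha1).trans ?_
    rw [cos_sq']
    have := sin_le ha0.le
    have h0 : 0 ≤ sin a := le_trans (by positivity) hsin
    nlinarith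
  rw [leadingMode, ← ha]
  calc _ = 1 / ((p : ℝ) + 2) * (2 / (p + 2)) ^ 2 * exp (-(a ^ 2 + 2 * (a ^ 2) ^ 2)) ^ n := by
        rw [← exp_nat_mul]
        have : -(n * a ^ 2 + 2 * (n * a ^ 4)) = n * -(a ^ 2 + 2 * (a ^ 2) ^ 2) := by ring
        rw [this]
        field_simp
        norm_num
    _ ≤ _ := by gcongr

theorem summable_exp_neg_mul {b : ℝ} (hb : 0 < b) : Summable fun p : ℕ => exp (-b * p) := by
  have := summable_geometric_of_lt_one (exp_pos (-b)).le (by simpa using hb)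
  refine this.congr fun p => ?_
  rw [← exp_nat_mul, mul_comm]

theorem summable_exp_neg_mul_mul {b B : ℝ} (hb : 0 < b) {f : ℕ → ℝ} (h0 : ∀ p, 0 ≤ f p)
    (h : ∀ p, f p ≤ B) : Summable fun p : ℕ => exp (-b * p) * f p := by
  refine Summable.of_nonneg_of_le (fun p => mul_nonneg (exp_pos _).le (h0 p)) (fun p => ?_)
    ((summable_exp_neg_mul hb).mul_right B)
  exact mul_le_mul_of_nonneg_left (h p) (exp_pos _).le

theorem summable_leadingMode {μ : ℝ} (hμ : 0 < μ) (n : ℕ) :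
    Summable fun p : ℕ => exp (-μ * p) * leadingMode n p :=
  summable_exp_neg_mul_mul hμ (leadingMode_nonneg n) fun p =>
    (leadingMode_le n p).trans (exp_le_one_iff.2 (by simp only [neg_nonpos]; positivity))

theorem tendsto_rpow_third : Tendsto (fun n : ℕ => (n : ℝ) ^ (1 / 3 : ℝ)) atTop atTop :=
  (tendsto_rpow_atTop (by norm_num)).comp tendsto_natCast_atTop_atTop

theorem rpow_third_pow_three (n : ℕ) : ((n : ℝ) ^ (1 / 3 : ℝ)) ^ 3 = n := by
  rw [← rpow_natCast, ← rpow_mul (by positivity)]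
  norm_num

theorem exists_le_tsum_leadingMode {μ x₀ : ℝ} (hμ : 0 < μ) (hx₀ : 0 < x₀)
    (hx : μ * x₀ ^ 3 = 2 * π ^ 2) : ∃ c > 0, ∀ᶠ n : ℕ in atTop,
      c * exp (-(3 / 2 * μ * x₀ * (n : ℝ) ^ (1 / 3 : ℝ))) / n ≤
        ∑' p : ℕ, exp (-μ * p) * leadingMode n p := by
  -- Only the term `p + 2 = ⌈x₀ * t⌉` is kept. Here `(x₀ + 1) ^ 3` bounds the prefactor, `μ` pays
  -- for rounding, and the last summand pays for the quartic correction in `leadingMode_ge`.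
  refine ⟨4 / (x₀ + 1) ^ 3 * exp (-(μ + 2 * (π ^ 4 / x₀ ^ 4))), by positivity, ?_⟩
  filter_upwards [tendsto_rpow_third.eventually_ge_atTop 1,
    tendsto_rpow_third.eventually_ge_atTop (6 / x₀)] with n h1 h6
  set t := (n : ℝ) ^ (1 / 3 : ℝ) with ht
  have ht3 : t ^ 3 = n := rpow_third_pow_three n
  rw [div_le_iff₀ hx₀] at h6
  have hceil := Nat.le_ceil (x₀ * t)
  have hceil' := Nat.ceil_lt_add_one (show 0 ≤ x₀ * t by positivity)
  have h6' : 6 ≤ ⌈x₀ * t⌉₊ := by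
    have : (6 : ℝ) ≤ ⌈x₀ * t⌉₊ := by linarith
    exact_mod_cast this
  obtain ⟨p, hp⟩ : ∃ p, ⌈x₀ * t⌉₊ = p + 2 := ⟨⌈x₀ * t⌉₊ - 2, by omega⟩
  rw [hp] at hceil hceil' h6'
  push_cast at hceil hceil'
  have hM : (0 : ℝ) < p + 2 := by positivity
  refine le_trans ?_ ((summable_leadingMode hμ n).le_tsum p fun i _ =>
    mul_nonneg (exp_pos _).le (leadingMode_nonneg n i))
  refine le_trans ?_ (mul_le_mul_of_nonneg_left (leadingMode_ge (n := n) (show 4 ≤ p by omega))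
    (exp_pos _).le)
  rw [← ht3]
  have hxt : 0 < x₀ * t := by positivity
  have hM3 : ((p : ℝ) + 2) ^ 3 ≤ (x₀ + 1) ^ 3 * t ^ 3 := by
    rw [← mul_pow]
    gcongr
    linarith
  have b1 : t ^ 3 * (π / (p + 2)) ^ 2 ≤ 1 / 2 * μ * x₀ * t := by
    calc t ^ 3 * (π / (p + 2)) ^ 2 ≤ t ^ 3 * (π / (x₀ * t)) ^ 2 := by gcongr
      _ = 1 / 2 * μ * x₀ * t := by
        field_simp
        linear_combination (-1) * hx
  have b2 : t ^ 3 * (π / (p + 2)) ^ 4 ≤ π ^ 4 / x₀ ^ 4 := by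
    calc t ^ 3 * (π / (p + 2)) ^ 4 ≤ t ^ 3 * (π / (x₀ * t)) ^ 4 := by gcongr
      _ = (π ^ 4 / x₀ ^ 4) / t := by field_simp
      _ ≤ _ := div_le_self (by positivity) h1
  have b3 : exp (-(μ + 2 * (π ^ 4 / x₀ ^ 4))) * exp (-(3 / 2 * μ * x₀ * t)) ≤
      exp (-μ * p) * exp (-(t ^ 3 * (π / (p + 2)) ^ 2 + 2 * (t ^ 3 * (π / (p + 2)) ^ 4))) := by
    rw [← exp_add, ← exp_add]
    have := mul_le_mul_of_nonneg_left hceil'.le hμ.le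
    refine exp_le_exp.2 ?_
    linarith
  calc _ = 4 / ((x₀ + 1) ^ 3 * t ^ 3) *
        (exp (-(μ + 2 * (π ^ 4 / x₀ ^ 4))) * exp (-(3 / 2 * μ * x₀ * t))) := by field_simp
    _ ≤ 4 / ((p : ℝ) + 2) ^ 3 * (exp (-μ * p) *
        exp (-(t ^ 3 * (π / (p + 2)) ^ 2 + 2 * (t ^ 3 * (π / (p + 2)) ^ 4)))) := by gcongr
    _ = _ := by ring

open Classical in
/-- The sum over the heights outside of the scaling window is negligible. -/
theorem tendsto_tail_div {μ x₀ ε : ℝ} (hμ : 0 < μ) (hx₀ : 0 < x₀) (hx : μ * x₀ ^ 3 = 2 * π ^ 2)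
    (hε : 0 < ε) (a : ℕ) : Tendsto (fun n : ℕ => (∑' p : ℕ, exp (-μ * p) *
      (if ε * (n : ℝ) ^ (1 / 3 : ℝ) ≤ |(p : ℝ) + 2 - x₀ * (n : ℝ) ^ (1 / 3 : ℝ)| then
        ((n : ℝ) + 1) ^ a * exp (-(n * (π / (p + 2)) ^ 2)) else 0)) /
      ∑' p : ℕ, exp (-μ * p) * leadingMode n p) atTop (𝓝 0) := by
  obtain ⟨κ, hκ, hgap⟩ := exists_exponent_gap hμ hx₀ hx hε
  obtain ⟨c, hc, hlow⟩ := exists_le_tsum_leadingMode hμ hx₀ hx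
  set S := ∑' p : ℕ, exp (-κ * p) with hS
  have hS0 : 0 ≤ S := tsum_nonneg fun p => (exp_pos _).le
  have hlim : Tendsto (fun n : ℕ => (exp (2 * μ) * S * 2 ^ a / c) *
      (((n : ℝ) ^ (1 / 3 : ℝ)) ^ ((3 * a + 3 : ℕ) : ℝ) * exp (-κ * (n : ℝ) ^ (1 / 3 : ℝ)))) atTop
      (𝓝 0) := by
    have := ((tendsto_rpow_mul_exp_neg_mul_atTop_nhds_zero ((3 * a + 3 : ℕ) : ℝ) κ hκ).comp
      tendsto_rpow_third).const_mul (exp (2 * μ) * S * 2 ^ a / c)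
    rwa [mul_zero] at this
  refine squeeze_zero' (Eventually.of_forall fun n => ?_) ?_ hlim
  · refine div_nonneg (tsum_nonneg fun p => ?_) (tsum_nonneg fun p =>
      mul_nonneg (exp_pos _).le (leadingMode_nonneg n p))
    split_ifs <;> positivity
  filter_upwards [hlow, eventually_ge_atTop 1] with n hn hn1
  have hn1' : (1 : ℝ) ≤ n := by exact_mod_cast hn1
  set t := (n : ℝ) ^ (1 / 3 : ℝ) with ht
  have ht3 : t ^ 3 = n := rpow_third_pow_three n
  have ht0 : 0 < t := by positivity
  have hterm : ∀ p : ℕ, exp (-μ * p) *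
      (if ε * t ≤ |(p : ℝ) + 2 - x₀ * t| then
        ((n : ℝ) + 1) ^ a * exp (-(n * (π / (p + 2)) ^ 2)) else 0) ≤
      (exp (2 * μ) * ((n : ℝ) + 1) ^ a * exp (-(3 / 2 * μ * x₀ * t) + -κ * t)) * exp (-κ * p) := by
    intro p
    split_ifs with hp
    · have h := hgap t (p + 2) ht0 (by positivity) hp
      rw [ht3] at h
      have e : exp (-μ * p) * exp (-(n * (π / (p + 2)) ^ 2)) ≤
          exp (2 * μ) * exp (-(3 / 2 * μ * x₀ * t) + -κ * t) * exp (-κ * p) := by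
        rw [← exp_add, ← exp_add, ← exp_add]
        refine exp_le_exp.2 ?_
        linarith
      calc _ = ((n : ℝ) + 1) ^ a * (exp (-μ * p) * exp (-(n * (π / (p + 2)) ^ 2))) := by ring
        _ ≤ ((n : ℝ) + 1) ^ a * (exp (2 * μ) * exp (-(3 / 2 * μ * x₀ * t) + -κ * t) *
            exp (-κ * p)) := by gcongr
        _ = _ := by ring
    · rw [mul_zero]
      positivity
  have hsum := (summable_exp_neg_mul hκ).mul_left
    (exp (2 * μ) * ((n : ℝ) + 1) ^ a * exp (-(3 / 2 * μ * x₀ * t) + -κ * t))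
  have htsum := Summable.tsum_le_tsum hterm (Summable.of_nonneg_of_le
    (fun p => by split_ifs <;> positivity) hterm hsum) hsum
  rw [tsum_mul_left, ← hS] at htsum
  have hpos : 0 < c * exp (-(3 / 2 * μ * x₀ * t)) / n := by positivity
  rw [div_le_iff₀ (hpos.trans_le hn)]
  refine htsum.trans (le_trans ?_ (mul_le_mul_of_nonneg_left hn (by positivity)))
  have e1 : ((n : ℝ) + 1) ^ a ≤ 2 ^ a * (t ^ 3) ^ a := by
    rw [← mul_pow, ht3]
    gcongr
    linarith
  rw [exp_add, rpow_natCast]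
  calc _ = exp (2 * μ) * exp (-(3 / 2 * μ * x₀ * t)) * exp (-κ * t) * S * ((n : ℝ) + 1) ^ a := by
        ring
    _ ≤ exp (2 * μ) * exp (-(3 / 2 * μ * x₀ * t)) * exp (-κ * t) * S * (2 ^ a * (t ^ 3) ^ a) := by
        gcongr
    _ = _ := by
        rw [← ht3]
        field_simp
        ring

/-- For `p + 2` in a small window around `x₀ n^{1/3}` the pair `(n, p)` is in the cubic regime with
`ρ = 1 / x₀³`, so `f` is uniformly close to `ℓ` times the leading mode. Outside the window both are
bounded by the same exponential, and `tendsto_tail_div` applies. -/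
theorem tendsto_tsum_div_tsum_leadingMode {μ ℓ C : ℝ} (hμ : 0 < μ) {a : ℕ} {f : ℕ → ℕ → ℝ}
    (hf0 : ∀ n p, 0 ≤ f n p)
    (hf : ∀ n p, f n p ≤ C * ((n + 1) ^ a * exp (-(n * (π / (p + 2)) ^ 2))))
    (hlim : Tendsto (fun x : ℕ × ℕ => f x.1 x.2 / leadingMode x.1 x.2)
      (cubicRegime (μ / (2 * π ^ 2))) (𝓝 ℓ)) :
    Tendsto (fun n : ℕ => (∑' p : ℕ, exp (-μ * p) * f n p) /
      ∑' p : ℕ, exp (-μ * p) * leadingMode n p) atTop (𝓝 ℓ) := by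
  classical
  obtain ⟨x₀, hx₀, hx⟩ : ∃ x₀ : ℝ, 0 < x₀ ∧ μ * x₀ ^ 3 = 2 * π ^ 2 := by
    refine ⟨(2 * π ^ 2 / μ) ^ (1 / 3 : ℝ), by positivity, ?_⟩
    rw [← rpow_natCast, ← rpow_mul (by positivity)]
    norm_num
    field_simp
  rw [Metric.tendsto_atTop']
  intro η hη
  have hev := (Metric.tendsto_nhds.1 hlim) (η / 2) (by positivity)
  rw [cubicRegime, eventually_inf] at hev
  obtain ⟨s, hs, s', hs', hss⟩ := hev
  obtain ⟨u, hu, hus⟩ := mem_comap.1 hs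
  obtain ⟨u', hu', hus'⟩ := mem_comap.1 hs'
  obtain ⟨n₀, hn₀⟩ := mem_atTop_sets.1 hu
  have hcont : ContinuousAt (fun x : ℝ => 1 / x ^ 3) x₀ :=
    continuousAt_const.div (by fun_prop) (by positivity)
  have hx3 : 1 / x₀ ^ 3 = μ / (2 * π ^ 2) := by
    rw [← hx]
    field_simp
  rw [ContinuousAt, hx3] at hcont
  obtain ⟨ε₀, hε₀, hball⟩ := Metric.mem_nhds_iff.1 (hcont hu')
  -- The bound `ε₀` keeps `n / (p + 2)³` in the required neighbourhood; `x₀ / 2` ensures `p ≥ 1` for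
  -- large `n`, so that the leading mode is positive.
  set ε := min ε₀ (x₀ / 2) with hε
  have hε0 : 0 < ε := by positivity
  set C' := max C 0 + |ℓ| with hC'
  have htail := (tendsto_tail_div hμ hx₀ hx hε0 a).const_mul C'
  rw [mul_zero] at htail
  have h1 := htail.eventually (gt_mem_nhds (show (0 : ℝ) < η / 2 by positivity))
  obtain ⟨c, hc, hlow⟩ := exists_le_tsum_leadingMode hμ hx₀ hx
  obtain ⟨N, hN⟩ := eventually_atTop.1 (h1.and (hlow.and ((eventually_ge_atTop (max n₀ 1)).and
    (tendsto_rpow_third.eventually_ge_atTop (6 / x₀)))))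
  refine ⟨N, fun n hn => ?_⟩
  obtain ⟨htl, hlw, hn1, h6⟩ := hN n hn.le
  set t := (n : ℝ) ^ (1 / 3 : ℝ) with ht
  have ht3 : t ^ 3 = n := rpow_third_pow_three n
  have hnpos : (0 : ℝ) < n := by
    have : 0 < n := lt_of_lt_of_le (by simp) hn1
    exact_mod_cast this
  have ht0 : 0 < t := by positivity
  set H := ∑' p : ℕ, exp (-μ * p) * leadingMode n p with hH
  have hHpos : 0 < H := lt_of_lt_of_le (by positivity) hlw
  set b : ℕ → ℝ := fun p => if ε * t ≤ |(p : ℝ) + 2 - x₀ * t| then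
    ((n : ℝ) + 1) ^ a * exp (-(n * (π / (p + 2)) ^ 2)) else 0 with hb
  have hB : ∀ p : ℕ, ((n : ℝ) + 1) ^ a * exp (-(n * (π / (p + 2)) ^ 2)) ≤ ((n : ℝ) + 1) ^ a :=
    fun p => mul_le_of_le_one_right (by positivity)
      (exp_le_one_iff.2 (by simp only [neg_nonpos]; positivity))
  have hb0 : ∀ p, 0 ≤ b p := fun p => by simp only [hb]; split_ifs <;> positivity
  have hbB : ∀ p, b p ≤ ((n : ℝ) + 1) ^ a := fun p => by
    simp only [hb]
    split_ifs
    · exact hB p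
    · positivity
  have hsf : Summable fun p : ℕ => exp (-μ * p) * f n p :=
    summable_exp_neg_mul_mul hμ (hf0 n) (B := max C 0 * ((n : ℝ) + 1) ^ a) fun p =>
      (hf n p).trans (mul_le_mul (le_max_left _ _) (hB p) (by positivity) (le_max_right _ _))
  have hsm := summable_leadingMode hμ n
  have hsb := summable_exp_neg_mul_mul hμ hb0 hbB
  have hpoint : ∀ p, |f n p - ℓ * leadingMode n p| ≤ η / 2 * leadingMode n p + C' * b p := by
    intro p
    have hm0 := leadingMode_nonneg n p
    by_cases hp : ε * t ≤ |(p : ℝ) + 2 - x₀ * t|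
    · simp only [hb, if_pos hp]
      have e1 : |f n p| ≤ max C 0 * (((n : ℝ) + 1) ^ a * exp (-(n * (π / (p + 2)) ^ 2))) := by
        rw [abs_of_nonneg (hf0 n p)]
        refine (hf n p).trans ?_
        gcongr
        exact le_max_left _ _
      have e2 : |ℓ * leadingMode n p| ≤
          |ℓ| * (((n : ℝ) + 1) ^ a * exp (-(n * (π / (p + 2)) ^ 2))) := by
        rw [abs_mul, abs_of_nonneg hm0]
        gcongr
        refine (leadingMode_le n p).trans (le_mul_of_one_le_left (exp_pos _).le ?_)
        exact one_le_pow₀ (by linarith)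
      have e3 := abs_sub (f n p) (ℓ * leadingMode n p)
      have e4 : 0 ≤ η / 2 * leadingMode n p := by positivity
      rw [hC', add_mul]
      linarith
    · simp only [hb, if_neg hp, mul_zero, add_zero]
      rw [not_le] at hp
      have hxe : ε ≤ x₀ / 2 := min_le_right _ _
      have hp3 : 1 ≤ p := by
        have h7 := (abs_lt.1 hp).1
        rw [div_le_iff₀ hx₀] at h6
        have h8 : ε * t ≤ x₀ / 2 * t := by gcongr
        have : (1 : ℝ) ≤ p := by linarith
        exact_mod_cast this
      have hm := leadingMode_pos hp3 n
      have hin : (n, p) ∈ s ∩ s' := by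
        constructor
        · exact hus (hn₀ n (le_trans (le_max_left _ _) hn1))
        · apply hus'
          have hmem : ((p : ℝ) + 2) / t ∈ Metric.ball x₀ ε₀ := by
            rw [Metric.mem_ball, dist_eq]
            have : ((p : ℝ) + 2) / t - x₀ = (p + 2 - x₀ * t) / t := by field_simp
            rw [this, abs_div, abs_of_pos ht0, div_lt_iff₀ ht0]
            refine hp.trans_le ?_
            gcongr
            exact min_le_left _ _
          have h9 := hball hmem
          simp only [Set.mem_preimage] at h9 ⊢
          convert h9 using 1
          rw [← ht3]
          field_simp
      have h10 : |f n p / leadingMode n p - ℓ| < η / 2 := by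
        have := hss _ hin
        rwa [dist_eq] at this
      have : f n p - ℓ * leadingMode n p = (f n p / leadingMode n p - ℓ) * leadingMode n p := by
        field_simp
      rw [this, abs_mul, abs_of_pos hm]
      gcongr
  rw [dist_eq]
  have e : (∑' p : ℕ, exp (-μ * p) * f n p) / H - ℓ =
      (∑' p : ℕ, exp (-μ * p) * (f n p - ℓ * leadingMode n p)) / H := by
    rw [div_sub' hHpos.ne', mul_comm H ℓ, hH, ← tsum_mul_left, ← hsf.tsum_sub (hsm.mul_left ℓ)]
    congr 2
    ext p
    ring
  rw [e, abs_div, abs_of_pos hHpos, div_lt_iff₀ hHpos]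
  have hs1 : Summable fun p : ℕ => η / 2 * (exp (-μ * p) * leadingMode n p) +
      C' * (exp (-μ * p) * b p) := (hsm.mul_left _).add (hsb.mul_left _)
  have hle : ∀ p : ℕ, |exp (-μ * p) * (f n p - ℓ * leadingMode n p)| ≤
      η / 2 * (exp (-μ * p) * leadingMode n p) + C' * (exp (-μ * p) * b p) := by
    intro p
    rw [abs_mul, abs_of_pos (exp_pos _)]
    calc _ ≤ exp (-μ * p) * (η / 2 * leadingMode n p + C' * b p) := by
          gcongr
          exact hpoint p
      _ = _ := by ring
  have hs2 : Summable fun p : ℕ => |exp (-μ * p) * (f n p - ℓ * leadingMode n p)| :=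
    Summable.of_nonneg_of_le (fun p => abs_nonneg _) hle hs1
  have hfin := (norm_tsum_le_tsum_norm (f := fun p : ℕ =>
    exp (-μ * p) * (f n p - ℓ * leadingMode n p)) hs2).trans (Summable.tsum_le_tsum hle hs2 hs1)
  rw [(hsm.mul_left _).tsum_add (hsb.mul_left _), tsum_mul_left, tsum_mul_left] at hfin
  rw [← mul_div_assoc, div_lt_iff₀ hHpos] at htl
  rw [norm_eq_abs] at hfin
  calc _ ≤ _ := hfin
    _ < η / 2 * H + η / 2 * H := by gcongr
    _ = η * H := by ring

theorem summable_forestWeight {μ : ℝ} (hμ : 0 < μ) (K n : ℕ) :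
    Summable fun p : ℕ => exp (-μ * p) * forestWeight K n p :=
  summable_exp_neg_mul_mul hμ (fun p => forestWeight_nonneg K n p) (B := ((n : ℝ) + 1) ^ K) fun p =>
    (forestWeight_le K n p).trans (mul_le_of_le_one_right (by positivity)
      (exp_le_one_iff.2 (by simp only [neg_nonpos]; positivity)))

/-- The choice `ρ = μ / (2π²)` makes the Laguerre argument `2π²ρ` equal to `μ`. The shift `s`
accounts for the edges inside the prescribed ball, which the numerator omits and the partition
function does not. -/
theorem tendsto_tsum_forestWeight_div {μ : ℝ} (hμ : 0 < μ) (K s : ℕ) :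
    Tendsto (fun n : ℕ => (∑' p : ℕ, exp (-μ * p) * forestWeight K n p) /
      ∑' p : ℕ, exp (-μ * p) * forestWeight 1 (n + s) p) atTop
      (𝓝 (2 / 2 ^ K * laguerreSum μ K)) := by
  have hρ : 0 < μ / (2 * π ^ 2) := by positivity
  have e : 2 * π ^ 2 * (μ / (2 * π ^ 2)) = μ := by field_simp
  have h1 : Tendsto (fun n : ℕ => (∑' p : ℕ, exp (-μ * p) * forestWeight K n p) /
      ∑' p : ℕ, exp (-μ * p) * leadingMode n p) atTop (𝓝 (2 / 2 ^ K * laguerreSum μ K)) := by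
    refine tendsto_tsum_div_tsum_leadingMode hμ (C := 1) (a := K)
      (fun n p => forestWeight_nonneg K n p) (fun n p => ?_) ?_
    · rw [one_mul]
      exact forestWeight_le K n p
    · have := isModeLike_forestWeight hρ K 0
      rw [e] at this
      simpa [iterDiff] using this
  have h2 : Tendsto (fun n : ℕ => (∑' p : ℕ, exp (-μ * p) * forestWeight 1 (n + s) p) /
      ∑' p : ℕ, exp (-μ * p) * leadingMode n p) atTop (𝓝 1) := by
    refine tendsto_tsum_div_tsum_leadingMode hμ (C := 1) (a := 0)
      (fun n p => forestWeight_nonneg 1 _ p) (fun n p => ?_) ?_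
    · rw [one_mul, pow_zero, one_mul]
      refine (forestWeight_one_le (n + s) p).trans ?_
      gcongr
      linarith
    · have := (isModeLike_forestWeight_one hρ).comp_add hρ s 0
      simpa [iterDiff] using this
  have h3 := h1.div h2 one_ne_zero
  rw [div_one] at h3
  obtain ⟨x₀, hx₀, hx⟩ : ∃ x₀ : ℝ, 0 < x₀ ∧ μ * x₀ ^ 3 = 2 * π ^ 2 := by
    refine ⟨(2 * π ^ 2 / μ) ^ (1 / 3 : ℝ), by positivity, ?_⟩
    rw [← rpow_natCast, ← rpow_mul (by positivity)]
    norm_num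
    field_simp
  obtain ⟨c, hc, hlow⟩ := exists_le_tsum_leadingMode hμ hx₀ hx
  refine h3.congr' ?_
  filter_upwards [hlow, eventually_ge_atTop 1] with n hn hn1
  have hn1' : (0 : ℝ) < n := by exact_mod_cast hn1
  have hH : 0 < ∑' p : ℕ, exp (-μ * p) * leadingMode n p := lt_of_lt_of_le (by positivity) hn
  simp only [Pi.div_apply]
  rw [div_div_div_cancel_right₀ hH.ne']

end Laplace

/-! ### Lists: sums over lists, blocks of consecutive positions. -/

section Lists

theorem ENNReal.tsum_list {α : Type*} (F : List α → ENNReal) :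
    ∑' l, F l = F [] + ∑' a, ∑' l, F (a :: l) := by
  let e : (Unit ⊕ α × List α) ≃ List α :=
    { toFun := fun x => x.elim (fun _ => []) fun y => y.1 :: y.2
      invFun := fun l => match l with
        | [] => Sum.inl ()
        | a :: l => Sum.inr (a, l)
      left_inv := by rintro (_ | ⟨a, l⟩) <;> rfl
      right_inv := by rintro (_ | ⟨a, l⟩) <;> rfl }
  rw [← e.tsum_eq F, Summable.tsum_sum ENNReal.summable ENNReal.summable, ← ENNReal.tsum_prod,
    tsum_fintype]
  simp [e]

theorem List.sum_map_range_eq (f : ℕ → ℕ) (n : ℕ) :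
    ((List.range n).map f).sum = ∑ i ∈ Finset.range n, f i := by
  induction n with
  | zero => simp
  | succ n ih => simp [List.range_succ, Finset.sum_range_succ, ih]

/-- The index of the block containing `j`, where consecutive blocks of the lengths listed in `c`
are laid out from left to right. -/
def blockIndex : List ℕ → ℕ → ℕ
  | [], _ => 0
  | a :: c, j => if j < a then 0 else blockIndex c (j - a) + 1

/-- This characterisation by partial sums matches order preserving parent maps with lists of child
counts. -/
theorem blockIndex_lt_iff {c : List ℕ} {j : ℕ} (hj : j < c.sum) (i : ℕ) :
    blockIndex c j < i ↔ j < (c.take i).sum := by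
  induction c generalizing i j with
  | nil => simp at hj
  | cons a c ih =>
    cases i with
    | zero => simp
    | succ i =>
      rw [List.sum_cons] at hj
      simp only [blockIndex, List.take_succ_cons, List.sum_cons]
      split_ifs with h
      · simp only [Nat.zero_lt_succ, true_iff]
        omega
      · rw [Nat.add_lt_add_iff_right, ih (by omega)]
        omega

theorem blockIndex_lt_length {c : List ℕ} {j : ℕ} (hj : j < c.sum) :
    blockIndex c j < c.length := by
  rw [blockIndex_lt_iff hj, List.take_length]
  exact hj

theorem blockIndex_mono {c : List ℕ} {i j : ℕ} (hij : i ≤ j) (hj : j < c.sum) :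
    blockIndex c i ≤ blockIndex c j := by
  have h := (blockIndex_lt_iff hj (blockIndex c j + 1)).1 (Nat.lt_succ_self _)
  exact Nat.lt_succ_iff.1 ((blockIndex_lt_iff (hij.trans_lt hj) _).2 (hij.trans_lt h))

theorem Finset.mem_iff_lt_card_of_isLowerSet {s : Finset ℕ} (h : ∀ a ∈ s, ∀ b ≤ a, b ∈ s) (j : ℕ) :
    j ∈ s ↔ j < s.card := by
  constructor
  · intro hj
    have : Finset.range (j + 1) ⊆ s := fun b hb => h j hj b (by simpa [Nat.lt_succ_iff] using hb)
    simpa using Finset.card_le_card this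
  · intro hj
    by_contra hn
    have : s ⊆ Finset.range j := fun a ha => by
      rw [Finset.mem_range]
      by_contra hc
      exact hn (h a ha j (not_lt.1 hc))
    have := Finset.card_le_card this
    rw [Finset.card_range] at this
    omega

end Lists

/-! ### Coding of a planar tree by the child counts of its generations. -/

namespace PlanarTree

/-- The number of children of the vertex `i ∈ D_r`. -/
def childCount (T : PlanarTree) (r i : ℕ) : ℕ :=
  ((Finset.range (T.width (r + 1))).filter fun j => T.parent r j = i).card

/-- The numbers of children of the vertices of `D_r`, from left to right. -/
def code (T : PlanarTree) (r : ℕ) : List ℕ := (List.range (T.width r)).map (T.childCount r)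

@[simp]
theorem length_code (T : PlanarTree) (r : ℕ) : (T.code r).length = T.width r := by simp [code]

theorem sum_take_code (T : PlanarTree) (r i : ℕ) : ((T.code r).take i).sum =
    ((Finset.range (T.width (r + 1))).filter fun j => T.parent r j < i).card := by
  rw [code, ← List.map_take, List.take_range, List.sum_map_range_eq]
  have hm : Set.MapsTo (T.parent r)
      (((Finset.range (T.width (r + 1))).filter fun j => T.parent r j < i : Finset ℕ) : Set ℕ)
      ((Finset.range (min i (T.width r)) : Finset ℕ) : Set ℕ) := by
    intro j hj
    simp only [Finset.coe_filter, Finset.mem_range, Set.mem_ofPred_eq] at hj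
    simp only [Finset.coe_range, Set.mem_Iio, lt_min_iff]
    exact ⟨hj.2, T.parent_lt r j hj.1⟩
  rw [Finset.card_eq_sum_card_fiberwise hm]
  refine Finset.sum_congr rfl fun l hl => ?_
  rw [Finset.mem_range, lt_min_iff] at hl
  rw [childCount, Finset.filter_filter]
  congr 1
  ext j
  simp only [Finset.mem_filter]
  constructor
  · rintro ⟨h1, h2⟩
    exact ⟨h1, by omega, h2⟩
  · rintro ⟨h1, -, h2⟩
    exact ⟨h1, h2⟩

@[simp]
theorem sum_code (T : PlanarTree) (r : ℕ) : (T.code r).sum = T.width (r + 1) := by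
  have h := sum_take_code T r (T.width r)
  rw [List.take_of_length_le (by simp), Finset.filter_true_of_mem, Finset.card_range] at h
  · exact h
  · exact fun j hj => T.parent_lt r j (Finset.mem_range.1 hj)

theorem code_zero (T : PlanarTree) : T.code 0 = [1] := by
  have h1 := T.length_code 0
  have h2 := T.sum_code 0
  rw [T.width_zero] at h1
  rw [zero_add, T.width_one] at h2
  obtain ⟨a, ha⟩ := List.length_eq_one_iff.1 h1
  rw [ha] at h2 ⊢
  simpa using h2

/-- By monotonicity the vertices with parent below `i` form an initial segment, so membership is a
comparison with its cardinality. -/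
theorem parent_lt_iff (T : PlanarTree) {r j : ℕ} (hj : j < T.width (r + 1)) (i : ℕ) :
    T.parent r j < i ↔ j < ((T.code r).take i).sum := by
  rw [sum_take_code, ← Finset.mem_iff_lt_card_of_isLowerSet]
  · simp [hj]
  · intro a ha b hb
    simp only [Finset.mem_filter, Finset.mem_range] at ha ⊢
    exact ⟨by omega, (T.parent_mono r b a hb ha.1).trans_lt ha.2⟩

theorem parent_eq_blockIndex (T : PlanarTree) {r j : ℕ} (hj : j < T.width (r + 1)) :
    T.parent r j = blockIndex (T.code r) j := by
  have h : ∀ i, T.parent r j < i ↔ blockIndex (T.code r) j < i := fun i => by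
    rw [parent_lt_iff T hj, blockIndex_lt_iff (by rwa [sum_code])]
  have h1 := h (T.parent r j + 1)
  have h2 := h (blockIndex (T.code r) j + 1)
  omega

theorem ball_succ_eq_iff (n : ℕ) (T T' : PlanarTree) :
    ball (n + 1) T = ball (n + 1) T' ↔ ∀ s ≤ n, T.code s = T'.code s := by
  rw [ball_eq_ball_iff, show max (n + 1) 1 = n + 1 by omega]
  constructor
  · rintro ⟨h1, h2⟩ s hs
    have hc : T.childCount s = T'.childCount s := by
      funext i
      simp only [childCount]
      rw [h1 (s + 1) (by omega), h2 s (by omega)]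
    rw [code, code, h1 s (by omega), hc]
  · intro h
    have hw : ∀ s ≤ n + 1, T.width s = T'.width s := by
      intro s hs
      cases s with
      | zero => rw [T.width_zero, T'.width_zero]
      | succ s => rw [← sum_code, ← sum_code, h s (by omega)]
    refine ⟨hw, fun s hs => ?_⟩
    funext j
    by_cases hj : j < T.width (s + 1)
    · rw [T.parent_eq_blockIndex hj, T'.parent_eq_blockIndex (by rwa [← hw (s + 1) (by omega)]),
        h s (by omega)]
    · rw [T.parent_eq_zero s j (by omega),
        T'.parent_eq_zero s j (by rw [← hw (s + 1) (by omega)]; omega)]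

/-- The planar tree with given numbers of children. -/
def ofCode (c : ℕ → List ℕ) (h0 : c 0 = [1]) (h : ∀ r, (c (r + 1)).length = (c r).sum) :
    PlanarTree where
  width r := (c r).length
  parent r j := if j < (c r).sum then blockIndex (c r) j else 0
  width_zero := by simp [h0]
  width_one := by simp [h, h0]
  parent_lt r j hj := by
    rw [h] at hj
    rw [if_pos hj]
    exact blockIndex_lt_length hj
  parent_mono r i j hij hj := by
    rw [h] at hj
    rw [if_pos hj, if_pos (by omega)]
    exact blockIndex_mono hij hj
  parent_eq_zero r j hj := by
    rw [h] at hj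
    rw [if_neg (by omega)]

theorem code_ofCode (c : ℕ → List ℕ) (h0 : c 0 = [1]) (h : ∀ r, (c (r + 1)).length = (c r).sum)
    (r : ℕ) : (ofCode c h0 h).code r = c r := by
  refine List.eq_of_sum_take_eq (by rw [length_code]; rfl) fun i _ => ?_
  rw [sum_take_code]
  have : (Finset.range ((ofCode c h0 h).width (r + 1))).filter
      (fun j => (ofCode c h0 h).parent r j < i) = Finset.range ((c r).take i).sum := by
    have hle : ((c r).take i).sum ≤ (c r).sum := (List.take_sublist i (c r)).sum_le_sum (by simp)
    ext j
    simp only [Finset.mem_filter, Finset.mem_range, ofCode, h]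
    constructor
    · rintro ⟨h1, h2⟩
      rwa [if_pos h1, blockIndex_lt_iff h1] at h2
    · intro h1
      have h2 : j < (c r).sum := by omega
      refine ⟨h2, ?_⟩
      rwa [if_pos h2, blockIndex_lt_iff h2]
  rw [this, Finset.card_range]

/-- The tree which agrees with `T` up to height `n + 1`, where the vertices at height `n + 1` have
the numbers of children listed in `c`, and which has no vertex at height `n + 3`. -/
def graft (T : PlanarTree) (n : ℕ) (c : List ℕ) (hc : c.length = T.width (n + 1)) : PlanarTree :=
  ofCode (fun s => if s ≤ n then T.code s else if s = n + 1 then c else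
      if s = n + 2 then List.replicate c.sum 0 else [])
    (by simp [code_zero])
    (by
      intro r
      rcases lt_trichotomy r n with hr | hr | hr
      · rw [if_pos (show r + 1 ≤ n by omega), if_pos (show r ≤ n by omega)]
        simp
      · subst hr
        simp [hc]
      · rw [if_neg (show ¬ r + 1 ≤ n by omega), if_neg (show ¬ r + 1 = n + 1 by omega),
          if_neg (show ¬ r ≤ n by omega)]
        by_cases h1 : r = n + 1
        · rw [if_pos (show r + 1 = n + 2 by omega), if_pos h1, List.length_replicate]
        · rw [if_neg (show ¬ r + 1 = n + 2 by omega), if_neg h1]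
          split_ifs <;> simp)

variable {T : PlanarTree} {n : ℕ} {c : List ℕ} {hc : c.length = T.width (n + 1)}

theorem code_graft_of_le {s : ℕ} (hs : s ≤ n) : (T.graft n c hc).code s = T.code s := by
  rw [graft, code_ofCode, if_pos hs]

theorem code_graft_succ : (T.graft n c hc).code (n + 1) = c := by
  rw [graft, code_ofCode]
  simp

theorem width_graft : (T.graft n c hc).width (n + 2) = c.sum := by
  rw [← sum_code, code_graft_succ]

/-- Enlarging a prescribed ball by one generation amounts to prescribing one further list of child
counts; this drives the induction in `treeCount_add`. -/
theorem ball_eq_ball_graft_iff (T' : PlanarTree) :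
    ball (n + 2) T' = ball (n + 2) (T.graft n c hc) ↔
      ball (n + 1) T' = ball (n + 1) T ∧ T'.code (n + 1) = c := by
  rw [ball_succ_eq_iff, ball_succ_eq_iff]
  constructor
  · intro h
    refine ⟨fun s hs => ?_, ?_⟩
    · rw [h s (by omega), code_graft_of_le hs]
    · rw [h (n + 1) le_rfl, code_graft_succ]
  · rintro ⟨h1, h2⟩ s hs
    rcases Nat.lt_or_ge n s with h | h
    · obtain rfl : s = n + 1 := by omega
      rw [h2, code_graft_succ]
    · rw [h1 s h, code_graft_of_le h]

end PlanarTree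

/-! ### Expansion of powers of a geometric series over lists of exponents. -/

section Expansion

open PowerSeries

/-- Each of the `K` factors `v` is the geometric series of `X * f`. The list of chosen exponents
will be the list of child counts of one generation. -/
theorem cast_coeff_pow_mul_eq_tsum {f v : PowerSeries ℕ} (h : v = 1 + X * f * v) (n K : ℕ)
    (w : PowerSeries ℕ) : ((coeff n (v ^ K * w) : ℕ) : ENNReal) =
      ∑' c : List ℕ, if c.length = K then ((coeff n ((X * f) ^ c.sum * w) : ℕ) : ENNReal) else 0 := by
  induction K generalizing w with
  | zero =>
    rw [tsum_eq_single []]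
    · simp
    · intro c hc
      rw [if_neg]
      simpa using hc
  | succ K ih =>
    rw [ENNReal.tsum_list, pow_succ', mul_assoc, coeff_mul_eq_sum_of_eq_one_add h]
    have hs : ∑' a : ℕ, ((coeff n ((X * f) ^ a * (v ^ K * w)) : ℕ) : ENNReal) =
        ∑ a ∈ Finset.range (n + 1), ((coeff n ((X * f) ^ a * (v ^ K * w)) : ℕ) : ENNReal) := by
      refine tsum_eq_sum fun a ha => ?_
      rw [coeff_X_mul_pow_of_lt _ (by simpa [Nat.lt_succ_iff] using ha), Nat.cast_zero]
    rw [Nat.cast_sum, ← hs]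
    simp only [List.length_nil, (Nat.succ_ne_zero K).symm, if_false, zero_add, List.length_cons,
      Nat.add_right_cancel_iff, List.sum_cons]
    refine tsum_congr fun a => ?_
    rw [show (X * f) ^ a * (v ^ K * w) = v ^ K * ((X * f) ^ a * w) by ring, ih]
    refine tsum_congr fun c => ?_
    rw [show (X * f) ^ c.sum * ((X * f) ^ a * w) = (X * f) ^ (a + c.sum) * w by ring]

theorem ENNReal.tsum_eq_tsum_add {f : ℕ → ENNReal} (k : ℕ) (h : ∀ m < k, f m = 0) :
    ∑' m, f m = ∑' m, f (m + k) := by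
  refine ((add_left_injective k).tsum_eq fun m hm => ?_).symm
  refine ⟨m - k, Nat.sub_add_cancel ?_⟩
  by_contra hn
  exact hm (h m (not_le.1 hn))

end Expansion

/-! ### Counting trees with a prescribed ball; cylinder sets. -/

namespace PlanarTree

/-- The number of edges of the ball of radius `n + 1`. -/
def ballEdges (n : ℕ) (T : PlanarTree) : ℕ := ∑ s ∈ Finset.range (n + 1), T.width (s + 1)

theorem ballEdges_zero (T : PlanarTree) : ballEdges 0 T = 1 := by simp [ballEdges, width_one]

theorem ballEdges_succ (n : ℕ) (T : PlanarTree) :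
    ballEdges (n + 1) T = ballEdges n T + T.width (n + 2) := by
  rw [ballEdges, Finset.sum_range_succ]
  rfl

theorem size_ball_succ (n : ℕ) (T : PlanarTree) : (ball (n + 1) T).size = ballEdges n T := by
  rw [size_ball (n + 1) (by omega), ballEdges, Finset.range_eq_Ico,
    Finset.sum_Ico_add' (fun s => T.width s) 0 (n + 1) 1]
  rfl

/-- The tree has no vertices at height larger than `m + 1`. -/
def HeightLE (T : PlanarTree) (m : ℕ) : Prop := ∀ s, m + 1 < s → T.width s = 0

theorem width_succ_eq_zero {T : PlanarTree} {r : ℕ} (h : T.width r = 0) : T.width (r + 1) = 0 := by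
  by_contra hn
  have := T.parent_lt r 0 (by omega)
  omega

theorem width_eq_zero_of_le {T : PlanarTree} {r s : ℕ} (hrs : r ≤ s) (h : T.width r = 0) :
    T.width s = 0 := by
  induction s, hrs using Nat.le_induction with
  | base => exact h
  | succ s _ ih => exact width_succ_eq_zero ih

theorem ball_eq_self {T : PlanarTree} {m : ℕ} (h : T.HeightLE m) : ball (m + 1) T = T := by
  ext s j
  · simp only [ball]
    split_ifs with hs
    · rfl
    · rw [h s (by omega)]
  · simp only [ball]
    split_ifs with hs
    · rfl
    · rw [T.parent_eq_zero s j]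
      rw [h (s + 1) (by omega)]
      omega

theorem heightLE_ball (n : ℕ) (T : PlanarTree) : (ball (n + 1) T).HeightLE n := by
  intro s hs
  simp only [ball]
  rw [if_neg (by omega)]

theorem le_size_of_width_ne_zero {T : PlanarTree} {N r : ℕ} (hT : T.size = N)
    (hr : T.width r ≠ 0) : r ≤ N := by
  have hsub : (((Finset.range r).map ⟨fun s => (s, 0), fun a b h => (Prod.mk.inj h).1⟩ :
      Finset (ℕ × ℕ)) : Set (ℕ × ℕ)) ⊆ {e : ℕ × ℕ | e.2 < T.width (e.1 + 1)} := by
    intro e he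
    simp only [Finset.coe_map, Set.mem_image, Finset.coe_range,
      Set.mem_Iio] at he
    obtain ⟨s, hs, rfl⟩ := he
    refine Nat.pos_of_ne_zero fun h0 => hr ?_
    exact width_eq_zero_of_le (show s + 1 ≤ r by omega) h0
  have := Set.encard_le_encard hsub
  rw [Set.encard_coe_eq_coe_finsetCard, Finset.card_map, Finset.card_range] at this
  rw [size] at hT
  rw [hT] at this
  exact_mod_cast this

theorem height_le_iff {T : PlanarTree} {N m : ℕ} (hT : T.size = N) :
    T.height ≤ m + 1 ↔ T.HeightLE m := by
  have hbdd : BddAbove {r : ℕ | T.width r ≠ 0} := ⟨N, fun r hr => le_size_of_width_ne_zero hT hr⟩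
  constructor
  · intro h s hs
    by_contra hn
    have : s ≤ T.height := le_csSup hbdd hn
    omega
  · intro h
    refine csSup_le ⟨0, by simp [T.width_zero]⟩ fun r hr => ?_
    by_contra hn
    exact hr (h r (by omega))

theorem one_le_height {T : PlanarTree} {N : ℕ} (hT : T.size = N) : 1 ≤ T.height :=
  le_csSup (s := {r : ℕ | T.width r ≠ 0}) ⟨N, fun r hr => le_size_of_width_ne_zero hT hr⟩
    (by simp [T.width_one])

open Classical in
/-- The number of trees of size `N` and height at most `m + 1` with a given ball of radius
`n + 1`. -/
noncomputable def treeCount (N m n : ℕ) (T₀ : PlanarTree) : ENNReal :=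
  ∑' T : PlanarTree,
    if T.size = N ∧ T.HeightLE m ∧ ball (n + 1) T = ball (n + 1) T₀ then 1 else 0

theorem width_eq_of_ball_eq {n : ℕ} {T T' : PlanarTree} (h : ball (n + 1) T = ball (n + 1) T') {s : ℕ}
    (hs : s ≤ n + 1) : T.width s = T'.width s :=
  ((ball_eq_ball_iff _ _ _).1 h).1 s (by omega)

theorem ballEdges_eq_of_ball_eq {n : ℕ} {T T' : PlanarTree}
    (h : ball (n + 1) T = ball (n + 1) T') : ballEdges n T = ballEdges n T' :=
  Finset.sum_congr rfl fun s hs => width_eq_of_ball_eq h (by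
    have := Finset.mem_range.1 hs
    omega)

-- Induction on the number `p` of generations allowed above the ball. For `p = 0` only the ball
-- itself counts. Otherwise the trees are sorted by the child counts of generation `n + 1`, which
-- enlarges the ball by one generation and matches the expansion of `treeSeries (p + 1) ^ K`.
open PowerSeries in
theorem treeCount_add (N n p : ℕ) (T₀ : PlanarTree) : treeCount N (n + p) n T₀ =
    ((coeff N (X ^ ballEdges n T₀ * treeSeries p ^ T₀.width (n + 1)) : ℕ) : ENNReal) := by
  classical
  induction p generalizing n T₀ with
  | zero =>
    rw [treeCount, tsum_eq_single (ball (n + 1) T₀)]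
    · rw [treeSeries, one_pow, mul_one, coeff_X_pow]
      have h1 : ball (n + 1) (ball (n + 1) T₀) = ball (n + 1) T₀ := ball_eq_self (heightLE_ball n T₀)
      simp only [add_zero, heightLE_ball, h1, and_true, size_ball_succ]
      by_cases h : ballEdges n T₀ = N
      · rw [if_pos (by exact_mod_cast h), if_pos h.symm, Nat.cast_one]
      · rw [if_neg (by exact_mod_cast h), if_neg (Ne.symm h), Nat.cast_zero]
    · intro T hT
      rw [if_neg]
      rintro ⟨-, h2, h3⟩
      exact hT (by rw [← h3, ball_eq_self h2])
  | succ p ih =>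
    have h1 : treeCount N (n + (p + 1)) n T₀ = ∑' c : List ℕ, ∑' T : PlanarTree,
        if (T.size = N ∧ T.HeightLE (n + (p + 1)) ∧ ball (n + 1) T = ball (n + 1) T₀) ∧
          T.code (n + 1) = c then 1 else 0 := by
      rw [treeCount, ENNReal.tsum_comm]
      refine tsum_congr fun T => ?_
      rw [tsum_eq_single (T.code (n + 1))]
      · simp
      · intro c hc
        rw [if_neg]
        rintro ⟨-, h⟩
        exact hc h.symm
    rw [h1, mul_comm, cast_coeff_pow_mul_eq_tsum (treeSeries_succ p)]
    refine tsum_congr fun c => ?_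
    split_ifs with hc
    · have h2 := ih (n + 1) (T₀.graft n c hc)
      rw [treeCount] at h2
      rw [ballEdges_succ, width_graft, show ballEdges n (T₀.graft n c hc) = ballEdges n T₀ from
        ballEdges_eq_of_ball_eq ((ball_eq_ball_graft_iff _).1 rfl).1] at h2
      rw [show (X * treeSeries p) ^ c.sum * X ^ ballEdges n T₀ =
        X ^ (ballEdges n T₀ + c.sum) * treeSeries p ^ c.sum by ring, ← h2]
      refine tsum_congr fun T => ?_
      simp only [ball_eq_ball_graft_iff, show n + (p + 1) = n + 1 + p by ring, and_assoc]
    · rw [ENNReal.tsum_eq_zero]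
      intro T
      rw [if_neg]
      rintro ⟨⟨-, -, h⟩, rfl⟩
      exact hc (by rw [length_code, width_eq_of_ball_eq h le_rfl])

theorem treeCount_eq_zero_of_lt {N m n : ℕ} {T₀ : PlanarTree} (h : m < n)
    (hK : T₀.width (n + 1) ≠ 0) : treeCount N m n T₀ = 0 := by
  classical
  rw [treeCount, ENNReal.tsum_eq_zero]
  intro T
  rw [if_neg]
  rintro ⟨-, h2, h3⟩
  exact hK (by rw [← width_eq_of_ball_eq h3 le_rfl, h2 (n + 1) (by omega)])

/-- The trees which agree with `T₀` up to height `n + 1`. -/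
def cylinder (n : ℕ) (T₀ : PlanarTree) : Set PlanarTree := {T | ball (n + 1) T = ball (n + 1) T₀}

theorem isOpen_cylinder (n : ℕ) (T₀ : PlanarTree) : IsOpen (cylinder n T₀) := by
  rw [Metric.isOpen_iff]
  intro T hT
  refine ⟨1 / ((n : ℝ) + 1), by positivity, fun T' hT' => ?_⟩
  rw [Metric.mem_ball] at hT'
  replace hT' : sInf (invRadii T' T) < 1 / ((n : ℝ) + 1) := hT'
  obtain ⟨x, ⟨s, hs, hb, rfl⟩, hx⟩ := exists_lt_of_csInf_lt (invRadii_nonempty T' T) hT'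
  have hs0 : (0 : ℝ) < s := by exact_mod_cast hs
  have hlt : (n : ℝ) + 1 < s := (one_div_lt_one_div hs0 (by positivity)).1 hx
  have hrs : n + 1 ≤ s := by
    have : n + 1 < s := by exact_mod_cast hlt
    omega
  exact (ball_eq_ball_of_le hrs hb).trans hT

theorem measurableSet_cylinder (n : ℕ) (T₀ : PlanarTree) : MeasurableSet (cylinder n T₀) :=
  (isOpen_cylinder n T₀).measurableSet

theorem exists_cylinder_subset {U : Set PlanarTree} (hU : IsOpen U) {T : PlanarTree} (hT : T ∈ U) :
    ∃ n, cylinder n T ⊆ U := by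
  obtain ⟨ε, hε, hsub⟩ := Metric.isOpen_iff.1 hU T hT
  obtain ⟨n, hn⟩ := exists_nat_one_div_lt hε
  refine ⟨n, fun T' hT' => hsub ?_⟩
  rw [Metric.mem_ball]
  show sInf (invRadii T' T) < ε
  refine lt_of_le_of_lt (csInf_le (invRadii_bddBelow T' T) ⟨n + 1, by omega, hT', rfl⟩) ?_
  push_cast
  exact hn

/-! ### The finite size measures and the limit of ball probabilities. -/

section FiniteSize

variable (μ : ℝ)

open Classical in
/-- The total weight of the trees of size `N` with a given ball of radius `n + 1`. -/
noncomputable def cylinderWeight (N n : ℕ) (T₀ : PlanarTree) : ENNReal :=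
  ∑' T : PlanarTree, if T.size = N ∧ ball (n + 1) T = ball (n + 1) T₀ then
    ENNReal.ofReal (Real.exp (-μ * T.height)) else 0

theorem partitionFunction_eq (N : ℕ) (T₀ : PlanarTree) :
    partitionFunction μ N = cylinderWeight μ N 0 T₀ := by
  classical
  rw [partitionFunction, cylinderWeight]
  refine (tsum_subtype {T : PlanarTree | T.size = N}
    fun T => ENNReal.ofReal (Real.exp (-μ * T.height))).trans ?_
  refine tsum_congr fun T => ?_
  have : ball (0 + 1) T = ball (0 + 1) T₀ := by
    rw [ball_succ_eq_iff]
    intro s hs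
    obtain rfl : s = 0 := by omega
    rw [code_zero, code_zero]
  simp [Set.indicator_apply, this]

theorem finiteSizeMeasure_cylinder (N n : ℕ) (T₀ : PlanarTree) :
    finiteSizeMeasure μ N (cylinder n T₀) =
      cylinderWeight μ N n T₀ / partitionFunction μ N := by
  classical
  rw [finiteSizeMeasure, Measure.sum_apply _ (measurableSet_cylinder n T₀), cylinderWeight,
    div_eq_mul_inv, ← ENNReal.tsum_mul_right]
  simp only [Measure.smul_apply, Measure.dirac_apply' _ (measurableSet_cylinder n T₀), smul_eq_mul]
  refine (tsum_subtype {T : PlanarTree | T.size = N} fun T =>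
    ENNReal.ofReal (Real.exp (-μ * T.height)) / partitionFunction μ N *
      (cylinder n T₀).indicator 1 T).trans ?_
  refine tsum_congr fun T => ?_
  simp only [Set.indicator_apply, Set.mem_ofPred_eq, cylinder, Pi.one_apply, div_eq_mul_inv]
  by_cases h1 : T.size = N <;> by_cases h2 : ball (n + 1) T = ball (n + 1) T₀ <;> simp [h1, h2]

/-- Summation by parts: `q ^ h = (1 - q) * ∑ q ^ (m + 1)` over `m + 1 ≥ h`, which replaces the exact
height by bounds on the height. -/
theorem cylinderWeight_eq_tsum_treeCount {μ : ℝ} (hμ : 0 < μ) (N n : ℕ) (T₀ : PlanarTree) :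
    cylinderWeight μ N n T₀ = (1 - ENNReal.ofReal (Real.exp (-μ))) *
      ∑' m : ℕ, ENNReal.ofReal (Real.exp (-μ)) ^ (m + 1) * treeCount N m n T₀ := by
  classical
  set q := ENNReal.ofReal (Real.exp (-μ)) with hq
  have hq1 : q < 1 := by
    rw [hq, ENNReal.ofReal_lt_one, Real.exp_lt_one_iff]
    linarith
  simp only [treeCount, ← ENNReal.tsum_mul_left]
  rw [ENNReal.tsum_comm, cylinderWeight]
  refine tsum_congr fun T => ?_
  by_cases h : T.size = N ∧ ball (n + 1) T = ball (n + 1) T₀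
  · rw [if_pos h]
    have hpow : ENNReal.ofReal (Real.exp (-μ * T.height)) = q ^ T.height := by
      rw [hq, ← ENNReal.ofReal_pow (Real.exp_pos _).le, ← Real.exp_nat_mul, mul_comm]
    obtain ⟨k, hk⟩ : ∃ k, T.height = k + 1 := ⟨T.height - 1, by have := one_le_height h.1; omega⟩
    have hterm : ∀ m, (if T.size = N ∧ T.HeightLE m ∧ ball (n + 1) T = ball (n + 1) T₀ then
        (1 : ENNReal) else 0) = if k ≤ m then 1 else 0 := by
      intro m
      have : T.HeightLE m ↔ k ≤ m := by rw [← height_le_iff h.1, hk]; omega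
      simp [h.1, h.2, this]
    simp only [hterm]
    rw [hpow, hk, ENNReal.tsum_mul_left]
    have hshift : ∑' m : ℕ, q ^ (m + 1) * (if k ≤ m then (1 : ENNReal) else 0) =
        q ^ (k + 1) * ∑' m : ℕ, q ^ m := by
      rw [← ENNReal.tsum_mul_left, ENNReal.tsum_eq_tsum_add k]
      · refine tsum_congr fun m => ?_
        rw [if_pos (by omega), mul_one]
        ring
      · intro m hm
        rw [if_neg (by omega), mul_zero]
    rw [hshift, ENNReal.tsum_geometric, mul_left_comm, ENNReal.mul_inv_cancel, mul_one]
    · exact (tsub_pos_of_lt hq1).ne'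
    · exact (lt_of_le_of_lt tsub_le_self ENNReal.one_lt_top).ne
  · rw [if_neg h, eq_comm, ENNReal.tsum_eq_zero]
    intro m
    rw [if_neg, mul_zero, mul_zero]
    rintro ⟨h1, -, h2⟩
    exact h ⟨h1, h2⟩

open PowerSeries in
theorem cylinderWeight_eq {μ : ℝ} (hμ : 0 < μ) (k n : ℕ) {T₀ : PlanarTree}
    (hK : T₀.width (n + 1) ≠ 0) : cylinderWeight μ (ballEdges n T₀ + k) n T₀ =
      (1 - ENNReal.ofReal (Real.exp (-μ))) * ENNReal.ofReal (Real.exp (-μ)) ^ (n + 1) *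
        ENNReal.ofReal (4 ^ (k + T₀.width (n + 1)) *
          ∑' p : ℕ, Real.exp (-μ * p) * forestWeight (T₀.width (n + 1)) k p) := by
  set q := ENNReal.ofReal (Real.exp (-μ)) with hq
  set K := T₀.width (n + 1) with hKdef
  rw [cylinderWeight_eq_tsum_treeCount hμ, mul_assoc]
  congr 1
  rw [ENNReal.tsum_eq_tsum_add n]
  · rw [← tsum_mul_left, ENNReal.ofReal_tsum_of_nonneg, ← ENNReal.tsum_mul_left]
    · refine tsum_congr fun p => ?_
      rw [add_comm p n, treeCount_add, add_comm (ballEdges n T₀) k, coeff_X_pow_mul, ← hKdef]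
      have h1 : ((coeff k (treeSeries p ^ K) : ℕ) : ENNReal) =
          ENNReal.ofReal (4 ^ (k + K) * forestWeight K k p) := by
        rw [forestWeight, coeff_realTreeSeries_pow, ← mul_assoc, ← mul_pow]
        norm_num
      have h2 : q ^ (n + p + 1) = q ^ (n + 1) * ENNReal.ofReal (Real.exp (-μ * p)) := by
        rw [hq, ← ENNReal.ofReal_pow (Real.exp_pos _).le, ← ENNReal.ofReal_pow (Real.exp_pos _).le,
          ← ENNReal.ofReal_mul (by positivity), ← Real.exp_nat_mul, ← Real.exp_nat_mul,
          ← Real.exp_add]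
        congr 2
        push_cast
        ring
      rw [h1, h2, mul_assoc, ← ENNReal.ofReal_mul (Real.exp_pos _).le]
      congr 2
      ring
    · intro p
      have := forestWeight_nonneg K k p
      positivity
    · exact (summable_forestWeight hμ K k).mul_left _
  · intro m hm
    rw [treeCount_eq_zero_of_lt hm hK, mul_zero]

theorem cylinderWeight_eq_zero {N n : ℕ} {T₀ : PlanarTree} (hK : T₀.width (n + 1) = 0)
    (hN : N ≠ ballEdges n T₀) : cylinderWeight μ N n T₀ = 0 := by
  classical
  rw [cylinderWeight, ENNReal.tsum_eq_zero]
  intro T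
  rw [if_neg]
  rintro ⟨h1, h2⟩
  have h3 : T.HeightLE n := fun s hs =>
    width_eq_zero_of_le hs.le (by rw [width_eq_of_ball_eq h2 le_rfl, hK])
  rw [← ball_eq_self h3, size_ball_succ, ballEdges_eq_of_ball_eq h2] at h1
  exact hN (by exact_mod_cast h1.symm)

theorem tsum_forestWeight_one_pos {μ : ℝ} (hμ : 0 < μ) (k : ℕ) :
    0 < ∑' p : ℕ, Real.exp (-μ * p) * forestWeight 1 k p := by
  have hp : 0 < forestWeight 1 k 1 := by
    rw [forestWeight_one]
    refine mul_pos (by positivity) (Finset.sum_pos' (fun i _ => by positivity) ⟨0, by simp, ?_⟩)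
    have h3 : ((0 : ℕ) + 1 : ℝ) * (Real.pi / ((1 : ℕ) + 2)) = Real.pi / 3 := by push_cast; ring
    rw [h3, Real.cos_pi_div_three, Real.sin_pi_div_three]
    positivity
  exact (summable_forestWeight hμ 1 k).tsum_pos
    (fun p => mul_nonneg (Real.exp_pos _).le (forestWeight_nonneg _ _ _)) 1
    (mul_pos (Real.exp_pos _) hp)

theorem partitionFunction_succ {μ : ℝ} (hμ : 0 < μ) (N : ℕ) :
    partitionFunction μ (N + 1) = (1 - ENNReal.ofReal (Real.exp (-μ))) *
      ENNReal.ofReal (Real.exp (-μ)) * ENNReal.ofReal (4 ^ (N + 1) *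
          ∑' p : ℕ, Real.exp (-μ * p) * forestWeight 1 N p) := by
  have T₀ : PlanarTree := ofCode (fun r => if r = 0 then [1] else if r = 1 then [0] else []) rfl
    (by
      intro r
      match r with
      | 0 => simp
      | 1 => simp
      | r + 2 => simp)
  have h1 := cylinderWeight_eq hμ N 0 (T₀ := T₀) (by simp [T₀.width_one])
  rw [ballEdges_zero, T₀.width_one, zero_add, pow_one, add_comm 1 N,
    ← partitionFunction_eq] at h1
  exact h1

theorem partitionFunction_ne_zero_ne_top {μ : ℝ} (hμ : 0 < μ) (N : ℕ) :
    partitionFunction μ (N + 1) ≠ 0 ∧ partitionFunction μ (N + 1) ≠ ⊤ := by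
  have hq1 : ENNReal.ofReal (Real.exp (-μ)) < 1 := by
    rw [ENNReal.ofReal_lt_one, Real.exp_lt_one_iff]
    linarith
  have hpos := tsum_forestWeight_one_pos hμ N
  rw [partitionFunction_succ hμ]
  constructor
  · refine mul_ne_zero (mul_ne_zero (tsub_pos_of_lt hq1).ne' ?_) ?_
    · simpa using Real.exp_pos _
    · have : (0 : ℝ) < 4 ^ (N + 1) * ∑' p : ℕ, Real.exp (-μ * p) * forestWeight 1 N p := by positivity
      simpa using this
  · exact ENNReal.mul_ne_top (ENNReal.mul_ne_top
      (lt_of_le_of_lt tsub_le_self ENNReal.one_lt_top).ne ENNReal.ofReal_ne_top)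
      ENNReal.ofReal_ne_top

theorem isProbabilityMeasure_finiteSizeMeasure {μ : ℝ} (hμ : 0 < μ) (N : ℕ) :
    IsProbabilityMeasure (finiteSizeMeasure μ (N + 1)) := by
  obtain ⟨h0, htop⟩ := partitionFunction_ne_zero_ne_top hμ N
  constructor
  rw [finiteSizeMeasure, Measure.sum_apply _ MeasurableSet.univ]
  simp only [Measure.smul_apply, measure_univ, smul_eq_mul, mul_one, div_eq_mul_inv]
  rw [ENNReal.tsum_mul_right]
  exact ENNReal.mul_inv_cancel h0 htop

/-- The limiting probability of a ball of radius `n + 1`. -/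
theorem tendsto_finiteSizeMeasure_cylinder {μ : ℝ} (hμ : 0 < μ) (n : ℕ) (T₀ : PlanarTree) :
    Tendsto (fun N => finiteSizeMeasure μ N (cylinder n T₀)) atTop
      (𝓝 (ENNReal.ofReal (Real.exp (-μ) ^ n * (2 ^ (T₀.width (n + 1) + 1) / 4 ^ ballEdges n T₀) *
        laguerreSum μ (T₀.width (n + 1))))) := by
  set K := T₀.width (n + 1) with hKdef
  by_cases hK : K = 0
  · rw [hK]
    simp only [laguerreSum, Finset.range_zero, Finset.sum_empty, mul_zero, ENNReal.ofReal_zero]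
    -- With an empty top level the ball is the whole tree, so its size is fixed and the probability
    -- vanishes for all larger `N`.
    refine tendsto_const_nhds.congr' ?_
    filter_upwards [eventually_gt_atTop (ballEdges n T₀)] with N hN
    rw [finiteSizeMeasure_cylinder, cylinderWeight_eq_zero μ hK hN.ne', ENNReal.zero_div]
  have hb : 1 ≤ ballEdges n T₀ := by
    rw [ballEdges, Finset.sum_range_succ']
    simp only [zero_add, T₀.width_one]
    omega
  rw [← tendsto_add_atTop_iff_nat (ballEdges n T₀)]
  have hlim := tendsto_tsum_forestWeight_div hμ K (ballEdges n T₀ - 1)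
  have hlim2 := (hlim.const_mul (Real.exp (-μ) ^ n * (4 ^ K / 4 ^ ballEdges n T₀)))
  have hval : Real.exp (-μ) ^ n * (4 ^ K / 4 ^ ballEdges n T₀) * (2 / 2 ^ K * laguerreSum μ K) =
      Real.exp (-μ) ^ n * (2 ^ (K + 1) / 4 ^ ballEdges n T₀) * laguerreSum μ K := by
    have : (4 : ℝ) ^ K = 2 ^ K * 2 ^ K := by rw [← mul_pow]; norm_num
    rw [this]
    field_simp
    ring
  rw [hval] at hlim2
  refine ((ENNReal.continuous_ofReal.tendsto _).comp hlim2).congr fun k => ?_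
  have hq1 : ENNReal.ofReal (Real.exp (-μ)) < 1 := by
    rw [ENNReal.ofReal_lt_one, Real.exp_lt_one_iff]
    linarith
  obtain ⟨N', hN'⟩ : ∃ N', k + ballEdges n T₀ = N' + 1 := ⟨k + ballEdges n T₀ - 1, by omega⟩
  have hN'' : k + (ballEdges n T₀ - 1) = N' := by omega
  have hpos := tsum_forestWeight_one_pos hμ N'
  have hq0 : ENNReal.ofReal (Real.exp (-μ)) ≠ 0 := by simpa using Real.exp_pos _
  simp only [Function.comp]
  rw [finiteSizeMeasure_cylinder, hN', partitionFunction_succ hμ, ← hN', add_comm k (ballEdges n T₀),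
    cylinderWeight_eq hμ k n hK, ← hKdef, pow_succ, hN'', add_comm (ballEdges n T₀) k, hN']
  set A := ∑' p : ℕ, Real.exp (-μ * p) * forestWeight K k p with hA
  set B := ∑' p : ℕ, Real.exp (-μ * p) * forestWeight 1 N' p with hB
  set q := ENNReal.ofReal (Real.exp (-μ)) with hq
  have hA0 : 0 ≤ A := tsum_nonneg fun p => mul_nonneg (Real.exp_pos _).le (forestWeight_nonneg _ _ _)
  have e1 : (1 - q) * (q ^ n * q) * ENNReal.ofReal (4 ^ (k + K) * A) =
      ((1 - q) * q) * (q ^ n * ENNReal.ofReal (4 ^ (k + K) * A)) := by ring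
  rw [e1, ENNReal.mul_div_mul_left _ _ (mul_ne_zero (tsub_pos_of_lt hq1).ne' hq0)
    (ENNReal.mul_ne_top (lt_of_le_of_lt tsub_le_self ENNReal.one_lt_top).ne ENNReal.ofReal_ne_top),
    hq, ← ENNReal.ofReal_pow (Real.exp_pos _).le, ← ENNReal.ofReal_mul (by positivity),
    ← ENNReal.ofReal_div_of_pos (by positivity)]
  congr 1
  rw [← hN']
  field_simp
  ring

end FiniteSize

end PlanarTree

/-! ### Weights of words of marks and of offsprings. -/

section Words

open ENNReal

theorem tsum_words_eq_choose (n i : ℕ) :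
    ∑' w : List Bool, (if w.length = n ∧ w.count true = i then (1 : ENNReal) else 0) =
      (n.choose i : ℕ) := by
  induction n generalizing i with
  | zero =>
    rw [tsum_eq_single []]
    · cases i <;> simp
    · intro w hw
      rw [if_neg]
      rintro ⟨h, -⟩
      exact hw (List.length_eq_zero_iff.1 h)
  | succ n ih =>
    rw [ENNReal.tsum_list, tsum_fintype, Fintype.sum_bool]
    cases i with
    | zero => simpa using ih 0
    | succ i =>
      have h1 := ih i
      have h2 := ih (i + 1)
      simp only [List.length_nil, (Nat.succ_ne_zero n).symm, false_and, if_false, zero_add,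
        List.length_cons, Nat.add_right_cancel_iff, List.count_cons_self] at h1 h2 ⊢
      rw [h1]
      simp only [List.count_cons_of_ne (show (false : Bool) ≠ true by simp)]
      rw [h2, Nat.choose_succ_succ]
      push_cast
      rfl

theorem tsum_words_pow (x : ENNReal) (i : ℕ) :
    ∑' w : List Bool, (if w.count true = i then x ^ w.length else 0) =
      ∑' n : ℕ, (n.choose i : ℕ) * x ^ n := by
  simp only [← tsum_words_eq_choose, ← ENNReal.tsum_mul_right]
  rw [ENNReal.tsum_comm]
  refine tsum_congr fun w => ?_
  rw [tsum_eq_single w.length]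
  · by_cases h : w.count true = i <;> simp [h]
  · intro n hn
    rw [if_neg, zero_mul]
    rintro ⟨h, -⟩
    exact hn h.symm

/-- The value does not depend on `i`: a marked vertex has total weight `2` for every prescribed
number of marked children, so additional marks are distributed uniformly over compositions. -/
theorem tsum_choose_mul_two_inv_pow (i : ℕ) :
    ∑' n : ℕ, (n.choose i : ℕ) * (2⁻¹ : ENNReal) ^ n = 2 := by
  rw [ENNReal.tsum_eq_tsum_add i]
  · have hr : ‖(1 / 2 : ℝ)‖ < 1 := by norm_num
    have h := hasSum_choose_mul_geometric_of_norm_lt_one i hr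
    have h2 := (h.mul_left ((1 / 2) ^ i)).tsum_eq
    have e : ∀ n : ℕ, (((n + i).choose i : ℕ) : ENNReal) * 2⁻¹ ^ (n + i) =
        ENNReal.ofReal ((1 / 2) ^ i * ((n + i).choose i * (1 / 2) ^ n)) := by
      intro n
      have h2 : (2⁻¹ : ENNReal) = ENNReal.ofReal (1 / 2) := by
        rw [one_div, ENNReal.ofReal_inv_of_pos (by norm_num)]
        simp
      rw [h2, ← ENNReal.ofReal_pow (by norm_num), ← ENNReal.ofReal_natCast,
        ← ENNReal.ofReal_mul (by positivity), pow_add]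
      congr 1
      ring
    rw [tsum_congr e, ← ENNReal.ofReal_tsum_of_nonneg (fun n => by positivity)
      (h.mul_left _).summable, h2]
    have : (1 / 2 : ℝ) ^ i * (1 / (1 - 1 / 2) ^ (i + 1)) = 2 := by
      rw [show (1 - 1 / 2 : ℝ) = 1 / 2 by norm_num]
      field_simp
      ring
    rw [this]
    simp
  · intro m hm
    rw [Nat.choose_eq_zero_of_lt hm]
    simp

/-- The number of compositions of `k` into `j` positive parts. -/
def compositionCount : ℕ → ℕ → ℕ
  | 0, k => if k = 0 then 1 else 0
  | j + 1, k => ∑ i ∈ Finset.range k, compositionCount j i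

theorem compositionCount_eq_zero {j k : ℕ} (h : k < j) : compositionCount j k = 0 := by
  induction j generalizing k with
  | zero => omega
  | succ j ih =>
    rw [compositionCount]
    exact Finset.sum_eq_zero fun i hi => ih (by have := Finset.mem_range.1 hi; omega)

theorem compositionCount_add (j p : ℕ) : compositionCount j (j + p) = j.multichoose p := by
  induction j generalizing p with
  | zero => cases p <;> simp [compositionCount]
  | succ j ih =>
    induction p with
    | zero =>
      rw [compositionCount, add_zero, Finset.sum_range_succ, Finset.sum_eq_zero, zero_add]
      · simpa using ih 0
      · exact fun i hi => compositionCount_eq_zero (Finset.mem_range.1 hi)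
    | succ p ihp =>
      rw [compositionCount, ← add_assoc, Finset.sum_range_succ, ← compositionCount, ihp,
        show j + 1 + p = j + (p + 1) by ring, ih, Nat.multichoose_succ_succ, add_comm]

/-- The number of children of the vertices whose flag in `c` is set. -/
def flaggedChildren {α : Type*} : List Bool → List (List α) → ℕ
  | d :: c, w :: e => (if d then w.length else 0) + flaggedChildren c e
  | _, _ => 0

theorem any_eq_true_iff_count_pos (w : List Bool) : w.any id = true ↔ 0 < w.count true := by
  rw [List.count_pos_iff, List.any_eq_true]
  simp

/-- The marks `s` of one generation are inherited: a vertex is marked if and only if one of its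
children is. -/
def parentMarks (e : List (List Bool)) : List Bool := e.map fun w => w.any id

/-- The sum factorises over the parents. An unmarked parent contributes `2`, or `(1 - t / 2)⁻¹` if
it is flagged. A marked parent, which is never flagged, contributes `2` for each positive number of
marked children, and the ways to share `k` marks are counted by compositions. The variable `t` is
for the extinction argument. -/
theorem tsum_offspring_weight (t : ENNReal) {c s : List Bool}
    (h : List.Forall₂ (fun d b => d = true → b = false) c s) (k : ℕ) :
    ∑' e : List (List Bool), (if parentMarks e = s ∧ e.flatten.count true = k then
      2⁻¹ ^ e.flatten.length * t ^ flaggedChildren c e else 0) =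
      2 ^ c.count false * (1 - t / 2)⁻¹ ^ c.count true * compositionCount (s.count true) k := by
  induction h generalizing k with
  | nil =>
    rw [tsum_eq_single []]
    · by_cases hk : k = 0 <;> simp [parentMarks, compositionCount, flaggedChildren, hk, eq_comm]
    · intro e he
      rw [if_neg]
      rintro ⟨h, -⟩
      exact he (by simpa [parentMarks] using h)
  | @cons d b c s hdb hcs ih =>
    have step : ∀ w : List Bool, ∑' e : List (List Bool),
        (if parentMarks (w :: e) = b :: s ∧ (w :: e).flatten.count true = k then
          2⁻¹ ^ (w :: e).flatten.length * t ^ flaggedChildren (d :: c) (w :: e) else 0) =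
        if w.any id = b ∧ w.count true ≤ k then (2⁻¹ * if d then t else 1) ^ w.length *
          (2 ^ c.count false * (1 - t / 2)⁻¹ ^ c.count true *
            compositionCount (s.count true) (k - w.count true)) else 0 := by
      intro w
      by_cases hw : w.any id = b ∧ w.count true ≤ k
      · rw [if_pos hw, ← ih, ← ENNReal.tsum_mul_left]
        refine tsum_congr fun e => ?_
        have hiff : (parentMarks (w :: e) = b :: s ∧ (w :: e).flatten.count true = k) ↔
            (parentMarks e = s ∧ e.flatten.count true = k - w.count true) := by
          have h2 := hw.2
          simp only [parentMarks, List.map_cons, hw.1, List.cons.injEq, true_and,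
            List.flatten_cons, List.count_append]
          constructor
          · rintro ⟨h1, h3⟩
            exact ⟨h1, by omega⟩
          · rintro ⟨h1, h3⟩
            exact ⟨h1, by omega⟩
        simp only [hiff]
        by_cases h1 : parentMarks e = s ∧ e.flatten.count true = k - w.count true
        · rw [if_pos h1, if_pos h1]
          cases d <;> simp [flaggedChildren] <;> ring
        · rw [if_neg h1, if_neg h1, mul_zero]
      · rw [if_neg hw, ENNReal.tsum_eq_zero]
        intro e
        rw [if_neg]
        rintro ⟨h1, h2⟩
        simp only [parentMarks, List.map_cons, List.cons.injEq, List.flatten_cons,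
          List.count_append] at h1 h2
        exact hw ⟨h1.1, by omega⟩
    rw [ENNReal.tsum_list, if_neg (by simp [parentMarks]), zero_add, tsum_congr step]
    set G : ℕ → ENNReal := fun k => 2 ^ c.count false * (1 - t / 2)⁻¹ ^ c.count true *
      compositionCount (s.count true) k with hG
    cases b with
    | false =>
      have h1 : ∀ w : List Bool, (if w.any id = false ∧ w.count true ≤ k then
          (2⁻¹ * if d then t else 1) ^ w.length * G (k - w.count true) else 0) =
          (if w.count true = 0 then (2⁻¹ * if d then t else 1) ^ w.length else 0) * G k := by
        intro w
        have hiff : w.any id = false ↔ w.count true = 0 := by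
          have := any_eq_true_iff_count_pos w
          rw [← Bool.not_eq_true, this]
          omega
        by_cases hw : w.count true = 0
        · rw [if_pos ⟨hiff.2 hw, by omega⟩, if_pos hw, hw, Nat.sub_zero]
        · rw [if_neg fun h => hw (hiff.1 h.1), if_neg hw, zero_mul]
      rw [tsum_congr h1, ENNReal.tsum_mul_right, tsum_words_pow]
      simp only [Nat.choose_zero_right, Nat.cast_one, one_mul]
      cases d with
      | true =>
        simp only [if_true]
        rw [ENNReal.tsum_geometric, mul_comm (2⁻¹ : ENNReal) t, ← div_eq_mul_inv, hG]
        simp only [List.count_cons_self, List.count_cons_of_ne (show (true : Bool) ≠ false by simp),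
          List.count_cons_of_ne (show (false : Bool) ≠ true by simp)]
        ring
      | false =>
        simp only [Bool.false_eq_true, if_false, mul_one]
        rw [ENNReal.tsum_geometric, ENNReal.one_sub_inv_two, inv_inv, hG]
        simp only [List.count_cons_self, List.count_cons_of_ne (show (false : Bool) ≠ true by simp)]
        ring
    | true =>
      have hd : d = false := by
        cases d with
        | false => rfl
        | true => exact absurd (hdb rfl) (by simp)
      subst hd
      have h1 : ∀ w : List Bool, (if w.any id = true ∧ w.count true ≤ k then
          (2⁻¹ * if (false : Bool) = true then t else 1) ^ w.length * G (k - w.count true) else 0) =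
          ∑ i ∈ Finset.range k, (if w.count true = k - i then 2⁻¹ ^ w.length else 0) * G i := by
        intro w
        simp only [Bool.false_eq_true, if_false, mul_one]
        split_ifs with hw
        · have h0 := (any_eq_true_iff_count_pos w).1 hw.1
          have h2 := hw.2
          rw [Finset.sum_eq_single (k - w.count true)]
          · rw [if_pos (by omega)]
          · intro i hi hne
            rw [if_neg, zero_mul]
            have := Finset.mem_range.1 hi
            omega
          · intro hn
            rw [Finset.mem_range] at hn
            omega
        · refine (Finset.sum_eq_zero fun i hi => ?_).symm
          rw [if_neg, zero_mul]
          intro h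
          have := Finset.mem_range.1 hi
          exact hw ⟨(any_eq_true_iff_count_pos w).2 (by omega), by omega⟩
      rw [tsum_congr h1, Summable.tsum_finsetSum fun i _ => ENNReal.summable]
      have h2 : ∀ i ∈ Finset.range k, ∑' w : List Bool,
          (if w.count true = k - i then 2⁻¹ ^ w.length else 0) * G i = 2 * G i := by
        intro i _
        rw [ENNReal.tsum_mul_right, tsum_words_pow, tsum_choose_mul_two_inv_pow]
      rw [Finset.sum_congr rfl h2, ← Finset.mul_sum, hG]
      simp only [List.count_cons_self, List.count_cons_of_ne (show (false : Bool) ≠ true by simp),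
        compositionCount]
      rw [← Finset.mul_sum]
      push_cast
      ring

theorem flaggedChildren_replicate_false {α : Type*} (n : ℕ) (e : List (List α)) :
    flaggedChildren (List.replicate n false) e = 0 := by
  induction n generalizing e with
  | zero => simp [flaggedChildren]
  | succ n ih => cases e <;> simp [List.replicate_succ, flaggedChildren, ih]

end Words

/-! ### The offspring law of a marked generation. -/

section Offspring

/-- The marks of the vertices of one generation, from left to right; at least one of them is
marked. -/
abbrev MarkedLevel : Type := {s : List Bool // 0 < s.count true}

/-- The possible marked offsprings of a marked generation, with a given number `p` of additional
marked vertices. -/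
abbrev MarkedOffspring (i : MarkedLevel × ℕ) : Type :=
  {e : List (List Bool) // parentMarks e = i.1.1 ∧ e.flatten.count true = i.1.1.count true + i.2}

instance (i : MarkedLevel × ℕ) : MeasurableSpace (MarkedOffspring i) := ⊤

/-- The probability of a marked offspring. -/
noncomputable def offspringWeight (s : List Bool) (p : ℕ) (e : List (List Bool)) : ENNReal :=
  2⁻¹ ^ e.flatten.length * (2⁻¹ ^ s.length * ((s.count true).multichoose p : ENNReal)⁻¹)

theorem count_false_add_count_true (c : List Bool) : c.count false + c.count true = c.length := by
  induction c with
  | nil => rfl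
  | cons b c ih =>
    cases b <;> simp <;> omega

theorem multichoose_pos {j : ℕ} (hj : 0 < j) (p : ℕ) : 0 < j.multichoose p := by
  rw [Nat.multichoose_eq]
  exact Nat.choose_pos (by omega)

open Classical in
theorem tsum_markedOffspring (i : MarkedLevel × ℕ) (F : List (List Bool) → ENNReal) :
    ∑' e : MarkedOffspring i, F e.1 = ∑' e : List (List Bool), if parentMarks e = i.1.1 ∧
      e.flatten.count true = i.1.1.count true + i.2 then F e else 0 := by
  refine (tsum_subtype {e : List (List Bool) | parentMarks e = i.1.1 ∧
    e.flatten.count true = i.1.1.count true + i.2} F).trans ?_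
  refine tsum_congr fun e => ?_
  simp [Set.indicator_apply]

/-- Flagged vertices reproduce independently by the critical geometric law, with generating function
`1 / (2 - t)`; the result involves neither the marks nor the number of additional marks. -/
theorem tsum_offspringWeight_mul (t : ENNReal) (i : MarkedLevel × ℕ) {c : List Bool}
    (h : List.Forall₂ (fun d b => d = true → b = false) c i.1.1) :
    ∑' e : MarkedOffspring i, offspringWeight i.1.1 i.2 e.1 * t ^ flaggedChildren c e.1 =
      (2⁻¹ * (1 - t / 2)⁻¹) ^ c.count true := by
  classical
  rw [tsum_markedOffspring i fun e => offspringWeight i.1.1 i.2 e * t ^ flaggedChildren c e]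
  have h1 := tsum_offspring_weight t h (i.1.1.count true + i.2)
  rw [compositionCount_add] at h1
  have hm : ((i.1.1.count true).multichoose i.2 : ENNReal) ≠ 0 := by
    have := multichoose_pos i.1.2 i.2
    exact_mod_cast this.ne'
  have h2 : ∀ e : List (List Bool), (if parentMarks e = i.1.1 ∧
      e.flatten.count true = i.1.1.count true + i.2 then
        offspringWeight i.1.1 i.2 e * t ^ flaggedChildren c e else 0) =
      (if parentMarks e = i.1.1 ∧ e.flatten.count true = i.1.1.count true + i.2 then
        2⁻¹ ^ e.flatten.length * t ^ flaggedChildren c e else 0) *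
      (2⁻¹ ^ i.1.1.length * ((i.1.1.count true).multichoose i.2 : ENNReal)⁻¹) := by
    intro e
    split_ifs
    · rw [offspringWeight]
      ring
    · rw [zero_mul]
  rw [tsum_congr h2, ENNReal.tsum_mul_right, h1, ← h.length_eq, ← count_false_add_count_true c,
    pow_add, mul_pow]
  have e2 : (2 : ENNReal) ^ c.count false * 2⁻¹ ^ c.count false = 1 := by
    rw [← mul_pow, ENNReal.mul_inv_cancel (by simp) (by simp), one_pow]
  have e3 : ((i.1.1.count true).multichoose i.2 : ENNReal) *
      ((i.1.1.count true).multichoose i.2 : ENNReal)⁻¹ = 1 :=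
    ENNReal.mul_inv_cancel hm (by simp)
  calc _ = (2 ^ c.count false * 2⁻¹ ^ c.count false) *
        (((i.1.1.count true).multichoose i.2 : ENNReal) *
          ((i.1.1.count true).multichoose i.2 : ENNReal)⁻¹) *
        (2⁻¹ ^ c.count true * (1 - t / 2)⁻¹ ^ c.count true) := by ring
    _ = _ := by rw [e2, e3, one_mul, one_mul]

theorem tsum_offspringWeight (i : MarkedLevel × ℕ) :
    ∑' e : MarkedOffspring i, offspringWeight i.1.1 i.2 e.1 = 1 := by
  have h : List.Forall₂ (fun d b => d = true → b = false)
      (List.replicate i.1.1.length false) i.1.1 := by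
    rw [List.forall₂_iff_get]
    refine ⟨by simp, fun k h1 h2 h3 => ?_⟩
    simp at h3
  have h1 := tsum_offspringWeight_mul 1 i h
  rw [show (List.replicate i.1.1.length false).count true = 0 by
    simp [List.count_replicate], pow_zero] at h1
  rw [← h1]
  refine tsum_congr fun e => ?_
  rw [flaggedChildren_replicate_false, pow_zero, mul_one]

/-- The law of the marked offspring of a marked generation. -/
noncomputable def offspringPMF (i : MarkedLevel × ℕ) : PMF (MarkedOffspring i) :=
  ⟨fun e => offspringWeight i.1.1 i.2 e.1, by
    rw [← tsum_offspringWeight i]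
    exact ENNReal.summable.hasSum⟩

end Offspring

/-! ### Chains driven by independent inputs. -/

section RecursiveChain

open ProbabilityTheory

variable {S W : Type*} [MeasurableSpace W] [MeasurableSpace S] [DiscreteMeasurableSpace S]
  [Countable S]

/-- The sequence of states of a system which is driven by the inputs `ω 0, ω 1, …`. -/
def recursiveChain (F : S → W → S) (s₀ : S) (ω : ℕ → W) : ℕ → S
  | 0 => s₀
  | n + 1 => F (recursiveChain F s₀ ω n) (ω n)

theorem measurable_recursiveChain {F : S → W → S} (hF : ∀ s, Measurable (F s)) (s₀ : S) (n : ℕ) :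
    Measurable fun ω => recursiveChain F s₀ ω n := by
  induction n with
  | zero => exact measurable_const
  | succ n ih =>
    have h : Measurable (Function.uncurry F) := measurable_from_prod_countable_right hF
    exact h.comp (ih.prodMk (measurable_pi_apply n))

theorem recursiveChain_eq_restrict {F : S → W → S} (hF : ∀ s, Measurable (F s)) (s₀ : S) (n : ℕ) :
    ∃ g : (Finset.range n → W) → S, Measurable g ∧
      ∀ ω, recursiveChain F s₀ ω n = g fun i => ω i := by
  induction n with
  | zero => exact ⟨fun _ => s₀, measurable_const, fun _ => rfl⟩
  | succ n ih =>
    obtain ⟨g, hg, h⟩ := ih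
    have hu : Measurable (Function.uncurry F) := measurable_from_prod_countable_right hF
    refine ⟨fun y => F (g fun i => y ⟨i.1, Finset.range_subset_range.2 (Nat.le_succ n) i.2⟩)
      (y ⟨n, Finset.self_mem_range_succ n⟩), ?_, fun ω => ?_⟩
    · exact hu.comp ((hg.comp (measurable_pi_lambda _ fun i => measurable_pi_apply _)).prodMk
        (measurable_pi_apply _))
    · rw [recursiveChain, h]

/-- The state at time `n` is a function of the inputs before `n` only. -/
theorem indepFun_recursiveChain {F : S → W → S} (hF : ∀ s, Measurable (F s))
    (s₀ : S) (n : ℕ) (κ : Measure W) [IsProbabilityMeasure κ] :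
    IndepFun (fun ω => recursiveChain F s₀ ω n) (fun ω => ω n)
      (Measure.infinitePi fun _ : ℕ => κ) := by
  obtain ⟨g, hg, h⟩ := recursiveChain_eq_restrict hF s₀ n
  have hind : iIndepFun (fun (i : ℕ) (ω : ℕ → W) => ω i) (Measure.infinitePi fun _ : ℕ => κ) :=
    iIndepFun_infinitePi (X := fun _ w => w) fun _ => measurable_id
  simp only [h]
  exact (hind.indepFun_finset (Finset.range n) {n} (by simp)
    fun i => measurable_pi_apply i).comp hg
      (measurable_pi_apply (⟨n, Finset.mem_singleton_self n⟩ : ({n} : Finset ℕ)))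

end RecursiveChain

/-! ### Construction of the random marked tree. -/

section MarkedHistory

open ProbabilityTheory
open scoped NNReal

theorem parentMarks_flatten (e : List (List Bool)) :
    (parentMarks e).count true ≤ e.flatten.count true := by
  induction e with
  | nil => simp [parentMarks]
  | cons w e ih =>
    have hw := any_eq_true_iff_count_pos w
    rw [parentMarks] at ih ⊢
    rw [List.map_cons, List.flatten_cons, List.count_append, List.count_cons]
    cases hb : w.any id
    · simpa using by omega
    · have := hw.1 hb
      simpa using by omega

/-- The inputs which determine the offspring of a generation: the number of additional marks, and
for any marked generation and any such number, the offspring. -/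
abbrev OffspringInput : Type := ℕ × ((i : MarkedLevel × ℕ) → MarkedOffspring i)

/-- The marked offspring of a generation. -/
def chosenOffspring (s : MarkedLevel) (w : OffspringInput) : MarkedOffspring (s, w.1) := w.2 (s, w.1)

/-- The history of a marked tree: the successive offsprings, the last one first, together with the
marks of the last generation. -/
def MarkedHistory : Type := List (List (List Bool)) × MarkedLevel

instance : MeasurableSpace MarkedHistory := ⊤

instance : DiscreteMeasurableSpace MarkedHistory := ⟨fun _ => trivial⟩

instance : Countable MarkedHistory :=
  inferInstanceAs (Countable (List (List (List Bool)) × MarkedLevel))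

/-- The history after one more generation. -/
def MarkedHistory.next (h : MarkedHistory) (w : OffspringInput) : MarkedHistory :=
  ((chosenOffspring h.2 w).1 :: h.1, ⟨(chosenOffspring h.2 w).1.flatten, by
    rw [(chosenOffspring h.2 w).2.2]
    exact Nat.add_pos_left h.2.2 _⟩)

theorem measurable_of_chosenOffspring (s : MarkedLevel) {α : Type*} [MeasurableSpace α]
    (f : List (List Bool) → α) : Measurable fun w : OffspringInput => f (chosenOffspring s w).1 := by
  refine measurable_from_prod_countable_right fun p => ?_
  exact (measurable_from_top (f := fun e : MarkedOffspring (s, p) => f e.1)).comp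
    (measurable_pi_apply (s, p))

theorem MarkedHistory.measurable_next (h : MarkedHistory) : Measurable h.next := by
  classical
  let g : List (List Bool) → MarkedHistory := fun e =>
    if he : 0 < e.flatten.count true then (e :: h.1, ⟨e.flatten, he⟩) else h
  have hg : h.next = fun w => g (chosenOffspring h.2 w).1 := by
    funext w
    have he : 0 < (chosenOffspring h.2 w).1.flatten.count true := by
      rw [(chosenOffspring h.2 w).2.2]
      exact Nat.add_pos_left h.2.2 _
    have h1 : g (chosenOffspring h.2 w).1 = ((chosenOffspring h.2 w).1 :: h.1,
        ⟨(chosenOffspring h.2 w).1.flatten, he⟩) := dif_pos he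
    rw [h1]
    rfl
  rw [hg]
  exact measurable_of_chosenOffspring h.2 g

/-- The law of the input of one generation. -/
noncomputable def offspringInputMeasure (a : ℝ≥0) : Measure OffspringInput :=
  (poissonMeasure a).prod (Measure.infinitePi fun i => (offspringPMF i).toMeasure)

instance (a : ℝ≥0) : IsProbabilityMeasure (offspringInputMeasure a) := by
  rw [offspringInputMeasure]
  infer_instance

theorem offspringInputMeasure_fst_mem_and (a : ℝ≥0) (s : MarkedLevel) (p : ℕ)
    (e : MarkedOffspring (s, p)) :
    offspringInputMeasure a {w | w.1 = p ∧ w.2 (s, p) = e} =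
      ENNReal.ofReal (Real.exp (-a) * a ^ p / p.factorial) * offspringWeight s.1 p e.1 := by
  have h : {w : OffspringInput | w.1 = p ∧ w.2 (s, p) = e} =
      ({p} : Set ℕ) ×ˢ ((fun f : (i : MarkedLevel × ℕ) → MarkedOffspring i => f (s, p)) ⁻¹' {e}) := by
    ext w
    simp
  have hm : MeasurableSet ({e} : Set (MarkedOffspring (s, p))) := trivial
  rw [h, offspringInputMeasure, Measure.prod_prod, poissonMeasure_singleton,
    (measurePreserving_eval_infinitePi (fun i => (offspringPMF i).toMeasure) (s, p)).measure_preimage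
      hm.nullMeasurableSet, PMF.toMeasure_apply_singleton _ _ hm]
  rfl

/-- The offspring determines the number `p` of additional marks, so the event is a product event. -/
theorem offspringInputMeasure_chosenOffspring_eq (a : ℝ≥0) (s : MarkedLevel)
    {e : List (List Bool)} (he : parentMarks e = s.1) {p : ℕ}
    (hp : e.flatten.count true = s.1.count true + p) :
    offspringInputMeasure a {w | (chosenOffspring s w).1 = e} =
      ENNReal.ofReal (Real.exp (-a) * a ^ p / p.factorial) * offspringWeight s.1 p e := by
  rw [← offspringInputMeasure_fst_mem_and a s p ⟨e, he, hp⟩]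
  congr 1
  ext ⟨q, f⟩
  constructor
  · intro h
    have h' : (f (s, q)).1 = e := h
    have hq : q = p := by
      have := (f (s, q)).2.2
      rw [h', hp] at this
      simpa using this.symm
    subst hq
    exact ⟨rfl, Subtype.ext h'⟩
  · rintro ⟨h1, h2⟩
    replace h1 : q = p := h1
    subst h1
    exact congrArg Subtype.val h2

/-- The inputs of all generations are independent. -/
noncomputable def markedTreeMeasure (a : ℝ≥0) : Measure (ℕ → OffspringInput) :=
  Measure.infinitePi fun _ => offspringInputMeasure a

instance (a : ℝ≥0) : IsProbabilityMeasure (markedTreeMeasure a) := by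
  rw [markedTreeMeasure]
  infer_instance

/-- The history of the first `n` offsprings. -/
def markedHistory (ω : ℕ → OffspringInput) (n : ℕ) : MarkedHistory :=
  recursiveChain MarkedHistory.next ([], ⟨[true], by simp⟩) ω n

theorem measurable_markedHistory (n : ℕ) : Measurable fun ω => markedHistory ω n :=
  measurable_recursiveChain MarkedHistory.measurable_next _ n

theorem indepFun_markedHistory (a : ℝ≥0) (n : ℕ) :
    IndepFun (fun ω => markedHistory ω n) (fun ω => ω n) (markedTreeMeasure a) :=
  indepFun_recursiveChain MarkedHistory.measurable_next _ n _

theorem measurePreserving_eval_markedTreeMeasure (a : ℝ≥0) (n : ℕ) :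
    MeasurePreserving (fun ω : ℕ → OffspringInput => ω n) (markedTreeMeasure a)
      (offspringInputMeasure a) :=
  measurePreserving_eval_infinitePi (fun _ : ℕ => offspringInputMeasure a) n

theorem markedTreeMeasure_history_mem_and (a : ℝ≥0) (n : ℕ) (A : Set MarkedHistory)
    {B : Set OffspringInput} (hB : MeasurableSet B) :
    markedTreeMeasure a {ω | markedHistory ω n ∈ A ∧ ω n ∈ B} =
      markedTreeMeasure a {ω | markedHistory ω n ∈ A} * offspringInputMeasure a B := by
  rw [← (measurePreserving_eval_markedTreeMeasure a n).measure_preimage hB.nullMeasurableSet]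
  exact (indepFun_markedHistory a n).measure_inter_preimage_eq_mul A B MeasurableSet.of_discrete hB

theorem lintegral_markedHistory (a : ℝ≥0) (n : ℕ) {F : MarkedHistory → OffspringInput → ENNReal}
    (hF : ∀ h, Measurable (F h)) :
    ∫⁻ ω, F (markedHistory ω n) (ω n) ∂(markedTreeMeasure a) =
      ∫⁻ ω, ∫⁻ w, F (markedHistory ω n) w ∂(offspringInputMeasure a) ∂(markedTreeMeasure a) := by
  have hm := measurable_markedHistory n
  have hu : Measurable (Function.uncurry F) := measurable_from_prod_countable_right hF
  have he := (measurePreserving_eval_markedTreeMeasure a n).measurable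
  have h := (indepFun_iff_map_prod_eq_prod_map_map hm.aemeasurable he.aemeasurable).1
    (indepFun_markedHistory a n)
  rw [(measurePreserving_eval_markedTreeMeasure a n).map_eq] at h
  calc _ = ∫⁻ x, Function.uncurry F x ∂((markedTreeMeasure a).map
        fun ω => (markedHistory ω n, ω n)) := (lintegral_map hu (hm.prodMk he)).symm
    _ = _ := by
      rw [h, lintegral_prod _ hu.aemeasurable, lintegral_map _ hm]
      · rfl
      · exact measurable_from_top

theorem lintegral_chosenOffspring (a : ℝ≥0) (s : MarkedLevel) (f : List (List Bool) → ENNReal) :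
    ∫⁻ w, f (chosenOffspring s w).1 ∂(offspringInputMeasure a) =
      ∫⁻ p, ∑' e : MarkedOffspring (s, p), offspringWeight s.1 p e.1 * f e.1
        ∂(poissonMeasure a) := by
  rw [offspringInputMeasure, lintegral_prod _ (measurable_of_chosenOffspring s f).aemeasurable]
  refine lintegral_congr fun p => ?_
  have hm : Measurable fun e : MarkedOffspring (s, p) => f e.1 := measurable_from_top
  have h := (measurePreserving_eval_infinitePi (fun i => (offspringPMF i).toMeasure)
    (s, p)).lintegral_comp hm
  refine h.trans ?_
  have hs : ∀ e : MarkedOffspring (s, p), MeasurableSet ({e} : Set (MarkedOffspring (s, p))) :=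
    fun _ => trivial
  have : MeasurableSingletonClass (MarkedOffspring (s, p)) := ⟨hs⟩
  rw [lintegral_countable']
  refine tsum_congr fun e => ?_
  rw [PMF.toMeasure_apply_singleton _ _ (hs e), mul_comm]
  rfl

/-- The marks of the vertices in the generation `n + 1` of the marked tree. -/
def markedLevel (ω : ℕ → OffspringInput) (n : ℕ) : MarkedLevel := (markedHistory ω n).2

/-- The marks of the children of the vertices in the generation `n + 1` of the marked tree. -/
def markedChildren (ω : ℕ → OffspringInput) (n : ℕ) : List (List Bool) :=
  (chosenOffspring (markedLevel ω n) (ω n)).1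

theorem markedHistory_succ (ω : ℕ → OffspringInput) (n : ℕ) :
    (markedHistory ω (n + 1)).1 = markedChildren ω n :: (markedHistory ω n).1 := rfl

theorem markedLevel_zero (ω : ℕ → OffspringInput) : (markedLevel ω 0).1 = [true] := rfl

theorem markedLevel_succ (ω : ℕ → OffspringInput) (n : ℕ) :
    (markedLevel ω (n + 1)).1 = (markedChildren ω n).flatten := rfl

theorem parentMarks_markedChildren (ω : ℕ → OffspringInput) (n : ℕ) :
    parentMarks (markedChildren ω n) = (markedLevel ω n).1 :=
  (chosenOffspring (markedLevel ω n) (ω n)).2.1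

/-- The offspring realises exactly the prescribed number of additional marks. This makes the spine
widths a random walk with Poisson steps. -/
theorem count_markedLevel (ω : ℕ → OffspringInput) (n : ℕ) :
    (markedLevel ω n).1.count true = 1 + ∑ i ∈ Finset.range n, (ω i).1 := by
  induction n with
  | zero => simp [markedLevel_zero]
  | succ n ih =>
    rw [Finset.sum_range_succ, ← add_assoc, ← ih, markedLevel_succ]
    exact (chosenOffspring (markedLevel ω n) (ω n)).2.2

theorem length_markedChildren (ω : ℕ → OffspringInput) (n : ℕ) :
    (markedChildren ω n).length = (markedLevel ω n).1.length := by
  rw [← parentMarks_markedChildren, parentMarks, List.length_map]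

/-- The random tree: it forgets the marks of the marked tree. -/
def markedTree (ω : ℕ → OffspringInput) : PlanarTree :=
  PlanarTree.ofCode (fun r => r.casesOn [1] fun n => (markedChildren ω n).map List.length) rfl
    (by
      intro r
      cases r with
      | zero => simp [length_markedChildren, markedLevel_zero]
      | succ n => simp [length_markedChildren, markedLevel_succ, List.length_flatten])

theorem code_markedTree_succ (ω : ℕ → OffspringInput) (n : ℕ) :
    (markedTree ω).code (n + 1) = (markedChildren ω n).map List.length := by
  rw [markedTree, PlanarTree.code_ofCode]

theorem width_markedTree_succ (ω : ℕ → OffspringInput) (n : ℕ) :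
    (markedTree ω).width (n + 1) = (markedLevel ω n).1.length := by
  rw [← PlanarTree.length_code, code_markedTree_succ, List.length_map, length_markedChildren]

end MarkedHistory

/-! ### Ball probabilities of the random tree. -/

section CylinderProbability

open scoped NNReal

theorem count_parentMarks_pos {e : List (List Bool)} (h : 0 < e.flatten.count true) :
    0 < (parentMarks e).count true := by
  rw [List.count_pos_iff, List.mem_flatten] at h
  obtain ⟨w, hw, hm⟩ := h
  rw [List.count_pos_iff, parentMarks, List.mem_map]
  exact ⟨w, hw, (any_eq_true_iff_count_pos w).2 (List.count_pos_iff.2 hm)⟩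

theorem PlanarTree.mem_cylinder_succ {n : ℕ} {T T₀ : PlanarTree} :
    T ∈ cylinder (n + 1) T₀ ↔ T ∈ cylinder n T₀ ∧ T.code (n + 1) = T₀.code (n + 1) := by
  simp only [cylinder, Set.mem_ofPred_eq, ball_succ_eq_iff]
  constructor
  · exact fun h => ⟨fun s hs => h s (by omega), h _ le_rfl⟩
  · rintro ⟨h1, h2⟩ s hs
    rcases Nat.le_succ_iff.1 hs with h | rfl
    · exact h1 s h
    · exact h2

theorem PlanarTree.mem_cylinder_zero (T T₀ : PlanarTree) : T ∈ cylinder 0 T₀ := by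
  simp only [cylinder, Set.mem_ofPred_eq, ball_succ_eq_iff]
  intro s hs
  rw [Nat.le_zero.1 hs, code_zero, code_zero]

open PlanarTree

theorem exists_markedTree_mem_cylinder_iff (n : ℕ) (T₀ : PlanarTree) :
    ∃ A : Set (List (List (List Bool))), ∀ ω,
      markedTree ω ∈ cylinder n T₀ ↔ (markedHistory ω n).1 ∈ A := by
  induction n with
  | zero => exact ⟨Set.univ, fun ω => iff_of_true (mem_cylinder_zero _ _) trivial⟩
  | succ n ih =>
    obtain ⟨A, hA⟩ := ih
    refine ⟨{x | ∃ e l, x = e :: l ∧ l ∈ A ∧ e.map List.length = T₀.code (n + 1)}, fun ω => ?_⟩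
    rw [mem_cylinder_succ, hA, code_markedTree_succ, markedHistory_succ]
    constructor
    · exact fun h => ⟨_, _, rfl, h⟩
    · rintro ⟨e, l, h1, h2⟩
      obtain ⟨rfl, rfl⟩ := List.cons.inj h1
      exact h2

theorem offspringWeight_eq_ofReal {s : List Bool} (hs : 0 < s.count true) (p : ℕ)
    (e : List (List Bool)) : offspringWeight s p e = ENNReal.ofReal
      ((1 / 2) ^ e.flatten.length * ((1 / 2) ^ s.length * ((s.count true).multichoose p : ℝ)⁻¹)) := by
  have h2 : (2⁻¹ : ENNReal) = ENNReal.ofReal (1 / 2) := by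
    rw [one_div, ENNReal.ofReal_inv_of_pos (by norm_num)]
    simp
  have hm : (0 : ℝ) < ((s.count true).multichoose p : ℝ) := by
    exact_mod_cast multichoose_pos hs p
  rw [offspringWeight, h2, ENNReal.ofReal_mul (by positivity), ENNReal.ofReal_mul (by positivity),
    ENNReal.ofReal_pow (by norm_num), ENNReal.ofReal_pow (by norm_num),
    ENNReal.ofReal_inv_of_pos hm, ENNReal.ofReal_natCast]

/-- It merges the factor `a^i / i!` of the past with the Poisson weight `a^p / p!` of one generation
into `a^(i+p) / (i+p)!`. -/
theorem multichoose_succ_mul_factorial (i p : ℕ) :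
    ((i + 1).multichoose p : ℝ) * (i.factorial * p.factorial) = (i + p).factorial := by
  rw [Nat.multichoose_eq, show i + 1 + p - 1 = i + p by omega, Nat.add_choose,
    Nat.cast_div (Nat.factorial_mul_factorial_dvd_factorial_add i p) (by positivity)]
  push_cast
  field_simp

/-- The ball and the marks of its top level determine all earlier marks, since a vertex is marked
exactly when one of its children is. The event is therefore a single history, and its probability is
a product over generations. -/
theorem markedTreeMeasure_cylinder_and_level (a : ℝ≥0) (n : ℕ) (T₀ : PlanarTree) (s : List Bool)
    (i : ℕ) (hi : s.count true = i + 1) :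
    markedTreeMeasure a {ω | markedTree ω ∈ cylinder n T₀ ∧ (markedLevel ω n).1 = s} =
      if s.length = T₀.width (n + 1) then ENNReal.ofReal (Real.exp (-a) ^ n *
        (2 ^ (T₀.width (n + 1) + 1) / 4 ^ ballEdges n T₀) * (a ^ i / i.factorial)) else 0 := by
  by_cases hlen : s.length = T₀.width (n + 1)
  swap
  · rw [if_neg hlen]
    convert measure_empty (μ := markedTreeMeasure a)
    refine Set.eq_empty_of_forall_notMem fun ω hω => hlen ?_
    rw [← hω.2, ← width_markedTree_succ]
    exact width_eq_of_ball_eq hω.1 le_rfl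
  rw [if_pos hlen]
  induction n generalizing s i with
  | zero =>
    rw [zero_add, width_one] at hlen
    obtain ⟨b, rfl⟩ := List.length_eq_one_iff.1 hlen
    have hb : b = true := by
      by_contra hb
      simp [hb] at hi
    subst hb
    obtain rfl : i = 0 := by simpa using hi.symm
    rw [ballEdges_zero, zero_add, width_one]
    have : {ω : ℕ → OffspringInput | markedTree ω ∈ cylinder 0 T₀ ∧ (markedLevel ω 0).1 = [true]} =
        Set.univ := Set.eq_univ_of_forall fun ω => ⟨mem_cylinder_zero _ _, markedLevel_zero ω⟩
    rw [this, measure_univ]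
    norm_num
  | succ n ih =>
    have hsum : s.length = (T₀.code (n + 1)).sum := by rw [hlen, sum_code]
    -- The only possible marked offspring: the top level `s`, cut into blocks of the lengths given
    -- by the child counts.
    obtain ⟨e, he1, he2⟩ : ∃ e : List (List Bool),
        e.map List.length = T₀.code (n + 1) ∧ e.flatten = s :=
      ⟨_, List.map_splitLengths_length _ _ hsum.ge, List.flatten_splitLengths _ _ hsum.le⟩
    obtain ⟨A, hA⟩ := exists_markedTree_mem_cylinder_iff n T₀
    have hpos : 0 < (parentMarks e).count true := count_parentMarks_pos (by rw [he2]; omega)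
    obtain ⟨i', hi'⟩ : ∃ i', (parentMarks e).count true = i' + 1 := ⟨_, (Nat.succ_pred_eq_of_pos hpos).symm⟩
    obtain ⟨p, hp⟩ := Nat.exists_eq_add_of_le (parentMarks_flatten e)
    have hl : (parentMarks e).length = T₀.width (n + 1) := by
      rw [← length_code, ← he1, parentMarks, List.length_map, List.length_map]
    have hset : {ω | markedTree ω ∈ cylinder (n + 1) T₀ ∧ (markedLevel ω (n + 1)).1 = s} =
        {ω | markedHistory ω n ∈ {h : MarkedHistory | h.1 ∈ A ∧ h.2.1 = parentMarks e} ∧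
          ω n ∈ {w | (chosenOffspring ⟨parentMarks e, hpos⟩ w).1 = e}} := by
      ext ω
      have hch : markedChildren ω n = e ↔
          (markedChildren ω n).map List.length = T₀.code (n + 1) ∧ (markedLevel ω (n + 1)).1 = s := by
        rw [markedLevel_succ, ← he1, ← he2, and_comm, ← List.eq_iff_flatten_eq]
      simp only [Set.mem_ofPred_eq]
      rw [mem_cylinder_succ, code_markedTree_succ, and_assoc, ← hch, hA]
      constructor
      · rintro ⟨h1, h2⟩
        have h3 : (markedLevel ω n).1 = parentMarks e := by rw [← h2, parentMarks_markedChildren]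
        refine ⟨⟨h1, h3⟩, ?_⟩
        have h4 : markedLevel ω n = ⟨parentMarks e, hpos⟩ := Subtype.ext h3
        exact (congrArg (fun s => (chosenOffspring s (ω n)).1) h4).symm.trans h2
      · rintro ⟨⟨h1, h3⟩, h2⟩
        refine ⟨h1, ?_⟩
        have h4 : markedLevel ω n = ⟨parentMarks e, hpos⟩ := Subtype.ext h3
        exact (congrArg (fun s => (chosenOffspring s (ω n)).1) h4).trans h2
    have hmeas : MeasurableSet {w | (chosenOffspring ⟨parentMarks e, hpos⟩ w).1 = e} :=
      measurable_of_chosenOffspring ⟨parentMarks e, hpos⟩ (fun e' => e' = e)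
        (MeasurableSet.of_discrete (s := {p : Prop | p}))
    have ih' := ih (parentMarks e) i' hi' hl
    rw [hset, markedTreeMeasure_history_mem_and a n _ hmeas,
      offspringInputMeasure_chosenOffspring_eq a ⟨parentMarks e, hpos⟩ rfl hp,
      offspringWeight_eq_ofReal hpos]
    have hset' : {ω | markedHistory ω n ∈ {h : MarkedHistory | h.1 ∈ A ∧ h.2.1 = parentMarks e}} =
        {ω | markedTree ω ∈ cylinder n T₀ ∧ (markedLevel ω n).1 = parentMarks e} := by
      ext ω
      exact and_congr_left fun _ => (hA ω).symm
    have hii : i = i' + p := by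
      rw [he2, hi, hi'] at hp
      omega
    have hm := multichoose_succ_mul_factorial i' p
    have hm0 : (((i' + 1).multichoose p : ℕ) : ℝ) ≠ 0 := by
      exact_mod_cast (multichoose_pos (Nat.succ_pos i') p).ne'
    rw [hset', ih', ← ENNReal.ofReal_mul (by positivity), ← ENNReal.ofReal_mul (by positivity),
      he2, hlen, hl, hi', ballEdges_succ, hii, ← hm]
    congr 1
    rw [show (4 : ℝ) = 2 * 2 by norm_num, mul_pow, mul_pow, show n + 1 + 1 = n + 2 by ring]
    simp only [pow_add, one_div, inv_pow]
    field_simp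

/-- The probability that the random tree lies in a cylinder. -/
theorem markedTreeMeasure_cylinder (a : ℝ≥0) (n : ℕ) (T₀ : PlanarTree) :
    markedTreeMeasure a {ω | markedTree ω ∈ cylinder n T₀} =
      ENNReal.ofReal (Real.exp (-a) ^ n * (2 ^ (T₀.width (n + 1) + 1) / 4 ^ ballEdges n T₀) *
        laguerreSum a (T₀.width (n + 1))) := by
  obtain ⟨A, hA⟩ := exists_markedTree_mem_cylinder_iff n T₀
  set K := T₀.width (n + 1)
  set C := Real.exp (-a) ^ n * (2 ^ (K + 1) / 4 ^ ballEdges n T₀) with hC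
  have hC0 : 0 ≤ C := by positivity
  have hset : {ω | markedTree ω ∈ cylinder n T₀} =
      ⋃ s : List Bool, {ω | markedTree ω ∈ cylinder n T₀ ∧ (markedLevel ω n).1 = s} := by
    ext ω
    simp
  have hmeas : ∀ s : List Bool,
      MeasurableSet {ω | markedTree ω ∈ cylinder n T₀ ∧ (markedLevel ω n).1 = s} := by
    intro s
    simp only [hA]
    exact measurable_markedHistory n
      (MeasurableSet.of_discrete (s := {h : MarkedHistory | h.1 ∈ A ∧ h.2.1 = s}))
  rw [hset, measure_iUnion (fun s s' hs => Set.disjoint_left.2 fun ω h1 h2 =>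
    hs (h1.2.symm.trans h2.2)) hmeas]
  -- A mark pattern contributes only to the index `i` with `i + 1` marks; there are `K.choose (i +
  -- 1)` such patterns of length `K`.
  have hterm : ∀ s : List Bool,
      markedTreeMeasure a {ω | markedTree ω ∈ cylinder n T₀ ∧ (markedLevel ω n).1 = s} =
      ∑ i ∈ Finset.range K, (if s.length = K ∧ s.count true = i + 1 then 1 else 0) *
        ENNReal.ofReal (C * (a ^ i / i.factorial)) := by
    intro s
    rcases Nat.eq_zero_or_pos (s.count true) with hs | hs
    · rw [Finset.sum_eq_zero fun i _ => by simp [hs]]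
      convert measure_empty (μ := markedTreeMeasure a)
      refine Set.eq_empty_of_forall_notMem fun ω hω => ?_
      have := (markedLevel ω n).2
      rw [hω.2, hs] at this
      exact lt_irrefl _ this
    · obtain ⟨i, hi⟩ : ∃ i, s.count true = i + 1 := ⟨_, (Nat.succ_pred_eq_of_pos hs).symm⟩
      rw [markedTreeMeasure_cylinder_and_level a n T₀ s i hi]
      by_cases hl : s.length = K
      · have hiK : i ∈ Finset.range K := by
          have := List.count_le_length (a := true) (l := s)
          rw [Finset.mem_range]
          omega
        rw [if_pos hl, Finset.sum_eq_single_of_mem i hiK fun i' _ hne => by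
          rw [if_neg (by omega), zero_mul], if_pos ⟨hl, hi⟩, one_mul]
      · rw [if_neg hl, Finset.sum_eq_zero fun i _ => by simp [hl]]
  rw [tsum_congr hterm, Summable.tsum_finsetSum fun _ _ => ENNReal.summable, laguerreSum,
    Finset.mul_sum, ENNReal.ofReal_sum_of_nonneg fun i _ => by positivity]
  refine Finset.sum_congr rfl fun i _ => ?_
  rw [ENNReal.tsum_mul_right, tsum_words_eq_choose, ← ENNReal.ofReal_natCast,
    ← ENNReal.ofReal_mul (by positivity)]
  congr 1
  ring

end CylinderProbability

/-! ### Weak convergence to the law of the random tree. -/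

section LocalLimit

open scoped NNReal

namespace PlanarTree

/-- The sets of trees with a given ball of positive radius. -/
def cylinders : Set (Set PlanarTree) := {s | ∃ n T₀, s = cylinder n T₀}

theorem countable_cylinders : cylinders.Countable := by
  refine (Set.countable_range fun p : ℕ × List (List ℕ) =>
    {T : PlanarTree | (List.range (p.1 + 1)).map T.code = p.2}).mono ?_
  rintro _ ⟨n, T₀, rfl⟩
  refine ⟨(n, (List.range (n + 1)).map T₀.code), ?_⟩
  ext T
  simp only [cylinder, Set.mem_ofPred_eq, ball_succ_eq_iff]
  rw [List.map_inj_left]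
  simp only [List.mem_range, Nat.lt_succ_iff]

theorem mem_cylinder_self (n : ℕ) (T : PlanarTree) : T ∈ cylinder n T := rfl

theorem isTopologicalBasis_cylinders : TopologicalSpace.IsTopologicalBasis cylinders := by
  refine TopologicalSpace.isTopologicalBasis_of_isOpen_of_nhds ?_ fun T U hT hU => ?_
  · rintro _ ⟨n, T₀, rfl⟩
    exact isOpen_cylinder n T₀
  · obtain ⟨n, hn⟩ := exists_cylinder_subset hU hT
    exact ⟨_, ⟨n, T, rfl⟩, mem_cylinder_self n T, hn⟩

instance : SecondCountableTopology PlanarTree :=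
  isTopologicalBasis_cylinders.secondCountableTopology countable_cylinders

theorem isPiSystem_cylinders : IsPiSystem cylinders := by
  rintro _ ⟨n, T₁, rfl⟩ _ ⟨m, T₂, rfl⟩ ⟨T, h1, h2⟩
  refine ⟨max n m, T, ?_⟩
  ext T'
  simp only [cylinder, Set.mem_inter_iff, Set.mem_ofPred_eq, ball_succ_eq_iff] at h1 h2 ⊢
  constructor
  · rintro ⟨h3, h4⟩ s hs
    rcases le_max_iff.1 hs with h | h
    · rw [h3 s h, h1 s h]
    · rw [h4 s h, h2 s h]
  · intro h3
    exact ⟨fun s hs => by rw [h3 s (le_max_of_le_left hs), h1 s hs],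
      fun s hs => by rw [h3 s (le_max_of_le_right hs), h2 s hs]⟩

theorem measurable_of_cylinder {α : Type*} [MeasurableSpace α] {f : α → PlanarTree}
    (h : ∀ n T₀, MeasurableSet {x | f x ∈ cylinder n T₀}) : Measurable f := by
  show @Measurable α PlanarTree _ (borel PlanarTree) f
  rw [isTopologicalBasis_cylinders.borel_eq_generateFrom]
  refine measurable_generateFrom ?_
  rintro _ ⟨n, T₀, rfl⟩
  exact h n T₀

theorem measurable_of_width_of_parent {α : Type*} [MeasurableSpace α] {f : α → PlanarTree}
    (hw : ∀ r k, MeasurableSet {x | (f x).width r = k})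
    (hp : ∀ r j k, MeasurableSet {x | (f x).parent r j = k}) : Measurable f := by
  refine measurable_of_cylinder fun n T₀ => ?_
  simp only [cylinder, Set.mem_ofPred_eq, ball_eq_ball_iff, funext_iff]
  refine MeasurableSet.inter (s₁ := {x | ∀ s ≤ max (n + 1) 1, (f x).width s = T₀.width s})
    (s₂ := {x | ∀ s < max (n + 1) 1, ∀ j, (f x).parent s j = T₀.parent s j}) ?_ ?_
  · simp only [Set.ofPred_forall]
    exact MeasurableSet.iInter fun s => MeasurableSet.iInter fun _ => hw s _
  · simp only [Set.ofPred_forall]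
    exact MeasurableSet.iInter fun s => MeasurableSet.iInter fun _ =>
      MeasurableSet.iInter fun j => hp s j _

end PlanarTree

open PlanarTree

theorem measurable_markedTree : Measurable markedTree := by
  refine measurable_of_cylinder fun n T₀ => ?_
  obtain ⟨A, hA⟩ := exists_markedTree_mem_cylinder_iff n T₀
  simp only [hA]
  exact measurable_markedHistory n (MeasurableSet.of_discrete (s := {h : MarkedHistory | h.1 ∈ A}))

theorem PlanarTree.IsLocalLimit.unique {μ : ℝ} {ν ν' : Measure PlanarTree}
    (h : IsLocalLimit μ ν) (h' : IsLocalLimit μ ν') : ν = ν' := by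
  have := h.1
  have := h'.1
  exact ext_of_forall_integral_eq_of_IsFiniteMeasure
    fun f => tendsto_nhds_unique (h.2 f) (h'.2 f)

/-- Cylinders are a π-system and contain arbitrarily small neighbourhoods of each tree, so
convergence of their probabilities implies weak convergence. -/
theorem isLocalLimit_map_markedTree {a : ℝ≥0} (ha : 0 < a) :
    IsLocalLimit a ((markedTreeMeasure a).map markedTree) := by
  have hP : IsProbabilityMeasure ((markedTreeMeasure a).map markedTree) :=
    Measure.isProbabilityMeasure_map measurable_markedTree.aemeasurable
  refine ⟨hP, fun F => ?_⟩
  -- The index `N = 0` is skipped: no planar tree has size `0`.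
  rw [← tendsto_add_atTop_iff_nat 1]
  have ha' : (0 : ℝ) < a := ha
  let ν' : ℕ → ProbabilityMeasure PlanarTree := fun N =>
    ⟨finiteSizeMeasure a (N + 1), isProbabilityMeasure_finiteSizeMeasure ha' N⟩
  let ν : ProbabilityMeasure PlanarTree := ⟨(markedTreeMeasure a).map markedTree, hP⟩
  have key : Tendsto ν' atTop (𝓝 ν) := by
    refine isPiSystem_cylinders.tendsto_probabilityMeasure_of_tendsto_of_mem ?_ ?_ ?_
    · rintro _ ⟨n, T₀, rfl⟩
      exact measurableSet_cylinder n T₀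
    · intro U hU T hT
      obtain ⟨n, hn⟩ := exists_cylinder_subset hU hT
      exact ⟨_, ⟨n, T, rfl⟩, (isOpen_cylinder n T).mem_nhds (mem_cylinder_self n T), hn⟩
    · rintro _ ⟨n, T₀, rfl⟩
      rw [← ENNReal.tendsto_coe]
      simp only [ProbabilityMeasure.ennreal_coeFn_eq_coeFn_toMeasure]
      have h1 := (tendsto_add_atTop_iff_nat 1).2 (tendsto_finiteSizeMeasure_cylinder ha' n T₀)
      rw [← markedTreeMeasure_cylinder a n T₀] at h1
      have h2 : (ν : Measure PlanarTree) (cylinder n T₀) =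
          markedTreeMeasure a {ω | markedTree ω ∈ cylinder n T₀} :=
        Measure.map_apply measurable_markedTree (measurableSet_cylinder n T₀)
      rw [h2]
      exact h1
  exact ProbabilityMeasure.tendsto_iff_forall_integral_tendsto.1 key F

end LocalLimit

/-! ### Marked vertices are of infinite type; descendants of unmarked vertices. -/

section InfiniteType

open scoped NNReal ENNReal

theorem exists_getElem?_flatten {α : Type*} {e : List (List α)} {i : ℕ} {w : List α} {b : α}
    (hi : e[i]? = some w) (hb : b ∈ w) :
    ∃ j, e.flatten[j]? = some b ∧ blockIndex (e.map List.length) j = i := by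
  induction e generalizing i with
  | nil => simp at hi
  | cons v e ih =>
    cases i with
    | zero =>
      obtain rfl : v = w := by simpa using hi
      obtain ⟨k, hk⟩ := List.mem_iff_getElem?.1 hb
      have hk' : k < v.length := (List.getElem?_eq_some_iff.1 hk).1
      exact ⟨k, by rw [List.flatten_cons, List.getElem?_append_left hk', hk],
        by rw [List.map_cons, blockIndex, if_pos hk']⟩
    | succ i =>
      obtain ⟨j, h1, h2⟩ := ih (by simpa using hi)
      refine ⟨v.length + j, ?_, ?_⟩
      · rw [List.flatten_cons, List.getElem?_append_right (by omega), Nat.add_sub_cancel_left, h1]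
      · rw [List.map_cons, blockIndex, if_neg (by omega), Nat.add_sub_cancel_left, h2]

theorem PlanarTree.size_eq_top {T : PlanarTree} (h : ∀ r, T.width (r + 1) ≠ 0) : T.size = ⊤ := by
  refine Set.encard_eq_top_iff.2 ((Set.infinite_range_of_injective
    (f := fun r : ℕ => (r, 0)) fun a b h => (Prod.mk.inj h).1).mono ?_)
  rintro _ ⟨r, rfl⟩
  exact Nat.pos_of_ne_zero (h r)

theorem width_markedTree_pos (ω : ℕ → OffspringInput) (n : ℕ) :
    0 < (markedTree ω).width (n + 1) := by
  rw [width_markedTree_succ]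
  exact (markedLevel ω n).2.trans_le List.count_le_length

theorem size_markedTree (ω : ℕ → OffspringInput) : (markedTree ω).size = ⊤ :=
  PlanarTree.size_eq_top fun n => (width_markedTree_pos ω n).ne'

theorem parent_markedTree (ω : ℕ → OffspringInput) {n j : ℕ}
    (hj : j < (markedTree ω).width (n + 2)) :
    (markedTree ω).parent (n + 1) j = blockIndex ((markedChildren ω n).map List.length) j := by
  rw [PlanarTree.parent_eq_blockIndex _ hj, code_markedTree_succ]

/-- A marked vertex has a marked child, and iterating this produces a descendant in every later
generation. -/
theorem isInfType_of_marked {ω : ℕ → OffspringInput} {n i : ℕ}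
    (hi : (markedLevel ω n).1[i]? = some true) : (markedTree ω).IsInfType (n + 1) i := by
  have key : ∀ k, ∃ j, (markedLevel ω (n + k)).1[j]? = some true ∧
      (markedTree ω).ancestor (n + 1) k j = i := by
    intro k
    induction k with
    | zero => exact ⟨i, hi, rfl⟩
    | succ k ih =>
      obtain ⟨j, h1, h2⟩ := ih
      rw [← parentMarks_markedChildren, parentMarks, List.getElem?_map,
        Option.map_eq_some_iff] at h1
      obtain ⟨w, hw1, hw2⟩ := h1
      obtain ⟨j', h3, h4⟩ := exists_getElem?_flatten hw1
        (List.count_pos_iff.1 ((any_eq_true_iff_count_pos w).1 hw2))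
      rw [← markedLevel_succ] at h3
      refine ⟨j', h3, ?_⟩
      have hj' : j' < (markedTree ω).width (n + k + 2) := by
        rw [width_markedTree_succ]
        exact (List.getElem?_eq_some_iff.1 h3).1
      rw [PlanarTree.ancestor, show n + 1 + k = n + k + 1 by ring, parent_markedTree ω hj', h4, h2]
  choose f hf1 hf2 using key
  refine (Set.infinite_range_of_injective (f := fun k : ℕ => (k, f (k + 1)))
    fun a b h => (Prod.mk.inj h).1).mono ?_
  rintro _ ⟨k, rfl⟩
  refine ⟨?_, hf2 (k + 1)⟩
  show f (k + 1) < (markedTree ω).width (n + 1 + (k + 1))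
  rw [show n + 1 + (k + 1) = n + (k + 1) + 1 by ring, width_markedTree_succ]
  exact (List.getElem?_eq_some_iff.1 (hf1 (k + 1))).1

/-- The children inherit the flags of their parents. -/
def inheritFlags {α : Type*} : List Bool → List (List α) → List Bool
  | d :: c, w :: e => List.replicate w.length d ++ inheritFlags c e
  | _, _ => []

theorem count_inheritFlags {α : Type*} (c : List Bool) (e : List (List α)) :
    (inheritFlags c e).count true = flaggedChildren c e := by
  induction c generalizing e with
  | nil => rfl
  | cons d c ih =>
    cases e with
    | nil => rfl
    | cons w e =>
      rw [inheritFlags, flaggedChildren, List.count_append, ih, List.count_replicate]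
      cases d <;> simp

theorem flaggedChildren_eq_zero {α : Type*} {c : List Bool} (hc : c.count true = 0)
    (e : List (List α)) : flaggedChildren c e = 0 := by
  induction c generalizing e with
  | nil => rfl
  | cons d c ih =>
    cases e with
    | nil => rfl
    | cons w e =>
      cases d
      · rw [flaggedChildren, ih (by simpa using hc)]
        simp
      · simp at hc

/-- Flags and marks remain disjoint because an unmarked vertex has only unmarked children. This is
the hypothesis under which `tsum_offspringWeight_mul` applies. -/
theorem forall₂_inheritFlags {c : List Bool} {e : List (List Bool)}
    (h : List.Forall₂ (fun d b => d = true → b = false) c (parentMarks e)) :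
    List.Forall₂ (fun d b => d = true → b = false) (inheritFlags c e) e.flatten := by
  induction e generalizing c with
  | nil =>
    cases h
    exact List.Forall₂.nil
  | cons w e ih =>
    rw [parentMarks, List.map_cons] at h
    obtain ⟨d, c, hd, hc, rfl⟩ := List.forall₂_cons_right_iff.1 h
    rw [inheritFlags, List.flatten_cons]
    refine List.rel_append ?_ (ih hc)
    rw [List.forall₂_iff_get]
    refine ⟨List.length_replicate, fun k h1 h2 h3 => ?_⟩
    simp only [List.get_eq_getElem, List.getElem_replicate] at h3
    have := hd h3
    rw [List.any_eq_false] at this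
    simpa using this _ (List.get_mem w ⟨k, h2⟩)

theorem getElem?_inheritFlags {α : Type*} {b : List Bool} {e : List (List α)}
    (h : b.length = e.length) {j : ℕ} (hj : j < e.flatten.length) :
    (inheritFlags b e)[j]? = b[blockIndex (e.map List.length) j]? := by
  induction e generalizing b j with
  | nil => simp at hj
  | cons w e ih =>
    obtain ⟨d, b, rfl⟩ := List.exists_cons_of_length_eq_add_one h
    rw [inheritFlags, List.map_cons, blockIndex]
    by_cases hw : j < w.length
    · rw [if_pos hw, List.getElem?_append_left (by simpa using hw)]
      simp [hw]
    · rw [if_neg hw, List.getElem?_append_right (by simpa using hw), List.length_replicate,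
        ih (by simpa using h), List.getElem?_cons_succ]
      rw [List.flatten_cons, List.length_append] at hj
      omega

/-- The flags of the descendants in the generation `n + 1 + k` of the vertices without mark of the
generation `n + 1`. -/
def unmarkedDescendants (ω : ℕ → OffspringInput) (n : ℕ) : ℕ → List Bool
  | 0 => (markedLevel ω n).1.map not
  | k + 1 => inheritFlags (unmarkedDescendants ω n k) (markedChildren ω (n + k))

theorem forall₂_unmarkedDescendants (ω : ℕ → OffspringInput) (n k : ℕ) :
    List.Forall₂ (fun d b => d = true → b = false) (unmarkedDescendants ω n k)
      (markedLevel ω (n + k)).1 := by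
  induction k with
  | zero =>
    rw [unmarkedDescendants, List.forall₂_map_left_iff]
    exact List.forall₂_same.2 fun b _ h => by simpa using h
  | succ k ih =>
    rw [← parentMarks_markedChildren] at ih
    exact forall₂_inheritFlags ih

theorem unmarkedDescendants_of_ancestor {ω : ℕ → OffspringInput} {n i : ℕ}
    (hi : (markedLevel ω n).1[i]? = some false) (k : ℕ) {j : ℕ}
    (hj : j < (markedTree ω).width (n + 1 + k)) (ha : (markedTree ω).ancestor (n + 1) k j = i) :
    (unmarkedDescendants ω n k)[j]? = some true := by
  induction k generalizing j with
  | zero =>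
    have ha' : j = i := ha
    rw [unmarkedDescendants, List.getElem?_map, ha', hi]
    rfl
  | succ k ih =>
    have hj' := (markedTree ω).parent_lt _ _ hj
    have h : (unmarkedDescendants ω n k)[(markedTree ω).parent (n + 1 + k) j]? = some true :=
      ih hj' ha
    rw [show n + 1 + (k + 1) = n + k + 2 by ring] at hj
    rw [show n + 1 + k = n + k + 1 by ring, parent_markedTree ω hj] at h
    rw [width_markedTree_succ, markedLevel_succ] at hj
    rw [unmarkedDescendants, getElem?_inheritFlags _ hj, h]
    rw [(forall₂_unmarkedDescendants ω n k).length_eq, length_markedChildren]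

theorem count_unmarkedDescendants_eq_zero {ω : ℕ → OffspringInput} {n k m : ℕ} (hkm : k ≤ m)
    (h : (unmarkedDescendants ω n k).count true = 0) :
    (unmarkedDescendants ω n m).count true = 0 := by
  induction m, hkm using Nat.le_induction with
  | base => exact h
  | succ m _ ih => rw [unmarkedDescendants, count_inheritFlags, flaggedChildren_eq_zero ih]

theorem not_isInfType_of_unmarked {ω : ℕ → OffspringInput} {n k i : ℕ}
    (hk : (unmarkedDescendants ω n k).count true = 0)
    (hi : (markedLevel ω n).1[i]? = some false) : ¬ (markedTree ω).IsInfType (n + 1) i := by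
  intro hinf
  refine hinf ((((Finset.range k).sigma fun m => Finset.range ((markedTree ω).width
    (n + 1 + (m + 1)))).map (Equiv.sigmaEquivProd ℕ ℕ).toEmbedding).finite_toSet.subset ?_)
  rintro ⟨m, j⟩ ⟨h1, h2⟩
  have h3 := unmarkedDescendants_of_ancestor hi (m + 1) h1 h2
  have hm : m < k := by
    by_contra hm
    have h4 := count_unmarkedDescendants_eq_zero (show k ≤ m + 1 by omega) hk
    exact (List.count_eq_zero.1 h4) (List.mem_of_getElem? h3)
  simpa using ⟨hm, h1⟩

end InfiniteType

/-! ### Extinction of the unmarked part. -/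

section Extinction

open ProbabilityTheory
open scoped NNReal ENNReal

theorem exists_markedLevel_eq (n : ℕ) : ∃ Φ : List (List (List Bool)) → List Bool,
    ∀ ω, (markedLevel ω n).1 = Φ (markedHistory ω n).1 := by
  cases n with
  | zero => exact ⟨fun _ => [true], fun _ => rfl⟩
  | succ n => exact ⟨fun x => (x.headD []).flatten, fun _ => rfl⟩

theorem exists_unmarkedDescendants_eq (n k : ℕ) : ∃ Φ : List (List (List Bool)) → List Bool,
    ∀ ω, unmarkedDescendants ω n k = Φ (markedHistory ω (n + k)).1 := by
  induction k with
  | zero =>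
    obtain ⟨Φ, hΦ⟩ := exists_markedLevel_eq n
    exact ⟨fun x => (Φ x).map not, fun ω => by rw [unmarkedDescendants, hΦ]; rfl⟩
  | succ k ih =>
    obtain ⟨Φ, hΦ⟩ := ih
    exact ⟨fun x => inheritFlags (Φ x.tail) (x.headD []), fun ω => by
      rw [unmarkedDescendants, hΦ]; rfl⟩

theorem measurable_count_unmarkedDescendants (n k : ℕ) :
    Measurable fun ω => (unmarkedDescendants ω n k).count true := by
  obtain ⟨Φ, hΦ⟩ := exists_unmarkedDescendants_eq n k
  simp only [hΦ]
  exact (measurable_from_top (f := fun h : MarkedHistory => (Φ h.1).count true)).comp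
    (measurable_markedHistory (n + k))

/-- One Galton–Watson step: conditionally on the history, the flagged vertices have independent
critical geometric offspring. -/
theorem lintegral_pow_count_unmarkedDescendants_succ (a : ℝ≥0) (n k : ℕ) (t : ℝ≥0∞) :
    ∫⁻ ω, t ^ (unmarkedDescendants ω n (k + 1)).count true ∂(markedTreeMeasure a) =
      ∫⁻ ω, (2⁻¹ * (1 - t / 2)⁻¹) ^ (unmarkedDescendants ω n k).count true
        ∂(markedTreeMeasure a) := by
  obtain ⟨Φ, hΦ⟩ := exists_unmarkedDescendants_eq n k
  have h := lintegral_markedHistory a (n + k)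
    (F := fun h w => t ^ flaggedChildren (Φ h.1) (chosenOffspring h.2 w).1)
    fun h => measurable_of_chosenOffspring h.2 fun e => t ^ flaggedChildren (Φ h.1) e
  have h1 : ∀ ω, t ^ (unmarkedDescendants ω n (k + 1)).count true =
      t ^ flaggedChildren (Φ (markedHistory ω (n + k)).1)
        (chosenOffspring (markedHistory ω (n + k)).2 (ω (n + k))).1 := by
    intro ω
    rw [unmarkedDescendants, count_inheritFlags, hΦ]
    rfl
  rw [lintegral_congr h1, h]
  refine lintegral_congr fun ω => ?_
  have hf : List.Forall₂ (fun d b => d = true → b = false) (Φ (markedHistory ω (n + k)).1)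
      (markedHistory ω (n + k)).2.1 := by
    rw [← hΦ]
    exact forall₂_unmarkedDescendants ω n k
  rw [lintegral_chosenOffspring a (markedHistory ω (n + k)).2
    fun e => t ^ flaggedChildren (Φ (markedHistory ω (n + k)).1) e]
  have h2 := fun p : ℕ => tsum_offspringWeight_mul t ((markedHistory ω (n + k)).2, p) hf
  rw [lintegral_congr h2, lintegral_const, measure_univ, mul_one, hΦ]

/-- The probability that a critical geometric branching process is extinct after `m` steps. -/
noncomputable def extinctionProbability (m : ℕ) : ℝ≥0∞ := ENNReal.ofReal (m / (m + 1))

/-- The values `m / (m + 1)` are the iterates of `t ↦ 1 / (2 - t)` started at `0`. -/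
theorem extinctionProbability_succ (m : ℕ) :
    2⁻¹ * (1 - extinctionProbability m / 2)⁻¹ = extinctionProbability (m + 1) := by
  have h2 : (2 : ℝ≥0∞) = ENNReal.ofReal 2 := by simp
  have h3 : (0 : ℝ) < 1 - m / (m + 1) / 2 := by
    have h4 : (m : ℝ) / (m + 1) < 1 := by rw [div_lt_one (by positivity)]; linarith
    linarith
  rw [extinctionProbability, extinctionProbability, h2, ← ENNReal.ofReal_div_of_pos two_pos,
    ← ENNReal.ofReal_one, ← ENNReal.ofReal_sub _ (by positivity), ← ENNReal.ofReal_inv_of_pos h3,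
    ← ENNReal.ofReal_inv_of_pos two_pos, ← ENNReal.ofReal_mul (by positivity)]
  congr 1
  push_cast
  have h5 : (1 - (m : ℝ) / (m + 1) / 2) = (m + 2) / (2 * (m + 1)) := by
    field_simp
    ring
  rw [h5]
  field_simp
  ring

theorem tendsto_extinctionProbability : Tendsto extinctionProbability atTop (𝓝 1) := by
  rw [← ENNReal.ofReal_one]
  exact ENNReal.tendsto_ofReal (tendsto_natCast_div_add_atTop 1)

theorem lintegral_pow_extinctionProbability (a : ℝ≥0) (n k m : ℕ) :
    ∫⁻ ω, extinctionProbability m ^ (unmarkedDescendants ω n k).count true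
      ∂(markedTreeMeasure a) =
    ∫⁻ ω, extinctionProbability (m + k) ^ (unmarkedDescendants ω n 0).count true
      ∂(markedTreeMeasure a) := by
  induction k generalizing m with
  | zero => rfl
  | succ k ih =>
    rw [lintegral_pow_count_unmarkedDescendants_succ, extinctionProbability_succ, ih,
      show m + 1 + k = m + (k + 1) by ring]

theorem markedTreeMeasure_count_unmarkedDescendants_eq_zero (a : ℝ≥0) (n k : ℕ) :
    markedTreeMeasure a {ω | (unmarkedDescendants ω n k).count true = 0} =
      ∫⁻ ω, extinctionProbability k ^ (unmarkedDescendants ω n 0).count true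
        ∂(markedTreeMeasure a) := by
  have h := lintegral_pow_extinctionProbability a n k 0
  rw [zero_add] at h
  have hm : MeasurableSet {ω | (unmarkedDescendants ω n k).count true = 0} :=
    measurable_count_unmarkedDescendants n k (measurableSet_singleton 0)
  rw [← h, ← lintegral_indicator_one hm]
  refine lintegral_congr fun ω => ?_
  -- At `t = 0` the generating function is the probability of extinction, as `0 ^ c` is the
  -- indicator of `c = 0`.
  rw [show extinctionProbability 0 = 0 by simp [extinctionProbability], zero_pow_eq]
  simp [Set.indicator_apply]

theorem ae_exists_count_unmarkedDescendants_eq_zero (a : ℝ≥0) (n : ℕ) :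
    ∀ᵐ ω ∂(markedTreeMeasure a), ∃ k, (unmarkedDescendants ω n k).count true = 0 := by
  have hm : ∀ k, MeasurableSet {ω | (unmarkedDescendants ω n k).count true = 0} :=
    fun k => measurable_count_unmarkedDescendants n k (measurableSet_singleton 0)
  have hset : {ω | ∃ k, (unmarkedDescendants ω n k).count true = 0} =
      ⋃ k, {ω | (unmarkedDescendants ω n k).count true = 0} := by
    ext ω
    simp
  have hlim : Tendsto (fun k => markedTreeMeasure a
      {ω | (unmarkedDescendants ω n k).count true = 0}) atTop (𝓝 1) := by
    simp only [markedTreeMeasure_count_unmarkedDescendants_eq_zero]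
    have h1 : (1 : ℝ≥0∞) = ∫⁻ _, 1 ∂(markedTreeMeasure a) := by simp
    rw [h1]
    refine tendsto_lintegral_of_dominated_convergence (fun _ => 1) (fun k => ?_) (fun k => ?_)
      (by simp) (Eventually.of_forall fun ω => ?_)
    · exact (measurable_from_top (f := fun c : ℕ => extinctionProbability k ^ c)).comp
        (measurable_count_unmarkedDescendants n 0)
    · refine Eventually.of_forall fun ω => pow_le_one₀ (by positivity) ?_
      rw [extinctionProbability, ENNReal.ofReal_le_one, div_le_one (by positivity)]
      linarith
    · have h2 := (ENNReal.continuous_pow ((unmarkedDescendants ω n 0).count true)).tendsto 1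
      rw [one_pow] at h2
      exact h2.comp tendsto_extinctionProbability
  have hmeas : MeasurableSet {ω | ∃ k, (unmarkedDescendants ω n k).count true = 0} := by
    rw [hset]
    exact MeasurableSet.iUnion hm
  refine (mem_ae_iff_prob_eq_one hmeas).2 (le_antisymm prob_le_one (le_of_tendsto' hlim fun k => ?_))
  exact measure_mono fun ω hω => ⟨k, hω⟩

theorem Nat.count_length_eq {p : ℕ → Prop} [DecidablePred p] {l : List Bool}
    (h : ∀ i < l.length, p i ↔ l[i]? = some true) : Nat.count p l.length = l.count true := by
  induction l using List.reverseRecOn with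
  | nil => simp
  | append_singleton l b ih =>
    have h1 := h l.length (by simp)
    rw [List.getElem?_append_right le_rfl, Nat.sub_self, List.getElem?_cons_zero] at h1
    rw [List.length_append, List.length_singleton, Nat.count_succ, List.count_append, ih]
    · cases b <;> simp [h1]
    · intro i hi
      rw [h i (by simp; omega), List.getElem?_append_left hi]

open Classical in
theorem PlanarTree.width_spine {T : PlanarTree} (hT : T.size = ⊤) (r : ℕ) :
    T.spine.width r = Nat.count (T.IsInfType r) (T.width r) := by
  rw [spine, dif_pos hT]
  rfl

/-- Almost surely, the vertices of infinite type are the marked vertices. -/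
theorem ae_width_spine_markedTree (a : ℝ≥0) : ∀ᵐ ω ∂(markedTreeMeasure a), ∀ n,
    (markedTree ω).spine.width (n + 1) = 1 + ∑ i ∈ Finset.range n, (ω i).1 := by
  classical
  rw [ae_all_iff]
  intro n
  filter_upwards [ae_exists_count_unmarkedDescendants_eq_zero a n] with ω hω
  obtain ⟨k, hk⟩ := hω
  rw [PlanarTree.width_spine (size_markedTree ω), ← count_markedLevel, width_markedTree_succ]
  refine Nat.count_length_eq fun i hi => ⟨fun h => ?_, isInfType_of_marked⟩
  rw [List.getElem?_eq_getElem hi]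
  by_contra hn
  refine not_isInfType_of_unmarked hk ?_ h
  rw [List.getElem?_eq_getElem hi]
  simpa using hn

end Extinction

/-! ### Measurability of the spine map. -/

section SpineMeasurable

namespace PlanarTree

theorem isOpen_of_cylinder_subset {U : Set PlanarTree} (h : ∀ T ∈ U, ∃ n, cylinder n T ⊆ U) :
    IsOpen U := by
  rw [isOpen_iff_mem_nhds]
  intro T hT
  obtain ⟨n, hn⟩ := h T hT
  exact mem_of_superset ((isOpen_cylinder n T).mem_nhds (mem_cylinder_self n T)) hn

theorem measurable_width (r : ℕ) : Measurable fun T : PlanarTree => T.width r := by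
  refine measurable_to_countable' fun k => (isOpen_of_cylinder_subset fun T hT => ?_).measurableSet
  refine ⟨r, fun T' hT' => ?_⟩
  rw [Set.mem_preimage, width_eq_of_ball_eq hT' (Nat.le_succ r)]
  exact hT

theorem measurable_parent (r j : ℕ) : Measurable fun T : PlanarTree => T.parent r j := by
  refine measurable_to_countable' fun k => (isOpen_of_cylinder_subset fun T hT => ?_).measurableSet
  refine ⟨r, fun T' hT' => ?_⟩
  rw [Set.mem_preimage, ((ball_eq_ball_iff _ _ _).1 hT').2 r (by omega)]
  exact hT

theorem measurable_apply_nat {α β : Type*} [MeasurableSpace α] [MeasurableSpace β] {f : α → ℕ → β}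
    {g : α → ℕ} (hf : ∀ j, Measurable fun x => f x j) (hg : Measurable g) :
    Measurable fun x => f x (g x) := by
  have h : Measurable fun p : α × ℕ => f p.1 p.2 := measurable_from_prod_countable_left hf
  exact h.comp (measurable_id.prodMk hg)

theorem measurable_ancestor (r k j : ℕ) : Measurable fun T : PlanarTree => T.ancestor r k j := by
  induction k generalizing j with
  | zero => exact measurable_const
  | succ k ih =>
    exact measurable_apply_nat (f := fun T j => T.ancestor r k j) ih (measurable_parent (r + k) j)

/-- A set of pairs is infinite if and only if it leaves every finite set; there are countably many
of these. -/
theorem measurableSet_isInfType (r i : ℕ) : MeasurableSet {T : PlanarTree | T.IsInfType r i} := by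
  have hset : {T : PlanarTree | T.IsInfType r i} = ⋂ F : Finset (ℕ × ℕ), ⋃ v : ℕ × ℕ, ⋃ _ : v ∉ F,
      {T : PlanarTree | v ∈ T.descendants r i} := by
    ext T
    simp only [Set.mem_iInter, Set.mem_iUnion, Set.mem_ofPred_eq, exists_prop]
    constructor
    · intro h F
      obtain ⟨v, h1, h2⟩ := h.exists_notMem_finset F
      exact ⟨v, h2, h1⟩
    · intro h hfin
      obtain ⟨v, h1, h2⟩ := h hfin.toFinset
      exact h1 (hfin.mem_toFinset.2 h2)
  rw [hset]
  refine MeasurableSet.iInter fun F => MeasurableSet.iUnion fun v => MeasurableSet.iUnion fun _ => ?_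
  exact (measurable_width _ (measurableSet_Ioi (a := v.2))).inter
    (measurable_ancestor r (v.1 + 1) v.2 (measurableSet_singleton i))

theorem size_eq_top_iff (T : PlanarTree) : T.size = ⊤ ↔ T.IsInfType 0 0 := by
  refine ⟨isInfType_zero, fun h => Set.encard_eq_top_iff.2 (h.mono ?_)⟩
  rintro v ⟨hv, -⟩
  rwa [zero_add] at hv

open Classical in
theorem measurable_count_isInfType (r m : ℕ) :
    Measurable fun T : PlanarTree => Nat.count (T.IsInfType r) m := by
  induction m with
  | zero => exact measurable_const
  | succ m ih =>
    simp only [Nat.count_succ]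
    exact ih.add (Measurable.ite (measurableSet_isInfType r m) measurable_const measurable_const)

open Classical in
theorem measurable_spine : Measurable spine := by
  have hS : MeasurableSet {T : PlanarTree | T.size = ⊤} := by
    simp only [size_eq_top_iff]
    exact measurableSet_isInfType 0 0
  have hc : ∀ r, Measurable fun T : PlanarTree => Nat.count (T.IsInfType r) (T.width r) :=
    fun r => measurable_apply_nat (measurable_count_isInfType r) (measurable_width r)
  refine measurable_of_width_of_parent (fun r k => ?_) fun r j k => ?_
  · have hset : {T : PlanarTree | T.spine.width r = k} =
        ({T | T.size = ⊤} ∩ {T | Nat.count (T.IsInfType r) (T.width r) = k}) ∪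
          ({T | T.size = ⊤}ᶜ ∩ {T | T.width r = k}) := by
      ext T
      by_cases hT : T.size = ⊤
      · simp [hT, width_spine hT]
      · simp [hT, spine]
    rw [hset]
    exact (hS.inter (hc r (measurableSet_singleton k))).union
      (hS.compl.inter (measurable_width r (measurableSet_singleton k)))
  -- The function `Nat.nth` is eliminated: the vertex with new number `j` is the `n` of infinite
  -- type that has exactly `j` predecessors of infinite type.
  · have hset : {T : PlanarTree | T.spine.parent r j = k} =
        ({T | T.size = ⊤} ∩ (({T | j < Nat.count (T.IsInfType (r + 1)) (T.width (r + 1))} ∩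
          ⋃ n : ℕ, {T | T.IsInfType (r + 1) n} ∩ {T | Nat.count (T.IsInfType (r + 1)) n = j} ∩
            {T | Nat.count (T.IsInfType r) (T.parent r n) = k}) ∪
          ({T | j < Nat.count (T.IsInfType (r + 1)) (T.width (r + 1))}ᶜ ∩ {_T | 0 = k}))) ∪
          ({T | T.size = ⊤}ᶜ ∩ {T | T.parent r j = k}) := by
      ext T
      by_cases hT : T.size = ⊤
      · have h1 : T.spine.parent r j =
            if j < Nat.count (T.IsInfType (r + 1)) (T.width (r + 1)) then
              Nat.count (T.IsInfType r) (T.parent r (Nat.nth (T.IsInfType (r + 1)) j)) else 0 := by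
          rw [spine, dif_pos hT]
          rfl
        by_cases hj : j < Nat.count (T.IsInfType (r + 1)) (T.width (r + 1))
        · have h2 : ∀ hf : (Set.ofPred (T.IsInfType (r + 1))).Finite, j < hf.toFinset.card :=
            fun hf => hj.trans_le (Nat.count_le_card hf _)
          simp only [Set.mem_ofPred_eq, Set.mem_union, Set.mem_inter_iff, Set.mem_iUnion,
            Set.mem_compl_iff, hT, hj, h1, if_pos, true_and, not_true, false_and, or_false]
          constructor
          · intro h
            exact ⟨_, ⟨Nat.nth_mem j h2, Nat.count_nth h2⟩, h⟩
          · rintro ⟨n, ⟨h3, h4⟩, h5⟩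
            rw [← h4, Nat.nth_count h3]
            exact h5
        · simp [hT, h1, hj]
      · simp [hT, spine]
    rw [hset]
    have hlt : MeasurableSet
        {T : PlanarTree | j < Nat.count (T.IsInfType (r + 1)) (T.width (r + 1))} :=
      hc (r + 1) (measurableSet_Ioi (a := j))
    refine (hS.inter ((hlt.inter (MeasurableSet.iUnion fun n => ?_)).union
      (hlt.compl.inter (MeasurableSet.const _)))).union
        (hS.compl.inter (measurable_parent r j (measurableSet_singleton k)))
    exact ((measurableSet_isInfType (r + 1) n).inter (measurable_count_isInfType (r + 1) n
      (measurableSet_singleton j))).inter (measurable_apply_nat (measurable_count_isInfType r)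
        (measurable_parent r n) (measurableSet_singleton k))

end PlanarTree

end SpineMeasurable

/-! ### Poisson moments, the strong law, and the law of the spine. -/

section SpineLaw

open ProbabilityTheory
open scoped NNReal

theorem hasSum_poisson_mean (a : ℝ≥0) :
    HasSum (fun n : ℕ => Real.exp (-a) * a ^ n / n.factorial * n) a := by
  have h := (hasSum_one_poissonMeasure a).mul_left (a : ℝ)
  rw [mul_one] at h
  refine (hasSum_nat_add_iff' 1).1 ?_
  simp only [Finset.range_one, Finset.sum_singleton, Nat.cast_zero, mul_zero, sub_zero]
  have e : ∀ n : ℕ, Real.exp (-a) * a ^ (n + 1) / (n + 1).factorial * ((n + 1 : ℕ) : ℝ) =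
      a * (Real.exp (-a) * a ^ n / n.factorial) := fun n => by
    rw [Nat.factorial_succ]
    push_cast
    field_simp
    rw [pow_succ, mul_comm]
  simpa only [e] using h

theorem integrable_natCast_poissonMeasure (a : ℝ≥0) :
    Integrable (fun n : ℕ => (n : ℝ)) (poissonMeasure a) := by
  rw [integrable_poissonMeasure_iff]
  simpa using (hasSum_poisson_mean a).summable

theorem integral_natCast_poissonMeasure (a : ℝ≥0) : ∫ n : ℕ, (n : ℝ) ∂(poissonMeasure a) = a := by
  rw [integral_poissonMeasure]
  simpa using (hasSum_poisson_mean a).tsum_eq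

/-- The number of additional marks in one generation. -/
def extraMarks (i : ℕ) (ω : ℕ → OffspringInput) : ℝ := (ω i).1

theorem measurePreserving_fst (a : ℝ≥0) (i : ℕ) :
    MeasurePreserving (fun ω : ℕ → OffspringInput => (ω i).1) (markedTreeMeasure a)
      (poissonMeasure a) :=
  (MeasureTheory.measurePreserving_fst (μ := poissonMeasure a)
    (ν := Measure.infinitePi fun i => (offspringPMF i).toMeasure)).comp
      (measurePreserving_eval_markedTreeMeasure a i)

theorem integrable_extraMarks (a : ℝ≥0) (i : ℕ) : Integrable (extraMarks i) (markedTreeMeasure a) :=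
  (measurePreserving_fst a i).integrable_comp_of_integrable (integrable_natCast_poissonMeasure a)

theorem integral_extraMarks (a : ℝ≥0) (i : ℕ) : ∫ ω, extraMarks i ω ∂(markedTreeMeasure a) = a := by
  rw [← integral_natCast_poissonMeasure a, ← (measurePreserving_fst a i).map_eq,
    integral_map (measurePreserving_fst a i).measurable.aemeasurable
      measurable_from_top.aestronglyMeasurable]
  rfl

theorem ae_tendsto_sum_extraMarks_div (a : ℝ≥0) : ∀ᵐ ω ∂(markedTreeMeasure a),
    Tendsto (fun n : ℕ => (∑ i ∈ Finset.range n, extraMarks i ω) / n) atTop (𝓝 a) := by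
  have hm : Measurable fun w : OffspringInput => (w.1 : ℝ) :=
    (measurable_from_top (f := fun n : ℕ => (n : ℝ))).comp measurable_fst
  have hind : iIndepFun extraMarks (markedTreeMeasure a) :=
    iIndepFun_infinitePi (X := fun _ (w : OffspringInput) => (w.1 : ℝ)) fun _ => hm
  have h := strong_law_ae_real extraMarks (integrable_extraMarks a 0)
    (fun i j hij => hind.indepFun hij) (fun i => ?_)
  · simpa only [integral_extraMarks] using h
  · have he := fun i => (measurePreserving_eval_markedTreeMeasure a i)
    refine ⟨(hm.comp (he i).measurable).aemeasurable, (hm.comp (he 0).measurable).aemeasurable, ?_⟩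
    show (markedTreeMeasure a).map (fun ω => ((ω i).1 : ℝ)) =
      (markedTreeMeasure a).map (fun ω => ((ω 0).1 : ℝ))
    rw [← Function.comp_def (fun w : OffspringInput => (w.1 : ℝ)) (fun ω : ℕ → OffspringInput => ω i),
      ← Function.comp_def (fun w : OffspringInput => (w.1 : ℝ)) (fun ω : ℕ → OffspringInput => ω 0),
      ← Measure.map_map hm (he i).measurable, ← Measure.map_map hm (he 0).measurable, (he i).map_eq,
      (he 0).map_eq]

/-- Cesàro summation with weights `i + 1`: the error `u (i + 1) - a * (i + 1)` is `o(i + 1)`, hence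
its partial sums are `o(n²)`. -/
theorem tendsto_sum_div_sq {u : ℕ → ℝ} {a : ℝ} (h : Tendsto (fun n : ℕ => u n / n) atTop (𝓝 a)) :
    Tendsto (fun n : ℕ => (∑ i ∈ Finset.Icc 1 n, u i) / (n : ℝ) ^ 2) atTop (𝓝 (a / 2)) := by
  have hs : ∀ n : ℕ, ∑ i ∈ Finset.range n, ((i : ℝ) + 1) = n * (n + 1) / 2 := by
    intro n
    induction n with
    | zero => simp
    | succ n ih =>
      rw [Finset.sum_range_succ, ih]
      push_cast
      ring
  have h1 : (fun i : ℕ => u (i + 1) - a * (i + 1)) =o[atTop] fun i : ℕ => (i : ℝ) + 1 := by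
    refine Asymptotics.isLittleO_of_tendsto (fun i hi => absurd hi (by positivity)) ?_
    have h2 := ((tendsto_add_atTop_iff_nat 1).2 h).sub_const a
    rw [sub_self] at h2
    refine h2.congr fun i => ?_
    push_cast
    field_simp
  have h2 := h1.sum_range (fun i => by positivity) (by
    simp only [hs]
    refine tendsto_atTop_mono (fun n => ?_) (tendsto_natCast_atTop_atTop (R := ℝ))
    rcases Nat.eq_zero_or_pos n with rfl | hn
    · simp
    · have : (1 : ℝ) ≤ n := by exact_mod_cast hn
      nlinarith)
  simp only [hs, Finset.sum_sub_distrib, ← Finset.mul_sum] at h2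
  have h3 := h2.tendsto_div_nhds_zero
  have h4 : Tendsto (fun n : ℕ => (1 + 1 / (n : ℝ)) / 2) atTop (𝓝 (1 / 2)) := by
    have := (tendsto_one_div_atTop_nhds_zero_nat (𝕜 := ℝ)).const_add 1 |>.div_const 2
    simpa using this
  have h5 := (h3.mul h4).add (h4.const_mul a)
  rw [zero_mul, zero_add, mul_one_div] at h5
  refine h5.congr' ?_
  filter_upwards [eventually_gt_atTop 0] with n hn
  have hn' : (0 : ℝ) < n := by exact_mod_cast hn
  have hIcc : ∑ i ∈ Finset.Icc 1 n, u i = ∑ i ∈ Finset.range n, u (i + 1) := by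
    rw [Finset.range_eq_Ico, Finset.sum_Ico_add' u 0 n 1]
    rfl
  rw [hIcc]
  field_simp
  ring

theorem PlanarTree.measurable_generationSize (r : ℕ) : Measurable (generationSize r) :=
  (measurable_from_top (f := fun n : ℕ => (n : ℝ))).comp (measurable_width r)

theorem PlanarTree.ballSize_eq_sum {r : ℕ} (hr : 1 ≤ r) :
    ballSize r = fun T => ∑ s ∈ Finset.Icc 1 r, generationSize s T := by
  funext T
  rw [ballSize, size_ball r hr, ENat.toNat_natCast]
  push_cast
  rfl

open PlanarTree

theorem ae_generationSize_spine (a : ℝ≥0) : ∀ᵐ ω ∂(markedTreeMeasure a), ∀ n,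
    generationSize (n + 1) (markedTree ω).spine = 1 + ∑ i ∈ Finset.range n, extraMarks i ω := by
  filter_upwards [ae_width_spine_markedTree a] with ω hω n
  rw [generationSize, hω n]
  push_cast
  rfl

theorem spineMeasure_map_markedTree (a : ℝ≥0) :
    spineMeasure ((markedTreeMeasure a).map markedTree) =
      (markedTreeMeasure a).map fun ω => (markedTree ω).spine :=
  Measure.map_map measurable_spine measurable_markedTree

theorem measurable_spine_markedTree : Measurable fun ω => (markedTree ω).spine :=
  measurable_spine.comp measurable_markedTree

theorem integrable_generationSize (a : ℝ≥0) (n : ℕ) : Integrable (generationSize (n + 1))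
    (spineMeasure ((markedTreeMeasure a).map markedTree)) := by
  rw [spineMeasure_map_markedTree, integrable_map_measure
    (measurable_generationSize _).aestronglyMeasurable measurable_spine_markedTree.aemeasurable]
  have h : Integrable (fun ω => 1 + ∑ i ∈ Finset.range n, extraMarks i ω) (markedTreeMeasure a) :=
    (integrable_const 1).add (integrable_finsetSum _ fun i _ => integrable_extraMarks a i)
  refine h.congr ?_
  filter_upwards [ae_generationSize_spine a] with ω hω
  exact (hω n).symm

theorem integral_generationSize (a : ℝ≥0) (n : ℕ) : ∫ T, generationSize (n + 1) T
    ∂(spineMeasure ((markedTreeMeasure a).map markedTree)) = a * n + 1 := by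
  rw [spineMeasure_map_markedTree, integral_map measurable_spine_markedTree.aemeasurable
    (measurable_generationSize _).aestronglyMeasurable]
  have h : ∀ᵐ ω ∂(markedTreeMeasure a), generationSize (n + 1) (markedTree ω).spine =
      1 + ∑ i ∈ Finset.range n, extraMarks i ω := by
    filter_upwards [ae_generationSize_spine a] with ω hω
    exact hω n
  rw [integral_congr_ae h, integral_add (integrable_const 1)
    (integrable_finsetSum _ fun i _ => integrable_extraMarks a i),
    integral_finsetSum _ fun i _ => integrable_extraMarks a i]
  simp only [integral_extraMarks, integral_const, Finset.sum_const, Finset.card_range]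
  simp
  ring

theorem ae_tendsto_generationSize_div (a : ℝ≥0) :
    ∀ᵐ T ∂(spineMeasure ((markedTreeMeasure a).map markedTree)),
      Tendsto (fun r : ℕ => generationSize r T / r) atTop (𝓝 a) := by
  rw [spineMeasure_map_markedTree, ae_map_iff measurable_spine_markedTree.aemeasurable
    (measurableSet_tendsto_fun (fun r => (measurable_generationSize r).div_const _)
      measurable_const)]
  filter_upwards [ae_generationSize_spine a, ae_tendsto_sum_extraMarks_div a] with ω h1 h2
  rw [← tendsto_add_atTop_iff_nat 1]
  have h3 := (h2.mul (tendsto_natCast_div_add_atTop (1 : ℝ))).add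
    (tendsto_one_div_add_atTop_nhds_zero_nat (𝕜 := ℝ))
  rw [mul_one, add_zero] at h3
  refine h3.congr' ?_
  filter_upwards [eventually_gt_atTop 0] with n hn
  have hn' : (0 : ℝ) < n := by exact_mod_cast hn
  rw [h1 n]
  push_cast
  field_simp
  ring

end SpineLaw

/-! ### Assembly of the main theorem. -/

theorem mainTheorem10 (μ : ℝ) (hμ : 0 < μ) :
    (∃! ν : Measure PlanarTree, PlanarTree.IsLocalLimit μ ν) ∧
    ∀ ν : Measure PlanarTree, PlanarTree.IsLocalLimit μ ν →
      (∀ᵐ T ∂ν, T.size = ⊤) ∧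
      AEMeasurable PlanarTree.spine ν ∧
      (∀ r : ℕ, 1 ≤ r →
        Integrable (PlanarTree.generationSize r) (PlanarTree.spineMeasure ν) ∧
        ∫ T, PlanarTree.generationSize r T ∂(PlanarTree.spineMeasure ν) = μ * (r - 1) + 1) ∧
      (∀ r : ℕ, 1 ≤ r →
        Integrable (PlanarTree.ballSize r) (PlanarTree.spineMeasure ν) ∧
        ∫ T, PlanarTree.ballSize r T ∂(PlanarTree.spineMeasure ν) = μ * r * (r - 1) / 2 + r) ∧
      (∀ᵐ T ∂(PlanarTree.spineMeasure ν),
        Tendsto (fun r : ℕ => PlanarTree.generationSize r T / r) atTop (𝓝 μ)) ∧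
      (∀ᵐ T ∂(PlanarTree.spineMeasure ν),
        Tendsto (fun r : ℕ => PlanarTree.ballSize r T / (r : ℝ) ^ 2) atTop (𝓝 (μ / 2))) := by
  lift μ to NNReal using hμ.le
  have hlim := isLocalLimit_map_markedTree (a := μ) hμ
  refine ⟨⟨_, hlim, fun ν hν => hν.unique hlim⟩, fun ν hν => ?_⟩
  -- By uniqueness of weak limits, every local limit is the law of the explicit random tree.
  obtain rfl := hν.unique hlim
  have hint : ∀ r : ℕ, 1 ≤ r → Integrable (PlanarTree.generationSize r)
      (PlanarTree.spineMeasure ((markedTreeMeasure μ).map markedTree)) := by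
    intro r hr
    obtain ⟨n, rfl⟩ := Nat.exists_eq_add_of_le' hr
    exact integrable_generationSize μ n
  have hval : ∀ r : ℕ, 1 ≤ r → ∫ T, PlanarTree.generationSize r T
      ∂(PlanarTree.spineMeasure ((markedTreeMeasure μ).map markedTree)) = μ * (r - 1) + 1 := by
    intro r hr
    obtain ⟨n, rfl⟩ := Nat.exists_eq_add_of_le' hr
    rw [integral_generationSize]
    push_cast
    ring
  refine ⟨?_, PlanarTree.measurable_spine.aemeasurable, fun r hr => ⟨hint r hr, hval r hr⟩,
    fun r hr => ?_, ae_tendsto_generationSize_div μ, ?_⟩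
  · have hS : MeasurableSet {T : PlanarTree | T.size = ⊤} := by
      simp only [PlanarTree.size_eq_top_iff]
      exact PlanarTree.measurableSet_isInfType 0 0
    rw [ae_map_iff measurable_markedTree.aemeasurable hS]
    exact Eventually.of_forall size_markedTree
  · have hmem : ∀ s ∈ Finset.Icc 1 r, 1 ≤ s := fun s hs => (Finset.mem_Icc.1 hs).1
    rw [PlanarTree.ballSize_eq_sum hr]
    refine ⟨integrable_finsetSum _ fun s hs => hint s (hmem s hs), ?_⟩
    rw [integral_finsetSum _ fun s hs => hint s (hmem s hs),
      Finset.sum_congr rfl fun s hs => hval s (hmem s hs)]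
    -- The closed form also holds for `r = 0`, where the sum is empty, so the induction can start
    -- there.
    clear hmem hr
    induction r with
    | zero => simp
    | succ r ih =>
      rw [Finset.sum_Icc_succ_top (by omega), ih]
      push_cast
      ring
  · filter_upwards [ae_tendsto_generationSize_div μ] with T hT
    refine (tendsto_sum_div_sq hT).congr' ?_
    filter_upwards [eventually_ge_atTop 1] with r hr
    rw [PlanarTree.ballSize_eq_sum hr]
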